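/- Let $X$ be a compact connected Riemann surface, $S\subset X$ a finite subset (regarded as a reduced effective divisor) and $r\ge 2$ an integer. If $r$ is even, fix a holomorphic line bundle $\mathcal L$ on $X$ with $\mathcal L^{\otimes 2}\cong TX\otimes\mathcal O_X(S)$. Let $(V,\mathcal F,D)$ be a branched $\mathrm{SL}(r,\mathbb C)$-oper on $X$ with branching over $S$. This means the following. $V$ is a holomorphic vector bundle of rank $r$ with an isomorphism $\bigwedge^r V\cong\mathcal O_X$; $\mathcal F$ is a filtration $0=F_0\subset F_1\subset\dots\subset F_r=V$ by holomorphic subbundles with $\operatorname{rank}F_i=i$; $D$ is a holomorphic connection on $V$ which induces the de Rham differential $d$ on $\bigwedge^rV\cong\mathcal O_X$ and satisfies $D(F_i)\subset F_{i+1}\otimes K_X$ for $1\le i\le r-1$. There are isomorphisms $F_1\cong(\mathcal L^{\otimes(r-1)})^*$ if $r$ is even, $F_1\cong\big((TX\otimes\mathcal O_X(S))^{\otimes (r-1)/2}\big)^*$ if $r$ is odd, and $F_{j+1}/F_j\cong F_1\otimes(TX\otimes\mathcal O_X(S))^{\otimes j}$ for $0\le j\le r-1$, through which the second fundamental form $F_i/F_{i-1}\to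 (F_{i+1}/F_i)\otimes K_X\cong(F_i/F_{i-1})\otimes\mathcal O_X(S)$ is the natural inclusion for $1\le i\le r-1$. Put $Q=F_r/F_{r-1}$ and $E=J^{r-1}(Q)\otimes\mathcal O_X(-(r-1)S)$. There is a holomorphic homomorphism $\Phi:V\to J^{r-1}(Q)$ which sends the value $s(x)$ of a local $D$-flat section $s$ to the $(r-1)$-jet at $x$ of the image of $s$ in $Q$; it is an isomorphism over $X\setminus S$. Let $\mathcal D$ be the connection on $E|_{X\setminus S}$ that corresponds to $D$ under $\Phi$ and the natural isomorphism $E|_{X\setminus S}\cong J^{r-1}(Q)|_{X\setminus S}$. Then $\det E$ is isomorphic to $\mathcal O_X\left(-\frac{r(r-1)}2S\right)$, and for every holomorphic isomorphism $\det E\cong\mathcal O_X\left(-\frac{r(r-1)}2S\right)$ the connection on $\det E|_{X\setminus S}$ induced by $\mathcal D$ coincides with the restriction of the logarithmic connection on $\mathcal O_X\left(-\frac{r(r-1)}2S\right)$, singular over $S$, given by the de Rham differential $f\mapsto df$. In particular the connection induced on $\det E$ extends to a logarithmic connection on $\det E$ over $X$. -/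

import Mathlib

open scoped Manifold ContDiff Topology
open Bundle

namespace HolGeom

universe u v

noncomputable section

section Basic

variable {X : Type u} [TopologicalSpace X] [ChartedSpace ℂ X]

/-- `s` is a holomorphic section of the bundle `V` over the set `W` (used for open `W`; the values
of `s` outside `W` are irrelevant). -/
def IsHolSection (F : Type) [NormedAddCommGroup F] [NormedSpace ℂ F] {V : X → Type v}
    [TopologicalSpace (TotalSpace F V)] [∀ x, TopologicalSpace (V x)] [FiberBundle F V]
    (s : Π x, V x) (W : Set X) : Prop :=
  ContMDiffOn 𝓘(ℂ, ℂ) (𝓘(ℂ, ℂ).prod 𝓘(ℂ, F)) ω (fun x => TotalSpace.mk' F x (s x)) W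

end Basic

/-- A holomorphic vector bundle on `X` with model fibre `F`, given by a holomorphic cocycle.
The fibre at `x` is written in the preferred local frame at `x`, namely `core.indexAt x`. -/
structure HolBundle (X : Type u) [TopologicalSpace X] [ChartedSpace ℂ X]
    (F : Type) [NormedAddCommGroup F] [NormedSpace ℂ F] where
  ι : Type u
  core : VectorBundleCore ℂ X F ι
  hol : core.IsContMDiff 𝓘(ℂ, ℂ) ω

/-- A holomorphic line bundle. -/
abbrev HolLine (X : Type u) [TopologicalSpace X] [ChartedSpace ℂ X] := HolBundle X ℂ

section Constructions

variable {X : Type u} [TopologicalSpace X] [ChartedSpace ℂ X]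
variable {F : Type} [NormedAddCommGroup F] [NormedSpace ℂ F]

/-- The fibres of the bundle. -/
abbrev HolBundle.Fiber (E : HolBundle X F) : X → Type := E.core.Fiber

theorem clm_comm (a b : ℂ →L[ℂ] ℂ) (v : ℂ) : a (b v) = b (a v) := by
  have ha : ∀ w, a w = w * a 1 := fun w => by
    have := a.map_smul w 1; simpa using this
  have hb : ∀ w, b w = w * b 1 := fun w => by
    have := b.map_smul w 1; simpa using this
  rw [ha (b v), hb v, hb (a v), ha v]; ring

theorem HolBundle.contMDiffOn (E : HolBundle X F) (i j : E.ι) :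
    ContMDiffOn 𝓘(ℂ, ℂ) 𝓘(ℂ, F →L[ℂ] F) ω (E.core.coordChange i j)
      (E.core.baseSet i ∩ E.core.baseSet j) :=
  E.hol.1 i j

theorem HolBundle.contMDiffOn_one (L : HolLine X) (i j : L.ι) :
    ContMDiffOn 𝓘(ℂ, ℂ) 𝓘(ℂ, ℂ) ω (fun x => L.core.coordChange i j x 1)
      (L.core.baseSet i ∩ L.core.baseSet j) :=
  (L.contMDiffOn i j).clm_apply contMDiffOn_const

/-- The tensor product of a holomorphic vector bundle `E` with a holomorphic line bundle `L`. -/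
def HolBundle.twist (E : HolBundle X F) (L : HolLine X) : HolBundle X F :=
  have hol : ∀ p q : E.ι × L.ι, ContMDiffOn 𝓘(ℂ, ℂ) 𝓘(ℂ, F →L[ℂ] F) ω
      (fun x => (L.core.coordChange p.2 q.2 x 1 : ℂ) • E.core.coordChange p.1 q.1 x)
      ((E.core.baseSet p.1 ∩ L.core.baseSet p.2) ∩ (E.core.baseSet q.1 ∩ L.core.baseSet q.2)) :=
    fun p q => ((L.contMDiffOn_one p.2 q.2).mono fun _ h => ⟨h.1.2, h.2.2⟩).smul
      ((E.contMDiffOn p.1 q.1).mono fun _ h => ⟨h.1.1, h.2.1⟩)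
  { ι := E.ι × L.ι
    core :=
      { baseSet := fun p => E.core.baseSet p.1 ∩ L.core.baseSet p.2
        isOpen_baseSet := fun p => (E.core.isOpen_baseSet _).inter (L.core.isOpen_baseSet _)
        indexAt := fun x => (E.core.indexAt x, L.core.indexAt x)
        mem_baseSet_at := fun x => ⟨E.core.mem_baseSet_at x, L.core.mem_baseSet_at x⟩
        coordChange := fun p q x =>
          (L.core.coordChange p.2 q.2 x 1 : ℂ) • E.core.coordChange p.1 q.1 x
        coordChange_self := fun p x hx w => by
          simp [E.core.coordChange_self _ x hx.1, L.core.coordChange_self _ x hx.2]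
        continuousOn_coordChange := fun p q => (hol p q).continuousOn
        coordChange_comp := fun p q t x hx w => by
          have h1 := E.core.coordChange_comp p.1 q.1 t.1 x ⟨⟨hx.1.1.1, hx.1.2.1⟩, hx.2.1⟩ w
          have h2 := L.core.coordChange_comp p.2 q.2 t.2 x ⟨⟨hx.1.1.2, hx.1.2.2⟩, hx.2.2⟩ 1
          have h3 := (L.core.coordChange q.2 t.2 x).map_smul (L.core.coordChange p.2 q.2 x 1) 1
          simp only [smul_eq_mul, mul_one] at h3
          simp only [smul_apply, map_smul, smul_smul]
          rw [h1, ← h2, h3, mul_comm] }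
    hol := ⟨hol⟩ }

/-- The dual of a holomorphic line bundle: the inverse cocycle. -/
def HolBundle.dual (L : HolLine X) : HolLine X :=
  have hol : ∀ i j, ContMDiffOn 𝓘(ℂ, ℂ) 𝓘(ℂ, ℂ →L[ℂ] ℂ) ω (L.core.coordChange j i)
      (L.core.baseSet i ∩ L.core.baseSet j) :=
    fun i j => (L.contMDiffOn j i).mono fun _ h => ⟨h.2, h.1⟩
  { ι := L.ι
    core :=
      { baseSet := L.core.baseSet
        isOpen_baseSet := L.core.isOpen_baseSet
        indexAt := L.core.indexAt
        mem_baseSet_at := L.core.mem_baseSet_at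
        coordChange := fun i j => L.core.coordChange j i
        coordChange_self := L.core.coordChange_self
        continuousOn_coordChange := fun i j => (hol i j).continuousOn
        coordChange_comp := fun i j k x hx w => by
          rw [clm_comm]
          exact L.core.coordChange_comp k j i x ⟨⟨hx.2, hx.1.2⟩, hx.1.1⟩ w }
    hol := ⟨hol⟩ }

variable (X) in
/-- The trivial line bundle. -/
def HolBundle.trivial : HolLine X where
  ι := PUnit
  core := trivialVectorBundleCore ℂ X ℂ PUnit
  hol := ⟨fun _ _ => contMDiffOn_const⟩

/-- The tensor powers of a holomorphic line bundle. -/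
def HolBundle.pow (L : HolLine X) : ℕ → HolLine X
  | 0 => HolBundle.trivial X
  | n + 1 => (HolBundle.pow L n).twist L

variable (X) in
/-- The holomorphic tangent bundle `TX`. -/
def tangentLine [IsManifold 𝓘(ℂ, ℂ) ω X] : HolLine X :=
  have : IsManifold 𝓘(ℂ, ℂ) 1 X := .of_le (n := ω) le_top
  have : IsManifold 𝓘(ℂ, ℂ) (ω + 1) X := .of_le (n := ω) le_top
  { ι := atlas ℂ X
    core := tangentBundleCore 𝓘(ℂ, ℂ) X
    hol := tangentBundleCore.isContMDiff }

end Constructions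

section Divisor

variable {X : Type u} [TopologicalSpace X] [ChartedSpace ℂ X]

open Classical in
/-- The local equation of the reduced divisor `S` near `p`: a centred coordinate if `p ∈ S`, and the
constant `1` otherwise. -/
def localEq (S : Finset X) (p x : X) : ℂ := if p ∈ S then chartAt ℂ p x - chartAt ℂ p p else 1

open Classical in
/-- An open neighbourhood of `p` on which `localEq S p` is an equation of `S`. -/
def divisorBaseSet (S : Finset X) (p : X) : Set X :=
  if p ∈ S then (chartAt ℂ p).source \ ((S : Set X) \ {p}) else (S : Set X)ᶜ

theorem isOpen_divisorBaseSet [T1Space X] (S : Finset X) (p : X) :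
    IsOpen (divisorBaseSet S p) := by
  unfold divisorBaseSet
  split_ifs
  · exact (chartAt ℂ p).open_source.sdiff (S.finite_toSet.subset Set.sdiff_subset).isClosed
  · exact S.finite_toSet.isClosed.isOpen_compl

theorem mem_divisorBaseSet (S : Finset X) (p : X) : p ∈ divisorBaseSet S p := by
  unfold divisorBaseSet
  split_ifs with h
  · exact ⟨mem_chart_source ℂ p, by simp⟩
  · simpa using h

theorem localEq_ne_zero (S : Finset X) {p x : X} (hx : x ∈ divisorBaseSet S p) (hne : x ∉ S) :
    localEq S p x ≠ 0 := by
  unfold localEq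
  unfold divisorBaseSet at hx
  split_ifs with h
  · rw [if_pos h] at hx
    intro h0
    have := (chartAt ℂ p).injOn hx.1 (mem_chart_source ℂ p) (sub_eq_zero.1 h0)
    exact hne (this ▸ h)
  · exact one_ne_zero

theorem notMem_of_mem_divisorBaseSet (S : Finset X) {p q x : X} (hpq : p ≠ q)
    (hp : x ∈ divisorBaseSet S p) (hq : x ∈ divisorBaseSet S q) : x ∉ S := by
  intro hx
  unfold divisorBaseSet at hp hq
  split_ifs at hp with h1
  · split_ifs at hq with h2
    · have e1 : x = p := by
        by_contra h; exact hp.2 ⟨hx, h⟩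
      have e2 : x = q := by
        by_contra h; exact hq.2 ⟨hx, h⟩
      exact hpq (e1.symm.trans e2)
    · exact hq hx
  · exact hp hx

theorem contMDiffOn_localEq [IsManifold 𝓘(ℂ, ℂ) ω X] (S : Finset X) (p : X) :
    ContMDiffOn 𝓘(ℂ, ℂ) 𝓘(ℂ, ℂ) ω (localEq S p) (divisorBaseSet S p) := by
  by_cases h : p ∈ S
  · have : localEq S p = fun x => chartAt ℂ p x - chartAt ℂ p p := by
      ext x; simp [localEq, h]
    rw [this]
    refine ContMDiffOn.sub ?_ contMDiffOn_const
    refine (contMDiffOn_chart (x := p)).mono ?_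
    simp only [divisorBaseSet, h, if_true]
    exact Set.sdiff_subset
  · have : localEq S p = fun x => 1 := by
      ext x; simp [localEq, h]
    rw [this]; exact contMDiffOn_const

open Classical in
/-- The cocycle of `𝒪(kS)` for the local frames `(localEq S p) ^ (-k)`: the meromorphic function `h`
has the coordinate `h * (localEq S p) ^ k` in the frame with index `p`. -/
def divisorCoord (S : Finset X) (k : ℤ) (p q x : X) : ℂ :=
  if p = q then 1 else (localEq S q x / localEq S p x) ^ k

theorem contMDiffOn_divisorCoord [IsManifold 𝓘(ℂ, ℂ) ω X] (S : Finset X) (k : ℤ) (p q : X) :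
    ContMDiffOn 𝓘(ℂ, ℂ) 𝓘(ℂ, ℂ) ω (divisorCoord S k p q)
      (divisorBaseSet S p ∩ divisorBaseSet S q) := by
  by_cases h : p = q
  · have : divisorCoord S k p q = fun x => 1 := by
      ext x; simp [divisorCoord, h]
    rw [this]; exact contMDiffOn_const
  · have : divisorCoord S k p q = fun x => (localEq S q x / localEq S p x) ^ k := by
      ext x; simp [divisorCoord, h]
    rw [this]
    intro x hx
    have hS := notMem_of_mem_divisorBaseSet S h hx.1 hx.2
    have h1 := localEq_ne_zero S hx.1 hS
    have h2 := localEq_ne_zero S hx.2 hS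
    have hd : ContDiffAt ℂ ω (fun z : ℂ × ℂ => (z.2 / z.1) ^ k)
        (localEq S p x, localEq S q x) := by
      apply AnalyticAt.contDiffAt
      exact (analyticAt_snd.div analyticAt_fst h1).zpow (div_ne_zero h2 h1)
    exact hd.contMDiffAt.comp_contMDiffWithinAt x
      ((((contMDiffOn_localEq S p).mono Set.inter_subset_left) x hx).prodMk_space
        (((contMDiffOn_localEq S q).mono Set.inter_subset_right) x hx))

theorem divisorCoord_comp (S : Finset X) (k : ℤ) (p q t x : X)
    (hx : x ∈ divisorBaseSet S p ∩ divisorBaseSet S q ∩ divisorBaseSet S t) :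
    divisorCoord S k q t x * divisorCoord S k p q x = divisorCoord S k p t x := by
  by_cases h1 : p = q
  · subst h1; simp [divisorCoord]
  by_cases h2 : q = t
  · subst h2; simp [divisorCoord]
  have hS := notMem_of_mem_divisorBaseSet S h1 hx.1.1 hx.1.2
  have hp := localEq_ne_zero S hx.1.1 hS
  have hq := localEq_ne_zero S hx.1.2 hS
  have ht := localEq_ne_zero S hx.2 hS
  by_cases h3 : p = t
  · subst h3
    simp only [divisorCoord, h1, h2, if_false, if_true]
    rw [← mul_zpow]
    rw [div_mul_div_cancel₀ hq, div_self hp, one_zpow]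
  · simp only [divisorCoord, h1, h2, h3, if_false]
    rw [← mul_zpow, div_mul_div_cancel₀ hq]

/-- The line bundle `𝒪(kS)`. -/
def divisorBundle [T1Space X] [IsManifold 𝓘(ℂ, ℂ) ω X] (S : Finset X) (k : ℤ) : HolLine X :=
  have hol : ∀ p q : X, ContMDiffOn 𝓘(ℂ, ℂ) 𝓘(ℂ, ℂ →L[ℂ] ℂ) ω
      (fun x => divisorCoord S k p q x • ContinuousLinearMap.id ℂ ℂ)
      (divisorBaseSet S p ∩ divisorBaseSet S q) :=
    fun p q => (contMDiffOn_divisorCoord S k p q).smul contMDiffOn_const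
  { ι := X
    core :=
      { baseSet := divisorBaseSet S
        isOpen_baseSet := isOpen_divisorBaseSet S
        indexAt := fun x => x
        mem_baseSet_at := mem_divisorBaseSet S
        coordChange := fun p q x => divisorCoord S k p q x • ContinuousLinearMap.id ℂ ℂ
        coordChange_self := fun p x _ w => by simp [divisorCoord]
        continuousOn_coordChange := fun p q => (hol p q).continuousOn
        coordChange_comp := fun p q t x hx w => by
          simp [← divisorCoord_comp S k p q t x hx, mul_assoc] }
    hol := ⟨hol⟩ }

end Divisor
section Jet

variable {X : Type u} [TopologicalSpace X] [ChartedSpace ℂ X]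

/-- The matrix which carries the derivatives of order `< r` of a function `h` at `z₀ = φ w₀` to those
of `w ↦ G w * h (φ w)` at `w₀`. -/
def jetMatrix (G φ : ℂ → ℂ) (r : ℕ) (z₀ w₀ : ℂ) : Matrix (Fin r) (Fin r) ℂ :=
  fun k l => iteratedDeriv k (fun w => G w * ((φ w - z₀) ^ (l : ℕ) / ((l : ℕ).factorial : ℂ))) w₀

/-- The Taylor polynomial with given derivatives at `z₀`. -/
def taylorPoly (r : ℕ) (a : Fin r → ℂ) (z₀ z : ℂ) : ℂ :=
  ∑ l : Fin r, a l * ((z - z₀) ^ (l : ℕ) / ((l : ℕ).factorial : ℂ))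

theorem analyticAt_taylorPoly (r : ℕ) (a : Fin r → ℂ) (z₀ z : ℂ) :
    AnalyticAt ℂ (taylorPoly r a z₀) z := by
  unfold taylorPoly
  fun_prop

theorem iteratedDeriv_taylorPoly (r : ℕ) (a : Fin r → ℂ) (z₀ : ℂ) (k : Fin r) :
    iteratedDeriv k (taylorPoly r a z₀) z₀ = a k := by
  unfold taylorPoly
  rw [iteratedDeriv_fun_sum (fun i _ => by fun_prop)]
  rw [Finset.sum_eq_single k]
  · have : (fun z : ℂ => a k * ((z - z₀) ^ (k : ℕ) / ((k : ℕ).factorial : ℂ)))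
      = fun z : ℂ => (a k / ((k : ℕ).factorial : ℂ)) * (z - z₀) ^ (k : ℕ) := by
      ext z; ring
    rw [this, iteratedDeriv_const_mul_field]
    rw [iteratedDeriv_comp_sub_const (n := (k : ℕ)) (f := fun z : ℂ => z ^ (k : ℕ))]
    have hk : ((k : ℕ).factorial : ℂ) ≠ 0 := by exact_mod_cast (Nat.factorial_ne_zero _)
    simp [Nat.descFactorial_self]
    field_simp
  · intro l _ hl
    have : (fun z : ℂ => a l * ((z - z₀) ^ (l : ℕ) / ((l : ℕ).factorial : ℂ)))
      = fun z : ℂ => (a l / ((l : ℕ).factorial : ℂ)) * (z - z₀) ^ (l : ℕ) := by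
      ext z; ring
    rw [this, iteratedDeriv_const_mul_field]
    rw [iteratedDeriv_comp_sub_const (n := (k : ℕ)) (f := fun z : ℂ => z ^ (l : ℕ))]
    have hl' : (k : ℕ) ≠ l := fun h => hl (Fin.ext h.symm)
    rcases lt_or_gt_of_ne hl' with h | h
    · simp [Nat.sub_ne_zero_of_lt h]
    · simp [Nat.descFactorial_eq_zero_iff_lt.2 h]
  · simp

theorem iteratedDeriv_mul_comp {G φ h : ℂ → ℂ} {w₀ : ℂ} {r : ℕ} (hG : AnalyticAt ℂ G w₀)
    (hφ : AnalyticAt ℂ φ w₀) (hh : AnalyticAt ℂ h (φ w₀)) (k : Fin r) :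
    iteratedDeriv k (fun w => G w * h (φ w)) w₀ =
      ∑ l : Fin r, jetMatrix G φ r (φ w₀) w₀ k l * iteratedDeriv l h (φ w₀) := by
  set P := taylorPoly r (fun l : Fin r => iteratedDeriv l h (φ w₀)) (φ w₀) with hP
  have hPa : AnalyticAt ℂ P (φ w₀) := analyticAt_taylorPoly _ _ _ _
  have hord : (r : ℕ∞) ≤ analyticOrderAt (h - P) (φ w₀) := by
    rw [natCast_le_analyticOrderAt_iff_iteratedDeriv_eq_zero (hh.sub hPa)]
    intro i hi
    rw [iteratedDeriv_sub (hh.contDiffAt) (hPa.contDiffAt)]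
    have := iteratedDeriv_taylorPoly r (fun l : Fin r => iteratedDeriv l h (φ w₀)) (φ w₀) ⟨i, hi⟩
    simp only at this
    rw [hP, this, sub_self]
  obtain ⟨u, hu, hu'⟩ := (natCast_le_analyticOrderAt (hh.sub hPa)).1 hord
  have hψ : AnalyticAt ℂ (fun w => φ w - φ w₀) w₀ := hφ.sub analyticAt_const
  have hψ1 : (1 : ℕ∞) ≤ analyticOrderAt (fun w => φ w - φ w₀) w₀ := by
    rw [Order.one_le_iff_ne_zero]
    exact hψ.analyticOrderAt_ne_zero.2 (by simp)
  have huφ : AnalyticAt ℂ (fun w => u (φ w)) w₀ := AnalyticAt.fun_comp hu hφ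
  have hhφ : AnalyticAt ℂ (fun w => h (φ w)) w₀ := AnalyticAt.fun_comp hh hφ
  have hPφ : AnalyticAt ℂ (fun w => P (φ w)) w₀ := AnalyticAt.fun_comp hPa hφ
  have hdiff : AnalyticAt ℂ (fun w => G w * h (φ w) - G w * P (φ w)) w₀ :=
    (hG.mul hhφ).sub (hG.mul hPφ)
  have key : iteratedDeriv k (fun w => G w * h (φ w) - G w * P (φ w)) w₀ = 0 := by
    refine (natCast_le_analyticOrderAt_iff_iteratedDeriv_eq_zero hdiff).1 ?_ k k.2
    rw [natCast_le_analyticOrderAt hdiff]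
    obtain ⟨ψ, hψa, hψ'⟩ := (natCast_le_analyticOrderAt (n := 1) hψ).1 (by exact_mod_cast hψ1)
    refine ⟨fun w => G w * (ψ w ^ r * u (φ w)), hG.mul ((hψa.pow r).mul huφ), ?_⟩
    filter_upwards [hφ.continuousAt.eventually hu', hψ'] with w h1 h2
    simp only [smul_eq_mul, Pi.sub_apply, pow_one] at h1 h2 ⊢
    rw [← mul_sub, h1, h2, mul_pow]; ring
  have hsub := iteratedDeriv_sub (n := (k : ℕ)) (hG.mul hhφ).contDiffAt (hG.mul hPφ).contDiffAt
  replace key := hsub.symm.trans key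
  rw [sub_eq_zero] at key
  change iteratedDeriv k (fun w => G w * h (φ w)) w₀ =
    iteratedDeriv k (fun w => G w * P (φ w)) w₀ at key
  rw [key]
  have e : (fun w => G w * P (φ w)) = fun w => ∑ l : Fin r, iteratedDeriv l h (φ w₀) *
      (G w * ((φ w - φ w₀) ^ (l : ℕ) / ((l : ℕ).factorial : ℂ))) := by
    ext w; rw [hP]; unfold taylorPoly; rw [Finset.mul_sum]
    exact Finset.sum_congr rfl fun l _ => by ring
  rw [e, iteratedDeriv_fun_sum (fun l _ => by
    apply AnalyticAt.contDiffAt; fun_prop)]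
  refine Finset.sum_congr rfl fun l _ => ?_
  rw [iteratedDeriv_const_mul_field, mul_comm]
  rfl


theorem analyticAt_comp_symm [IsManifold 𝓘(ℂ, ℂ) ω X] {f : X → ℂ} {U : Set X} (hU : IsOpen U)
    (hf : ContMDiffOn 𝓘(ℂ, ℂ) 𝓘(ℂ, ℂ) ω f U) (c : atlas ℂ X) {x : X} (hx : x ∈ U)
    (hc : x ∈ c.1.source) : AnalyticAt ℂ (fun w => f (c.1.symm w)) (c.1 x) := by
  have h1 : ContMDiffAt 𝓘(ℂ, ℂ) 𝓘(ℂ, ℂ) ω c.1.symm (c.1 x) :=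
    contMDiffAt_symm_of_mem_maximalAtlas (IsManifold.subset_maximalAtlas c.2) (c.1.map_source hc)
  have h2 : ContMDiffAt 𝓘(ℂ, ℂ) 𝓘(ℂ, ℂ) ω f (c.1.symm (c.1 x)) := by
    rw [c.1.left_inv hc]; exact hf.contMDiffAt (hU.mem_nhds hx)
  have h3 := h2.comp _ h1
  exact h3.contDiffAt.analyticAt

theorem contMDiffOn_chart_atlas [IsManifold 𝓘(ℂ, ℂ) ω X] (c : atlas ℂ X) :
    ContMDiffOn 𝓘(ℂ, ℂ) 𝓘(ℂ, ℂ) ω c.1 c.1.source :=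
  contMDiffOn_of_mem_maximalAtlas (IsManifold.subset_maximalAtlas c.2)

/-- The change of coordinates on `(r-1)`-jets of sections of `Q`. A coordinate system is given by a
local frame of `Q` and a chart of `X`; the coordinates of the jet of a section are the derivatives
of order `< r` of the function which represents the section. -/
def jetCoordChange (Q : HolLine X) (r : ℕ) (a b : Q.ι × atlas ℂ X) (x : X) :
    Matrix (Fin r) (Fin r) ℂ :=
  jetMatrix (fun w => Q.core.coordChange a.1 b.1 (b.2.1.symm w) 1)
    (fun w => a.2.1 (b.2.1.symm w)) r (a.2.1 x) (b.2.1 x)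

/-- The domain of a coordinate system for jets. -/
def jetBaseSet (Q : HolLine X) (a : Q.ι × atlas ℂ X) : Set X :=
  Q.core.baseSet a.1 ∩ a.2.1.source

theorem jetCoordChange_mulVec [IsManifold 𝓘(ℂ, ℂ) ω X] (Q : HolLine X) (r : ℕ)
    (a b : Q.ι × atlas ℂ X) {x : X} (ha : x ∈ jetBaseSet Q a) (hb : x ∈ jetBaseSet Q b)
    {h : ℂ → ℂ} (hh : AnalyticAt ℂ h (a.2.1 x)) (k : Fin r) :
    (jetCoordChange Q r a b x).mulVec (fun l => iteratedDeriv l h (a.2.1 x)) k =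
      iteratedDeriv k (fun w => Q.core.coordChange a.1 b.1 (b.2.1.symm w) 1 *
        h (a.2.1 (b.2.1.symm w))) (b.2.1 x) := by
  have hG := analyticAt_comp_symm ((Q.core.isOpen_baseSet a.1).inter (Q.core.isOpen_baseSet b.1))
    (HolBundle.contMDiffOn_one Q a.1 b.1) b.2 ⟨ha.1, hb.1⟩ hb.2
  have hφ := analyticAt_comp_symm a.2.1.open_source (contMDiffOn_chart_atlas a.2) b.2 ha.2 hb.2
  have e : a.2.1 (b.2.1.symm (b.2.1 x)) = a.2.1 x := by rw [b.2.1.left_inv hb.2]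
  have := iteratedDeriv_mul_comp (r := r) hG hφ (h := h) (by rw [e]; exact hh) k
  rw [this, e]
  rfl

theorem jetCoordChange_self [IsManifold 𝓘(ℂ, ℂ) ω X] (Q : HolLine X) (r : ℕ)
    (a : Q.ι × atlas ℂ X) {x : X} (ha : x ∈ jetBaseSet Q a) (v : Fin r → ℂ) :
    (jetCoordChange Q r a a x).mulVec v = v := by
  ext k
  have hv : v = fun l : Fin r => iteratedDeriv l (taylorPoly r v (a.2.1 x)) (a.2.1 x) := by
    ext l; rw [iteratedDeriv_taylorPoly]
  conv_lhs => rw [hv]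
  rw [jetCoordChange_mulVec Q r a a ha ha (analyticAt_taylorPoly _ _ _ _) k]
  conv_rhs => rw [hv]
  refine Filter.EventuallyEq.iteratedDeriv_eq _ ?_
  have h1 : ∀ᶠ w in 𝓝 (a.2.1 x), w ∈ a.2.1.target :=
    a.2.1.open_target.mem_nhds (a.2.1.map_source ha.2)
  have h2 : ∀ᶠ w in 𝓝 (a.2.1 x), a.2.1.symm w ∈ Q.core.baseSet a.1 := by
    apply (a.2.1.continuousAt_symm (a.2.1.map_source ha.2)).eventually
    rw [a.2.1.left_inv ha.2]
    exact (Q.core.isOpen_baseSet a.1).mem_nhds ha.1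
  filter_upwards [h1, h2] with w h1 h2
  rw [a.2.1.right_inv h1, Q.core.coordChange_self _ _ h2, one_mul]

theorem jetCoordChange_comp [IsManifold 𝓘(ℂ, ℂ) ω X] (Q : HolLine X) (r : ℕ)
    (a b c : Q.ι × atlas ℂ X) {x : X} (ha : x ∈ jetBaseSet Q a) (hb : x ∈ jetBaseSet Q b)
    (hc : x ∈ jetBaseSet Q c) (v : Fin r → ℂ) :
    (jetCoordChange Q r b c x).mulVec ((jetCoordChange Q r a b x).mulVec v) =
      (jetCoordChange Q r a c x).mulVec v := by
  set P := taylorPoly r v (a.2.1 x) with hP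
  have hPa : ∀ z, AnalyticAt ℂ P z := fun z => analyticAt_taylorPoly _ _ _ _
  have hv : v = fun l : Fin r => iteratedDeriv l P (a.2.1 x) := by
    ext l; rw [hP, iteratedDeriv_taylorPoly]
  have hab : (jetCoordChange Q r a b x).mulVec v = fun k : Fin r =>
      iteratedDeriv k (fun w => Q.core.coordChange a.1 b.1 (b.2.1.symm w) 1 *
        P (a.2.1 (b.2.1.symm w))) (b.2.1 x) := by
    ext k
    conv_lhs => rw [hv]
    exact jetCoordChange_mulVec Q r a b ha hb (hPa _) k
  have hG := analyticAt_comp_symm ((Q.core.isOpen_baseSet a.1).inter (Q.core.isOpen_baseSet b.1))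
    (HolBundle.contMDiffOn_one Q a.1 b.1) b.2 ⟨ha.1, hb.1⟩ hb.2
  have hφ := analyticAt_comp_symm a.2.1.open_source (contMDiffOn_chart_atlas a.2) b.2 ha.2 hb.2
  ext k
  rw [hab, jetCoordChange_mulVec Q r b c hb hc
    (h := fun w => Q.core.coordChange a.1 b.1 (b.2.1.symm w) 1 * P (a.2.1 (b.2.1.symm w)))
    (hG.mul ((hPa _).fun_comp hφ)) k]
  conv_rhs => rw [hv]
  rw [jetCoordChange_mulVec Q r a c ha hc (hPa _) k]
  refine Filter.EventuallyEq.iteratedDeriv_eq _ ?_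
  have h1 : ∀ᶠ w in 𝓝 (c.2.1 x), c.2.1.symm w ∈
      jetBaseSet Q a ∩ jetBaseSet Q b ∩ jetBaseSet Q c := by
    apply (c.2.1.continuousAt_symm (c.2.1.map_source hc.2)).eventually
    rw [c.2.1.left_inv hc.2]
    have ho : ∀ d, IsOpen (jetBaseSet Q d) := fun d =>
      (Q.core.isOpen_baseSet _).inter d.2.1.open_source
    exact (((ho a).inter (ho b)).inter (ho c)).mem_nhds ⟨⟨ha, hb⟩, hc⟩
  filter_upwards [h1] with w hw
  have e := Q.core.coordChange_comp a.1 b.1 c.1 _ ⟨⟨hw.1.1.1, hw.1.2.1⟩, hw.2.1⟩ 1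
  have e3 := (Q.core.coordChange b.1 c.1 (c.2.1.symm w)).map_smul
    (Q.core.coordChange a.1 b.1 (c.2.1.symm w) 1) 1
  simp only [smul_eq_mul, mul_one] at e3
  rw [b.2.1.left_inv hw.1.2.2, ← e, e3]
  ring

theorem contMDiffOn_jetCoordChange [IsManifold 𝓘(ℂ, ℂ) ω X] (Q : HolLine X) (r : ℕ)
    (a b : Q.ι × atlas ℂ X) (k l : Fin r) :
    ContMDiffOn 𝓘(ℂ, ℂ) 𝓘(ℂ, ℂ) ω (fun x => jetCoordChange Q r a b x k l)
      (jetBaseSet Q a ∩ jetBaseSet Q b) := by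
  intro x hx
  apply ContMDiffAt.contMDiffWithinAt
  set G : ℂ → ℂ := fun w => Q.core.coordChange a.1 b.1 (b.2.1.symm w) 1 with hGdef
  set φ : ℂ → ℂ := fun w => a.2.1 (b.2.1.symm w) with hφdef
  have hG : ∀ y ∈ jetBaseSet Q a ∩ jetBaseSet Q b, AnalyticAt ℂ G (b.2.1 y) := fun y hy =>
    analyticAt_comp_symm ((Q.core.isOpen_baseSet a.1).inter (Q.core.isOpen_baseSet b.1))
      (HolBundle.contMDiffOn_one Q a.1 b.1) b.2 ⟨hy.1.1, hy.2.1⟩ hy.2.2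
  have hφ : ∀ y ∈ jetBaseSet Q a ∩ jetBaseSet Q b, AnalyticAt ℂ φ (b.2.1 y) := fun y hy =>
    analyticAt_comp_symm a.2.1.open_source (contMDiffOn_chart_atlas a.2) b.2 hy.1.2 hy.2.2
  have ho : ∀ d, IsOpen (jetBaseSet Q d) := fun d =>
    (Q.core.isOpen_baseSet _).inter d.2.1.open_source
  have hU : jetBaseSet Q a ∩ jetBaseSet Q b ∈ 𝓝 x := ((ho a).inter (ho b)).mem_nhds hx
  have ha : ContMDiffAt 𝓘(ℂ, ℂ) 𝓘(ℂ, ℂ) ω a.2.1 x :=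
    (contMDiffOn_chart_atlas a.2).contMDiffAt (a.2.1.open_source.mem_nhds hx.1.2)
  have hb : ContMDiffAt 𝓘(ℂ, ℂ) 𝓘(ℂ, ℂ) ω b.2.1 x :=
    (contMDiffOn_chart_atlas b.2).contMDiffAt (b.2.1.open_source.mem_nhds hx.2.2)
  have hexp : ∀ y ∈ jetBaseSet Q a ∩ jetBaseSet Q b, jetCoordChange Q r a b y k l =
      ∑ m ∈ Finset.range (l + 1), ((-(a.2.1 y)) ^ ((l : ℕ) - m) *
        (((l : ℕ).choose m : ℂ) / ((l : ℕ).factorial : ℂ))) *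
        iteratedDeriv k (fun w => G w * φ w ^ m) (b.2.1 y) := by
    intro y hy
    have e : (fun w => G w * ((φ w - a.2.1 y) ^ (l : ℕ) / ((l : ℕ).factorial : ℂ))) =
        fun w => ∑ m ∈ Finset.range (l + 1), ((-(a.2.1 y)) ^ ((l : ℕ) - m) *
          (((l : ℕ).choose m : ℂ) / ((l : ℕ).factorial : ℂ))) * (G w * φ w ^ m) := by
      ext w
      rw [sub_eq_add_neg, add_pow, Finset.sum_div, Finset.mul_sum]
      exact Finset.sum_congr rfl fun m _ => by ring
    have h1 := hG y hy
    have h2 := hφ y hy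
    change iteratedDeriv k (fun w => G w * ((φ w - a.2.1 y) ^ (l : ℕ) /
      ((l : ℕ).factorial : ℂ))) (b.2.1 y) = _
    rw [e, iteratedDeriv_fun_sum (fun m _ => by
      apply AnalyticAt.contDiffAt; fun_prop)]
    refine Finset.sum_congr rfl fun m _ => ?_
    rw [iteratedDeriv_const_mul_field]
  refine ContMDiffAt.congr_of_eventuallyEq (f := fun y => ∑ m ∈ Finset.range (l + 1),
      ((-(a.2.1 y)) ^ ((l : ℕ) - m) *
        (((l : ℕ).choose m : ℂ) / ((l : ℕ).factorial : ℂ))) *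
        iteratedDeriv k (fun w => G w * φ w ^ m) (b.2.1 y)) ?_
    (Filter.eventually_of_mem hU hexp)
  refine contMDiffAt_finsetSum fun m _ => ?_
  refine ContMDiffAt.mul (ContMDiffAt.mul ?_ contMDiffAt_const) ?_
  · exact (ha.neg).pow _
  · have h1 := hG x hx
    have h2 := hφ x hx
    have h3 : AnalyticAt ℂ (fun w => G w * φ w ^ m) (b.2.1 x) := by fun_prop
    have h4 : AnalyticAt ℂ (iteratedDeriv k (fun w => G w * φ w ^ m)) (b.2.1 x) := by
      rw [iteratedDeriv_eq_iterate]; exact h3.iterated_deriv k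
    exact (h4.contDiffAt (n := ω)).contMDiffAt.comp x hb

/-- Matrices as continuous linear maps. -/
def matrixCLM (r : ℕ) : Matrix (Fin r) (Fin r) ℂ →ₗ[ℂ] ((Fin r → ℂ) →L[ℂ] (Fin r → ℂ)) :=
  (LinearMap.toContinuousLinearMap : ((Fin r → ℂ) →ₗ[ℂ] (Fin r → ℂ)) ≃ₗ[ℂ] _).toLinearMap ∘ₗ
    (Matrix.toLin' : Matrix (Fin r) (Fin r) ℂ ≃ₗ[ℂ] _).toLinearMap

theorem matrixCLM_apply (r : ℕ) (M : Matrix (Fin r) (Fin r) ℂ) (v : Fin r → ℂ) :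
    matrixCLM r M v = M.mulVec v := rfl

/-- The jet bundle `J^{r-1}(Q)`, of rank `r`. -/
def jetBundle [IsManifold 𝓘(ℂ, ℂ) ω X] (Q : HolLine X) (r : ℕ) : HolBundle X (Fin r → ℂ) :=
  have hol : ∀ a b : Q.ι × atlas ℂ X,
      ContMDiffOn 𝓘(ℂ, ℂ) 𝓘(ℂ, (Fin r → ℂ) →L[ℂ] (Fin r → ℂ)) ω
        (fun x => matrixCLM r (jetCoordChange Q r a b x))
        (jetBaseSet Q a ∩ jetBaseSet Q b) := fun a b => by
    have e : (fun x => matrixCLM r (jetCoordChange Q r a b x)) = fun x =>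
        ∑ k, ∑ l, jetCoordChange Q r a b x k l • matrixCLM r (Matrix.single k l 1) := by
      ext1 x
      conv_lhs => rw [Matrix.matrix_eq_sum_single (jetCoordChange Q r a b x)]
      rw [map_sum]
      refine Finset.sum_congr rfl fun k _ => ?_
      rw [map_sum]
      refine Finset.sum_congr rfl fun l _ => ?_
      rw [← map_smul, Matrix.smul_single, smul_eq_mul, mul_one]
    rw [e]
    refine contMDiffOn_finsetSum fun k _ => contMDiffOn_finsetSum fun l _ => ?_
    exact (contMDiffOn_jetCoordChange Q r a b k l).smul contMDiffOn_const
  { ι := Q.ι × atlas ℂ X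
    core :=
      { baseSet := jetBaseSet Q
        isOpen_baseSet := fun a => (Q.core.isOpen_baseSet _).inter a.2.1.open_source
        indexAt := fun x => (Q.core.indexAt x, achart ℂ x)
        mem_baseSet_at := fun x => ⟨Q.core.mem_baseSet_at x, mem_chart_source ℂ x⟩
        coordChange := fun a b x => matrixCLM r (jetCoordChange Q r a b x)
        coordChange_self := fun a x hx v => jetCoordChange_self Q r a hx v
        continuousOn_coordChange := fun a b => (hol a b).continuousOn
        coordChange_comp := fun a b c x hx v =>
          jetCoordChange_comp Q r a b c hx.1.1 hx.1.2 hx.2 v }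
    hol := ⟨hol⟩ }

/-- The `(r-1)`-jet at `x` of a section `σ` of `Q` which is holomorphic near `x`, as an element of
the fibre of `jetBundle Q r` at `x`. -/
def jetAt [IsManifold 𝓘(ℂ, ℂ) ω X] (Q : HolLine X) (r : ℕ) (σ : Π y, Q.Fiber y) (x : X) :
    (jetBundle Q r).Fiber x :=
  fun k : Fin r => iteratedDeriv k (fun w =>
    Q.core.coordChange (Q.core.indexAt ((chartAt ℂ x).symm w)) (Q.core.indexAt x)
      ((chartAt ℂ x).symm w) (σ ((chartAt ℂ x).symm w))) (chartAt ℂ x x)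

end Jet

section Connections

variable {X : Type u} [TopologicalSpace X] [ChartedSpace ℂ X]

instance instTopAddGroupFiber {F : Type} [NormedAddCommGroup F] [NormedSpace ℂ F]
    (E : HolBundle X F) (x : X) : IsTopologicalAddGroup (E.Fiber x) :=
  inferInstanceAs (IsTopologicalAddGroup F)

instance instContSMulFiber {F : Type} [NormedAddCommGroup F] [NormedSpace ℂ F]
    (E : HolBundle X F) (x : X) : ContinuousSMul ℂ (E.Fiber x) :=
  inferInstanceAs (ContinuousSMul ℂ F)

/-- A homomorphism of holomorphic vector bundles. -/
structure HolHom (F F' : Type) [NormedAddCommGroup F] [NormedSpace ℂ F]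
    [NormedAddCommGroup F'] [NormedSpace ℂ F'] (V V' : X → Type*)
    [TopologicalSpace (TotalSpace F V)] [∀ x, AddCommGroup (V x)] [∀ x, Module ℂ (V x)]
    [∀ x, TopologicalSpace (V x)] [FiberBundle F V]
    [TopologicalSpace (TotalSpace F' V')] [∀ x, AddCommGroup (V' x)] [∀ x, Module ℂ (V' x)]
    [∀ x, TopologicalSpace (V' x)] [FiberBundle F' V'] where
  toFun : Π x, V x →ₗ[ℂ] V' x
  hol : ∀ W : Set X, IsOpen W → ∀ s : Π x, V x, IsHolSection F s W →
    IsHolSection F' (fun x => toFun x (s x)) W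

/-- An isomorphism of holomorphic vector bundles. -/
structure HolIso (F F' : Type) [NormedAddCommGroup F] [NormedSpace ℂ F]
    [NormedAddCommGroup F'] [NormedSpace ℂ F'] (V V' : X → Type*)
    [TopologicalSpace (TotalSpace F V)] [∀ x, AddCommGroup (V x)] [∀ x, Module ℂ (V x)]
    [∀ x, TopologicalSpace (V x)] [FiberBundle F V]
    [TopologicalSpace (TotalSpace F' V')] [∀ x, AddCommGroup (V' x)] [∀ x, Module ℂ (V' x)]
    [∀ x, TopologicalSpace (V' x)] [FiberBundle F' V'] where
  toEquiv : Π x, V x ≃ₗ[ℂ] V' x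
  hol : ∀ W : Set X, IsOpen W → ∀ s : Π x, V x, IsHolSection F s W →
    IsHolSection F' (fun x => toEquiv x (s x)) W
  hol_symm : ∀ W : Set X, IsOpen W → ∀ s : Π x, V' x, IsHolSection F' s W →
    IsHolSection F (fun x => (toEquiv x).symm (s x)) W

variable (F : Type) [NormedAddCommGroup F] [NormedSpace ℂ F] (V : X → Type v)
  [TopologicalSpace (TotalSpace F V)] [∀ x, AddCommGroup (V x)] [∀ x, Module ℂ (V x)]
  [∀ x, TopologicalSpace (V x)] [∀ x, IsTopologicalAddGroup (V x)]
  [∀ x, ContinuousSMul ℂ (V x)] [FiberBundle F V]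

/-- A holomorphic connection on the restriction of `V` to `Ω`. Here `toFun s x` is the value at `x` of
the covariant derivative of `s`, an element of `V x ⊗ K x = Hom(T_x X, V x)`. -/
structure HolConnection [IsManifold 𝓘(ℂ, ℂ) ω X] (Ω : Set X) where
  toFun : (Π x, V x) → Π x, TangentSpace 𝓘(ℂ, ℂ) x →L[ℂ] V x
  isCov : IsCovariantDerivativeOn (I := 𝓘(ℂ, ℂ)) F toFun Ω
  hol : ∀ W : Set X, IsOpen W → W ⊆ Ω → ∀ (s : Π x, V x) (ξ : Π x : X, TangentSpace 𝓘(ℂ, ℂ) x),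
    IsHolSection F s W → IsHolSection ℂ ξ W → IsHolSection F (fun x => toFun s x (ξ x)) W

/-- A logarithmic connection on `V`, singular over `S`: a holomorphic connection `∇` over `X ∖ S` such
that `∇ s`, for a holomorphic section `s` on an open set `W`, is a section over `W` of
`V ⊗ K ⊗ 𝒪(S)`, that is, its contraction with every holomorphic vector field which vanishes on `S`
(a section of the dual of `K ⊗ 𝒪(S)`) extends to a holomorphic section of `V` over `W`. -/
structure LogConnection [IsManifold 𝓘(ℂ, ℂ) ω X] (S : Finset X) extends
    HolConnection F V ((S : Set X)ᶜ) where
  log : ∀ W : Set X, IsOpen W → ∀ (s : Π x, V x) (ξ : Π x : X, TangentSpace 𝓘(ℂ, ℂ) x),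
    IsHolSection F s W → IsHolSection ℂ ξ W → (∀ x ∈ W, x ∈ S → ξ x = 0) →
    ∃ t : Π x, V x, IsHolSection F t W ∧ ∀ x ∈ W, x ∉ S → t x = toFun s x (ξ x)

variable {V} in
/-- The subspaces `P x` of the fibres form a holomorphic subbundle of rank `k`. -/
def IsHolSubbundle (P : Π x, Submodule ℂ (V x)) (k : ℕ) : Prop :=
  ∀ x₀, ∃ W : Set X, IsOpen W ∧ x₀ ∈ W ∧ ∃ e : Fin k → Π x, V x,
    (∀ a, IsHolSection F (e a) W) ∧
    ∀ x ∈ W, LinearIndependent ℂ (fun a => e a x) ∧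
      Submodule.span ℂ (Set.range fun a => e a x) = P x

variable {V} in
/-- The section `s₁ ∧ ⋯ ∧ s_r` of `⋀^r V`. -/
def wedge {r : ℕ} (s : Fin r → Π x, V x) (x : X) : ⋀[ℂ]^r (V x) :=
  exteriorPower.ιMulti ℂ r (fun j => s j x)

variable {F V} in
/-- The connection on `⋀^r V` induced by `∇`, on decomposable sections: the derivative of
`s₁ ∧ ⋯ ∧ s_r` along `v` is `∑ j, s₁ ∧ ⋯ ∧ ∇_v s_j ∧ ⋯ ∧ s_r`. -/
def HolConnection.wedgeDeriv [IsManifold 𝓘(ℂ, ℂ) ω X] {Ω : Set X} (D : HolConnection F V Ω) {r : ℕ}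
    (s : Fin r → Π x, V x) (x : X) (v : TangentSpace 𝓘(ℂ, ℂ) x) : ⋀[ℂ]^r (V x) :=
  ∑ j, exteriorPower.ιMulti ℂ r (Function.update (fun j => s j x) j (D.toFun (s j) x v))

/-- A holomorphic isomorphism of `⋀^r V` (for `V` of rank `r`) with a line bundle `L`. A map from
`⋀^r V` is holomorphic if it takes wedge products of holomorphic sections to holomorphic
sections; the inverse is then holomorphic as well. -/
structure DetIso (r : ℕ) (L : X → Type*) [TopologicalSpace (TotalSpace ℂ L)]
    [∀ x, AddCommGroup (L x)] [∀ x, Module ℂ (L x)] [∀ x, TopologicalSpace (L x)]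
    [FiberBundle ℂ L] where
  toEquiv : Π x, ⋀[ℂ]^r (V x) ≃ₗ[ℂ] L x
  hol : ∀ W : Set X, IsOpen W → ∀ s : Fin r → Π x, V x, (∀ j, IsHolSection F (s j) W) →
    IsHolSection ℂ (fun x => toEquiv x (wedge s x)) W

variable {F V} in
/-- The isomorphism `θ : ⋀^r V ≅ L` carries the connection on `⋀^r V` induced by `D` to the
connection `d` on `L`, over `Ω`. (Both are determined by their values on the sections
`s₁ ∧ ⋯ ∧ s_r`, by the Leibniz rule.) -/
def DetIso.Carries [IsManifold 𝓘(ℂ, ℂ) ω X] {r : ℕ} {L : X → Type*}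
    [TopologicalSpace (TotalSpace ℂ L)] [∀ x, AddCommGroup (L x)] [∀ x, Module ℂ (L x)]
    [∀ x, TopologicalSpace (L x)] [FiberBundle ℂ L] (θ : DetIso F V r L) {Ω : Set X}
    (D : HolConnection F V Ω) (d : (Π x, L x) → Π x, TangentSpace 𝓘(ℂ, ℂ) x →L[ℂ] L x) : Prop :=
  ∀ W : Set X, IsOpen W → W ⊆ Ω → ∀ s : Fin r → Π x, V x, (∀ j, IsHolSection F (s j) W) →
    ∀ x ∈ W, ∀ v : TangentSpace 𝓘(ℂ, ℂ) x,
      θ.toEquiv x (D.wedgeDeriv s x v) = d (fun y => θ.toEquiv y (wedge s y)) x v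

end Connections

section Oper

variable {X : Type u} [TopologicalSpace X] [ChartedSpace ℂ X]

/-- The de Rham differential on the trivial line bundle. -/
def deRham (f : Π x : X, Bundle.Trivial X ℂ x) (x : X) :
    TangentSpace 𝓘(ℂ, ℂ) x →L[ℂ] Bundle.Trivial X ℂ x :=
  mvfderiv 𝓘(ℂ, ℂ) (fun y => (f y : ℂ)) x

/-- The element `a ⊗ b` of the fibre of `E ⊗ L` (in the preferred frames). -/
def tmul {F : Type} [NormedAddCommGroup F] [NormedSpace ℂ F] {E : HolBundle X F} {L : HolLine X}
    {x : X} (a : E.Fiber x) (b : L.Fiber x) : (E.twist L).Fiber x :=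
  let a' : F := a
  let b' : ℂ := b
  (b' • a' : F)

variable [T1Space X] [IsManifold 𝓘(ℂ, ℂ) ω X]

/-- The value at `x` of the meromorphic function, with poles in `S`, given by a section of `𝒪(kS)`
whose value in the fibre at `x` is `a`. (At a point of `S` this makes sense only if `k ≤ 0`.) -/
def functionValue (S : Finset X) (k : ℤ) (x : X) (a : (divisorBundle S k).Fiber x) : ℂ :=
  let a' : ℂ := a
  localEq S x x ^ (-k) * a'

/-- The connection `δ` on `𝒪(kS)` is the de Rham differential `f ↦ df`. -/
def IsDeRham {S : Finset X} {k : ℤ}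
    (δ : LogConnection ℂ (divisorBundle S k).Fiber S) : Prop :=
  ∀ W : Set X, IsOpen W → W ⊆ (S : Set X)ᶜ → ∀ t : Π x, (divisorBundle S k).Fiber x,
    IsHolSection ℂ t W → ∀ x ∈ W, ∀ v : TangentSpace 𝓘(ℂ, ℂ) x,
      functionValue S k x (δ.toFun t x v) =
        mvfderiv 𝓘(ℂ, ℂ) (fun y => functionValue S k y (t y)) x v

/-- The section of `𝒪(S)` given by the constant function `1`. -/
def oneSection (S : Finset X) (x : X) : (divisorBundle S 1).Fiber x :=
  localEq S x x

/-- The natural inclusion `E ⊗ 𝒪(-mS) ⟶ E`. -/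
def twistIncl {F : Type} [NormedAddCommGroup F] [NormedSpace ℂ F] (E : HolBundle X F)
    (S : Finset X) (m : ℕ) (x : X) :
    (E.twist (divisorBundle S (-(m : ℤ)))).Fiber x →ₗ[ℂ] E.Fiber x :=
  (localEq S x x ^ m • LinearMap.id : F →ₗ[ℂ] F)

/-- The line bundle `TX ⊗ 𝒪(S)`. -/
def tangentTwist (S : Finset X) : HolLine X :=
  (tangentLine X).twist (divisorBundle S 1)

/-- The vector `v ⊗ 1` of `TX ⊗ 𝒪(S)` given by a tangent vector `v`. -/
def tangentIncl (S : Finset X) {x : X} (v : TangentSpace 𝓘(ℂ, ℂ) x) : (tangentTwist S).Fiber x :=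
  tmul (E := tangentLine X) (L := divisorBundle S 1) (x := x) v (oneSection S x)

/-- The line bundle prescribed for the first step `F₁` of the filtration. -/
def lowestLine (r : ℕ) (S : Finset X) (L : HolLine X) : HolLine X :=
  if Even r then HolBundle.dual (HolBundle.pow L (r - 1))
  else HolBundle.dual (HolBundle.pow (tangentTwist S) ((r - 1) / 2))

/-- The line bundle `F₁ ⊗ (TX ⊗ 𝒪(S))^{⊗ j}`, prescribed for the quotient `F_{j+1}/F_j`. -/
def gradedLine (r : ℕ) (S : Finset X) (L : HolLine X) : ℕ → HolLine X
  | 0 => lowestLine r S L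
  | j + 1 => (gradedLine r S L j).twist (tangentTwist S)

/-- A branched `SL(r)`-oper on `X` with branching over `S` and underlying bundle `V`; the line bundle
`L`, a square root of `TX ⊗ 𝒪(S)`, matters only for even `r`. -/
structure BranchedOper (r : ℕ) (S : Finset X) (L : HolLine X) (V : X → Type v)
    [TopologicalSpace (TotalSpace (Fin r → ℂ) V)] [∀ x, AddCommGroup (V x)] [∀ x, Module ℂ (V x)]
    [∀ x, TopologicalSpace (V x)] [∀ x, IsTopologicalAddGroup (V x)]
    [∀ x, ContinuousSMul ℂ (V x)] [FiberBundle (Fin r → ℂ) V] [VectorBundle ℂ (Fin r → ℂ) V]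
    [ContMDiffVectorBundle ω (Fin r → ℂ) V 𝓘(ℂ, ℂ)] where
  /-- the isomorphism of `⋀^r V` with the trivial line bundle -/
  triv : DetIso (Fin r → ℂ) V r (Bundle.Trivial X ℂ)
  /-- the holomorphic connection -/
  D : HolConnection (Fin r → ℂ) V Set.univ
  /-- the filtration `0 = F₀ ⊂ F₁ ⊂ ⋯ ⊂ F_r = V`, continued by `V` -/
  fil : ℕ → Π x, Submodule ℂ (V x)
  fil_zero : ∀ x, fil 0 x = ⊥
  fil_top : ∀ i, r ≤ i → ∀ x, fil i x = ⊤
  fil_mono : ∀ i x, fil i x ≤ fil (i + 1) x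
  fil_sub : ∀ i, i ≤ r → IsHolSubbundle (Fin r → ℂ) (fil i) i
  /-- the projection from `F_{j+1}` to `F_{j+1}/F_j ≅ F₁ ⊗ (TX ⊗ 𝒪(S))^{⊗ j}`, for `j < r` -/
  gr : (j : ℕ) → Π x, fil (j + 1) x →ₗ[ℂ] (gradedLine r S L j).Fiber x
  gr_ker : ∀ j, j < r → ∀ x (a : fil (j + 1) x), gr j x a = 0 ↔ (a : V x) ∈ fil j x
  gr_surj : ∀ j, j < r → ∀ x, Function.Surjective (gr j x)
  gr_hol : ∀ j, j < r → ∀ W : Set X, IsOpen W → ∀ s : Π x, fil (j + 1) x,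
    IsHolSection (Fin r → ℂ) (fun x => (s x : V x)) W → IsHolSection ℂ (fun x => gr j x (s x)) W
  /-- `D` induces the trivial connection on `⋀^r V` -/
  det_eq : triv.Carries D deRham
  /-- `D(F_i) ⊂ F_{i+1} ⊗ K` -/
  transversal : ∀ i, 1 ≤ i → i + 1 ≤ r → ∀ W : Set X, IsOpen W → ∀ s : Π x, fil i x,
    IsHolSection (Fin r → ℂ) (fun x => (s x : V x)) W →
    ∀ x ∈ W, ∀ v : TangentSpace 𝓘(ℂ, ℂ) x, D.toFun (fun y => (s y : V y)) x v ∈ fil (i + 1) x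
  /-- The second fundamental form `F_i/F_{i-1} ⟶ (F_{i+1}/F_i) ⊗ K = (F_i/F_{i-1}) ⊗ 𝒪(S)`, for
  `i = j + 1`, is the natural inclusion: for a section `s` of `F_i` with class `[s]` in
  `F_i/F_{i-1}`, the class of `D_v s` in `F_{i+1}/F_i = (F_i/F_{i-1}) ⊗ TX ⊗ 𝒪(S)` is
  `[s] ⊗ v ⊗ 1`. -/
  second_fund : ∀ j, j + 1 < r → ∀ W : Set X, IsOpen W → ∀ s : Π x, fil (j + 1) x,
    IsHolSection (Fin r → ℂ) (fun x => (s x : V x)) W →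
    ∀ x ∈ W, ∀ v : TangentSpace 𝓘(ℂ, ℂ) x,
    ∀ h : D.toFun (fun y => (s y : V y)) x v ∈ fil (j + 1 + 1) x,
      gr (j + 1) x ⟨_, h⟩ = tmul (gr j x (s x)) (tangentIncl S v)

/-- The line bundle `Q = F_r/F_{r-1}`. -/
def topLine (r : ℕ) (S : Finset X) (L : HolLine X) : HolLine X :=
  gradedLine r S L (r - 1)

/-- The vector bundle `E = J^{r-1}(Q) ⊗ 𝒪(-(r-1)S)`. -/
def jetTwist (r : ℕ) (S : Finset X) (L : HolLine X) : HolBundle X (Fin r → ℂ) :=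
  (jetBundle (topLine r S L) r).twist (divisorBundle S (-((r - 1 : ℕ) : ℤ)))

section

variable {r : ℕ} {S : Finset X} {L : HolLine X} {V : X → Type v}
    [TopologicalSpace (TotalSpace (Fin r → ℂ) V)] [∀ x, AddCommGroup (V x)] [∀ x, Module ℂ (V x)]
    [∀ x, TopologicalSpace (V x)] [∀ x, IsTopologicalAddGroup (V x)]
    [∀ x, ContinuousSMul ℂ (V x)] [FiberBundle (Fin r → ℂ) V] [VectorBundle ℂ (Fin r → ℂ) V]
    [ContMDiffVectorBundle ω (Fin r → ℂ) V 𝓘(ℂ, ℂ)]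

/-- The quotient map `V ⟶ Q`. -/
def BranchedOper.quot (O : BranchedOper r S L V) (x : X) (a : V x) : (topLine r S L).Fiber x :=
  O.gr (r - 1) x ⟨a, by rw [O.fil_top (r - 1 + 1) (by omega)]; exact Submodule.mem_top⟩

/-- `Φ` is the homomorphism `V ⟶ J^{r-1}(Q)` of the oper: for a local section `s` which is flat for
`D`, it sends `s(x)` to the `(r-1)`-jet at `x` of the image of `s` in `Q`. (Every vector of `V` is
the value of a local flat section, so there is at most one such `Φ`.) -/
def BranchedOper.IsFlatJetMap (O : BranchedOper r S L V)
    (Φ : HolHom (Fin r → ℂ) (Fin r → ℂ) V (jetBundle (topLine r S L) r).Fiber) : Prop :=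
  ∀ W : Set X, IsOpen W → ∀ s : Π x, V x, IsHolSection (Fin r → ℂ) s W →
    (∀ x ∈ W, O.D.toFun s x = 0) →
    ∀ x ∈ W, Φ.toFun x (s x) = jetAt (topLine r S L) r (fun y => O.quot y (s y)) x

/-- `𝒟` is the connection on `E`, over `X ∖ S`, which corresponds to `D` under the isomorphisms
`Φ : V ≅ J^{r-1}(Q)` and `E = J^{r-1}(Q) ⊗ 𝒪(-(r-1)S) ≅ J^{r-1}(Q)` over `X ∖ S`. -/
def BranchedOper.IsTransport (O : BranchedOper r S L V)
    (Φ : HolHom (Fin r → ℂ) (Fin r → ℂ) V (jetBundle (topLine r S L) r).Fiber)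
    (D' : HolConnection (Fin r → ℂ) (jetTwist r S L).Fiber ((S : Set X)ᶜ)) : Prop :=
  ∀ W : Set X, IsOpen W → W ⊆ (S : Set X)ᶜ →
    ∀ (s : Π x, V x) (t : Π x, (jetTwist r S L).Fiber x),
    IsHolSection (Fin r → ℂ) s W → IsHolSection (Fin r → ℂ) t W →
    (∀ x ∈ W, Φ.toFun x (s x) = twistIncl (jetBundle (topLine r S L) r) S (r - 1) x (t x)) →
    ∀ x ∈ W, ∀ v : TangentSpace 𝓘(ℂ, ℂ) x, Φ.toFun x (O.D.toFun s x v) =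
      twistIncl (jetBundle (topLine r S L) r) S (r - 1) x (D'.toFun t x v)

end

end Oper

end

end HolGeom

/-! Fix a point p and let z be the local equation `localEq S p` (the constant 1 if p is not in S).
The components of Φ are constructed without flat sections. The form `lam 0` is the class in Q read
in a frame, and `lam (k+1)` is the derivative of `lam k` for the dual connection, that is, `lam
(k+1)` of s is the derivative of `lam k` of s minus `lam k` of ∇s. For a flat s the last term
vanishes, so `lam k` computes the k-th derivative of the image of s in Q.

The heart of the matter is `lam_fil`: on F_{r-k} the form `lam k` is (-1)^k z^k times the class in
F_{r-k}/F_{r-k-1}. Indeed `lam k` vanishes on F_{r-k-1}, so there `lam (k+1)` equals -`lam k`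
composed with ∇, and the second fundamental form contributes one more factor z, the coordinate of
the section 1 of 𝒪(S). In a frame adapted to the filtration the matrix of Φ is therefore lower
triangular, and its determinant is a unit times z^m with m = r(r-1)/2 (`det_jetMat`). In particular
Φ is invertible off S.

The coordinates in E are z^{-(r-1)} times those in the jet bundle, so the determinant of r vectors
of E is z^{-2m} times that of their jets. Combining the two powers, the trivialization of det V is
z^m times a unit times the determinant in E (`triv_fromTwist`). This is how the function given by a
section of 𝒪(-mS) is related to its coordinate. Hence det V ≅ 𝒪, transported to E off S, extends
over S to an isomorphism det E ≅ 𝒪(-mS) (`detTwist`). It carries the induced connection to d because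
D induces d on det V. Any other isomorphism differs from it by a holomorphic function on a compact
connected surface, which is a constant, and d commutes with constants.

That the local maps glue to a homomorphism into the jet bundle (`coord_jet`) is checked on sections
flat to finite order. These exist by an elementary induction (`exists_solution_to_order`), and no
convergence argument for differential equations is needed. -/

namespace HolGeom

universe u v

noncomputable section

/-! ### Determinants and linear systems with holomorphic coefficients -/

section Cramer

variable {X : Type u} [TopologicalSpace X] [ChartedSpace ℂ X]

theorem contMDiffAt_det {n : Type*} [Fintype n] [DecidableEq n] {M : X → Matrix n n ℂ} {x : X}
    (hM : ∀ i j, ContMDiffAt 𝓘(ℂ, ℂ) 𝓘(ℂ, ℂ) ω (fun y => M y i j) x) :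
    ContMDiffAt 𝓘(ℂ, ℂ) 𝓘(ℂ, ℂ) ω (fun y => (M y).det) x := by
  simp only [Matrix.det_apply']
  exact contMDiffAt_finsetSum fun σ _ =>
    contMDiffAt_const.mul (contMDiffAt_finsetProd fun i _ => hM _ _)

theorem contMDiffAt_inv_of_ne_zero {f : X → ℂ} {x : X}
    (hf : ContMDiffAt 𝓘(ℂ, ℂ) 𝓘(ℂ, ℂ) ω f x) (h : f x ≠ 0) :
    ContMDiffAt 𝓘(ℂ, ℂ) 𝓘(ℂ, ℂ) ω (fun y => (f y)⁻¹) x :=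
  (contDiffAt_inv ℂ h).contMDiffAt.comp x hf

/-- The solution of a linear system with holomorphic coefficients and non-vanishing determinant is
holomorphic. -/
theorem contMDiffAt_of_mulVec_eq {n : Type*} [Fintype n] [DecidableEq n] {M : X → Matrix n n ℂ}
    {b c : X → n → ℂ} {x : X}
    (hM : ∀ i j, ContMDiffAt 𝓘(ℂ, ℂ) 𝓘(ℂ, ℂ) ω (fun y => M y i j) x)
    (hb : ∀ i, ContMDiffAt 𝓘(ℂ, ℂ) 𝓘(ℂ, ℂ) ω (fun y => b y i) x)
    (hdet : (M x).det ≠ 0) (h : ∀ᶠ y in 𝓝 x, (M y).mulVec (c y) = b y) (j : n) :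
    ContMDiffAt 𝓘(ℂ, ℂ) 𝓘(ℂ, ℂ) ω (fun y => c y j) x := by
  have hd := contMDiffAt_det hM
  have hne : ∀ᶠ y in 𝓝 x, (M y).det ≠ 0 := hd.continuousAt.eventually_ne hdet
  -- Cramer's rule: each component of the solution is a quotient of determinants near x.
  refine ContMDiffAt.congr_of_eventuallyEq
    (f := fun y => ((M y).det)⁻¹ * ((M y).updateCol j (b y)).det) ?_ ?_
  · refine (contMDiffAt_inv_of_ne_zero hd hdet).mul (contMDiffAt_det fun i k => ?_)
    by_cases hk : k = j
    · subst hk; simpa using hb i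
    · simpa [Matrix.updateCol_ne hk] using hM i k
  · filter_upwards [h, hne] with y h1 h2
    have h3 : (M y).cramer (b y) j = ((M y).det • c y) j := by
      rw [← h1, Matrix.cramer_eq_adjugate_mulVec, Matrix.mulVec_mulVec, Matrix.adjugate_mul,
        Matrix.smul_mulVec, Matrix.one_mulVec]
    rw [Matrix.cramer_apply] at h3
    rw [h3]
    simp [h2]

end Cramer

/-! ### Sections of holomorphic bundles in local frames -/

section Bundles

variable {X : Type u} [TopologicalSpace X] [ChartedSpace ℂ X]
variable {F : Type} [NormedAddCommGroup F] [NormedSpace ℂ F]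

instance instContMDiffVectorBundleFiber (E : HolBundle X F) :
    ContMDiffVectorBundle ω F E.Fiber 𝓘(ℂ, ℂ) :=
  haveI := E.hol
  E.core.instContMDiffVectorBundle (n := ω) (IB := 𝓘(ℂ, ℂ))

/-- The coordinates, in the frame with index `i`, of a vector in the fibre at `x`. -/
def HolBundle.coord (E : HolBundle X F) (i : E.ι) (x : X) : E.Fiber x →L[ℂ] F :=
  E.core.coordChange (E.core.indexAt x) i x

theorem HolBundle.coord_indexAt (E : HolBundle X F) (x : X) (v : E.Fiber x) :
    E.coord (E.core.indexAt x) x v = v :=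
  E.core.coordChange_self _ x (E.core.mem_baseSet_at x) v

theorem HolBundle.coordChange_coord (E : HolBundle X F) {i j : E.ι} {x : X}
    (hi : x ∈ E.core.baseSet i) (hj : x ∈ E.core.baseSet j) (v : E.Fiber x) :
    E.core.coordChange i j x (E.coord i x v) = E.coord j x v :=
  E.core.coordChange_comp _ i j x ⟨⟨E.core.mem_baseSet_at x, hi⟩, hj⟩ v

theorem HolBundle.coord_injective (E : HolBundle X F) {i : E.ι} {x : X}
    (hi : x ∈ E.core.baseSet i) : Function.Injective (E.coord i x) := fun v w h => by
  have := congrArg (E.core.coordChange i (E.core.indexAt x) x) h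
  rwa [E.coordChange_coord hi (E.core.mem_baseSet_at x),
    E.coordChange_coord hi (E.core.mem_baseSet_at x), E.coord_indexAt, E.coord_indexAt] at this

theorem HolBundle.contMDiffAt_section_iff (E : HolBundle X F) {i : E.ι} {x : X}
    (hi : x ∈ E.core.baseSet i) {s : Π y, E.Fiber y} :
    ContMDiffAt 𝓘(ℂ, ℂ) (𝓘(ℂ, ℂ).prod 𝓘(ℂ, F)) ω (fun y => TotalSpace.mk' F y (s y)) x ↔
      ContMDiffAt 𝓘(ℂ, ℂ) 𝓘(ℂ, F) ω (fun y => E.coord i y (s y)) x :=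
  have : MemTrivializationAtlas (E.core.localTriv i) := ⟨i, rfl⟩
  (E.core.localTriv i).contMDiffAt_section_iff (IB := 𝓘(ℂ, ℂ)) (n := ω) hi

theorem HolBundle.mdifferentiableAt_section_iff (E : HolBundle X F) {i : E.ι} {x : X}
    (hi : x ∈ E.core.baseSet i) {s : Π y, E.Fiber y} :
    MDifferentiableAt 𝓘(ℂ, ℂ) (𝓘(ℂ, ℂ).prod 𝓘(ℂ, F)) (fun y => TotalSpace.mk' F y (s y)) x ↔
      MDifferentiableAt 𝓘(ℂ, ℂ) 𝓘(ℂ, F) (fun y => E.coord i y (s y)) x := by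
  have : ContMDiffVectorBundle 1 F E.Fiber 𝓘(ℂ, ℂ) := .of_le (n := ω) le_top
  have : MemTrivializationAtlas (E.core.localTriv i) := ⟨i, rfl⟩
  exact (E.core.localTriv i).mdifferentiableAt_section_iff 𝓘(ℂ, ℂ) s hi

theorem IsHolSection.contMDiffAt {V : X → Type v}
    [TopologicalSpace (TotalSpace F V)] [∀ x, TopologicalSpace (V x)] [FiberBundle F V]
    {s : Π x, V x} {W : Set X} (h : IsHolSection F s W) (hW : IsOpen W) {x : X} (hx : x ∈ W) :
    ContMDiffAt 𝓘(ℂ, ℂ) (𝓘(ℂ, ℂ).prod 𝓘(ℂ, F)) ω (fun y => TotalSpace.mk' F y (s y)) x :=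
  ContMDiffOn.contMDiffAt h (hW.mem_nhds hx)

theorem IsHolSection.mono {V : X → Type v}
    [TopologicalSpace (TotalSpace F V)] [∀ x, TopologicalSpace (V x)] [FiberBundle F V]
    {s : Π x, V x} {W W' : Set X} (h : IsHolSection F s W) (hW : W' ⊆ W) : IsHolSection F s W' :=
  ContMDiffOn.mono h hW

theorem IsHolSection.congr {V : X → Type v}
    [TopologicalSpace (TotalSpace F V)] [∀ x, TopologicalSpace (V x)] [FiberBundle F V]
    {s t : Π x, V x} {W : Set X} (h : IsHolSection F s W) (hst : ∀ x ∈ W, t x = s x) :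
    IsHolSection F t W :=
  ContMDiffOn.congr h fun x hx => by rw [hst x hx]

theorem isHolSection_of_contMDiffAt {V : X → Type v}
    [TopologicalSpace (TotalSpace F V)] [∀ x, TopologicalSpace (V x)] [FiberBundle F V]
    {s : Π x, V x} {W : Set X}
    (h : ∀ x ∈ W, ContMDiffAt 𝓘(ℂ, ℂ) (𝓘(ℂ, ℂ).prod 𝓘(ℂ, F)) ω
      (fun y => TotalSpace.mk' F y (s y)) x) : IsHolSection F s W :=
  fun x hx => (h x hx).contMDiffWithinAt

theorem contMDiffAt_trivial_section_iff {s : Π y, Bundle.Trivial X ℂ y} {x : X} :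
    ContMDiffAt 𝓘(ℂ, ℂ) (𝓘(ℂ, ℂ).prod 𝓘(ℂ, ℂ)) ω
      (fun y => TotalSpace.mk' ℂ (E := Bundle.Trivial X ℂ) y (s y)) x ↔
      ContMDiffAt 𝓘(ℂ, ℂ) 𝓘(ℂ, ℂ) ω (fun y => (s y : ℂ)) x :=
  Bundle.contMDiffAt_section (IB := 𝓘(ℂ, ℂ)) (n := ω) (E := Bundle.Trivial X ℂ) x

end Bundles

section Frames

variable {X : Type u} [TopologicalSpace X] [ChartedSpace ℂ X]
variable {r : ℕ} {V : X → Type v}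
    [TopologicalSpace (TotalSpace (Fin r → ℂ) V)] [∀ x, AddCommGroup (V x)] [∀ x, Module ℂ (V x)]
    [∀ x, TopologicalSpace (V x)] [FiberBundle (Fin r → ℂ) V] [VectorBundle ℂ (Fin r → ℂ) V]

/-- A holomorphic combination of holomorphic sections is holomorphic. -/
theorem contMDiffAt_sum_smul {ι : Type*} [Fintype ι] {f : ι → Π x, V x} {c : X → ι → ℂ} {x : X}
    (hf : ∀ j, ContMDiffAt 𝓘(ℂ, ℂ) (𝓘(ℂ, ℂ).prod 𝓘(ℂ, Fin r → ℂ)) ω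
      (fun y => TotalSpace.mk' (Fin r → ℂ) y (f j y)) x)
    (hc : ∀ j, ContMDiffAt 𝓘(ℂ, ℂ) 𝓘(ℂ, ℂ) ω (fun y => c y j) x) :
    ContMDiffAt 𝓘(ℂ, ℂ) (𝓘(ℂ, ℂ).prod 𝓘(ℂ, Fin r → ℂ)) ω
      (fun y => TotalSpace.mk' (Fin r → ℂ) y (∑ j, c y j • f j y)) x :=
  ContMDiffAt.sum_section fun j _ => (hc j).smul_section (hf j)

variable [ContMDiffVectorBundle ω (Fin r → ℂ) V 𝓘(ℂ, ℂ)]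

/-- The coefficients of a holomorphic section in a holomorphic frame are holomorphic. -/
theorem contMDiffAt_frame_coeff {f : Fin r → Π x, V x} {s : Π x, V x} {c : X → Fin r → ℂ} {x : X}
    (hf : ∀ j, ContMDiffAt 𝓘(ℂ, ℂ) (𝓘(ℂ, ℂ).prod 𝓘(ℂ, Fin r → ℂ)) ω
      (fun y => TotalSpace.mk' (Fin r → ℂ) y (f j y)) x)
    (hs : ContMDiffAt 𝓘(ℂ, ℂ) (𝓘(ℂ, ℂ).prod 𝓘(ℂ, Fin r → ℂ)) ω
      (fun y => TotalSpace.mk' (Fin r → ℂ) y (s y)) x)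
    (hli : LinearIndependent ℂ fun j => f j x)
    (h : ∀ᶠ y in 𝓝 x, s y = ∑ j, c y j • f j y) (j : Fin r) :
    ContMDiffAt 𝓘(ℂ, ℂ) 𝓘(ℂ, ℂ) ω (fun y => c y j) x := by
  set e := trivializationAt (Fin r → ℂ) V x
  have hx : x ∈ e.baseSet := FiberBundle.mem_baseSet_trivializationAt' x
  have hf' := fun j => contMDiffAt_pi_space.1 ((e.contMDiffAt_section_iff hx).1 (hf j))
  have hs' := contMDiffAt_pi_space.1 ((e.contMDiffAt_section_iff hx).1 hs)
  -- In a trivialization the coefficients solve a linear system whose matrix has the frame vectors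
  -- as columns.
  refine contMDiffAt_of_mulVec_eq (M := fun y => Matrix.of fun i j => (e ⟨y, f j y⟩).2 i)
    (b := fun y => (e ⟨y, s y⟩).2) (fun i j => hf' j i) hs' ?_ ?_ j
  · have h1 : LinearIndependent ℂ fun j => (e ⟨x, f j x⟩).2 := by
      have := hli.map' (e.linearEquivAt ℂ x hx).toLinearMap (LinearEquiv.ker _)
      exact this
    have h2 : IsUnit (Matrix.of fun i j => (e ⟨x, f j x⟩).2 i) :=
      Matrix.linearIndependent_cols_iff_isUnit.1 h1
    exact ((Matrix.isUnit_iff_isUnit_det _).1 h2).ne_zero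
  · filter_upwards [h, e.open_baseSet.mem_nhds hx] with y h1 h2
    rw [h1]
    have h3 : ∀ v : V y, (e ⟨y, v⟩).2 = e.linearEquivAt ℂ y h2 v := fun v => rfl
    ext i
    simp only [h3, map_sum, map_smul, Matrix.mulVec, dotProduct, Matrix.of_apply,
      Finset.sum_apply, Pi.smul_apply, smul_eq_mul]
    exact Finset.sum_congr rfl fun j _ => mul_comm _ _

end Frames

section Push

variable {X : Type u} [TopologicalSpace X] [ChartedSpace ℂ X]
variable {F F' : Type} [NormedAddCommGroup F] [NormedSpace ℂ F] [FiniteDimensional ℂ F]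
    [NormedAddCommGroup F'] [NormedSpace ℂ F'] {V : X → Type*} {V' : X → Type*}
    [TopologicalSpace (TotalSpace F V)] [∀ x, AddCommGroup (V x)] [∀ x, Module ℂ (V x)]
    [∀ x, TopologicalSpace (V x)] [FiberBundle F V] [VectorBundle ℂ F V]
    [ContMDiffVectorBundle ω F V 𝓘(ℂ, ℂ)]
    [TopologicalSpace (TotalSpace F' V')] [∀ x, AddCommGroup (V' x)] [∀ x, Module ℂ (V' x)]
    [∀ x, TopologicalSpace (V' x)] [FiberBundle F' V'] [VectorBundle ℂ F' V']

/-- A holomorphic homomorphism of vector bundles takes differentiable sections to differentiable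
sections. -/
theorem mdifferentiableAt_map_section {Ω : Set X} (hΩ : IsOpen Ω) (Ψ : Π x, V x →ₗ[ℂ] V' x)
    (hΨ : ∀ W : Set X, IsOpen W → W ⊆ Ω → ∀ s : Π x, V x, IsHolSection F s W →
      IsHolSection F' (fun x => Ψ x (s x)) W) {σ : Π x, V x} {x : X} (hx : x ∈ Ω)
    (hσ : MDifferentiableAt 𝓘(ℂ, ℂ) (𝓘(ℂ, ℂ).prod 𝓘(ℂ, F)) (fun y => TotalSpace.mk' F y (σ y)) x) :
    MDifferentiableAt 𝓘(ℂ, ℂ) (𝓘(ℂ, ℂ).prod 𝓘(ℂ, F'))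
      (fun y => TotalSpace.mk' F' y (Ψ y (σ y))) x := by
  have : ContMDiffVectorBundle 1 F V 𝓘(ℂ, ℂ) := .of_le (n := ω) le_top
  set e := trivializationAt F V x
  have hxe : x ∈ e.baseSet := FiberBundle.mem_baseSet_trivializationAt' x
  -- The hypothesis concerns holomorphic sections only. Expanding σ in a holomorphic local frame
  -- leaves mere differentiability to the scalar coefficients.
  let b := Module.finBasis ℂ F
  have h1 : ∀ i, MDifferentiableAt 𝓘(ℂ, ℂ) (𝓘(ℂ, ℂ).prod 𝓘(ℂ, F'))
      (fun y => TotalSpace.mk' F' y (Ψ y (e.localFrame b i y))) x := fun i => by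
    have h2 := hΨ (e.baseSet ∩ Ω) (e.open_baseSet.inter hΩ) Set.inter_subset_right _
      ((e.contMDiffOn_localFrame_baseSet (I := 𝓘(ℂ, ℂ)) ω b i).mono Set.inter_subset_left)
    exact (h2.contMDiffAt (e.open_baseSet.inter hΩ) ⟨hxe, hx⟩).mdifferentiableAt (by simp)
  have h3 := fun i => mdifferentiableAt_localFrameCoeff (I := 𝓘(ℂ, ℂ)) b hxe hσ i
  have h4 : MDifferentiableAt 𝓘(ℂ, ℂ) (𝓘(ℂ, ℂ).prod 𝓘(ℂ, F')) (fun y => TotalSpace.mk' F' y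
      (∑ i, e.localFrameCoeff 𝓘(ℂ, ℂ) b i y (σ y) • Ψ y (e.localFrame b i y))) x :=
    MDifferentiableAt.sum_section fun i _ => (h3 i).smul_section (h1 i)
  refine h4.congr_of_eventuallyEq ?_
  filter_upwards [e.eventually_eq_localFrame_sum_coeff_smul (I := 𝓘(ℂ, ℂ)) (s := σ) b hxe]
    with y hy
  conv_lhs => rw [hy]
  simp only [map_sum, map_smul]

end Push

/-! ### Vector fields and derivatives in a chart -/

section Tangent

variable {X : Type u} [TopologicalSpace X] [ChartedSpace ℂ X] [IsManifold 𝓘(ℂ, ℂ) ω X]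

/-- The coordinate of a tangent vector in the chart at `p`. -/
def chartDeriv (p x : X) : TangentSpace 𝓘(ℂ, ℂ) x →L[ℂ] ℂ :=
  (tangentLine X).coord (achart ℂ p) x

/-- The coordinate vector field of the chart at `p`. -/
def coordVec (p x : X) : TangentSpace 𝓘(ℂ, ℂ) x :=
  (tangentLine X).core.coordChange (achart ℂ p) (achart ℂ x) x 1

theorem chartDeriv_coordVec {p x : X} (hx : x ∈ (chartAt ℂ p).source) :
    chartDeriv p x (coordVec p x) = 1 := by
  have h := (tangentLine X).core.coordChange_comp (achart ℂ p) (achart ℂ x) (achart ℂ p) x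
    ⟨⟨hx, mem_chart_source ℂ x⟩, hx⟩ 1
  rw [(tangentLine X).core.coordChange_self (achart ℂ p) x hx] at h
  exact h

theorem chartDeriv_smul_coordVec {p x : X} (hx : x ∈ (chartAt ℂ p).source)
    (v : TangentSpace 𝓘(ℂ, ℂ) x) : chartDeriv p x v • coordVec p x = v := by
  apply (tangentLine X).coord_injective (i := achart ℂ p) (x := x) hx
  change chartDeriv p x (chartDeriv p x v • coordVec p x) = chartDeriv p x v
  rw [map_smul, chartDeriv_coordVec hx, smul_eq_mul, mul_one]

theorem contMDiffAt_vectorField_iff {p x : X} (hx : x ∈ (chartAt ℂ p).source)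
    {ξ : Π y : X, TangentSpace 𝓘(ℂ, ℂ) y} :
    ContMDiffAt 𝓘(ℂ, ℂ) (𝓘(ℂ, ℂ).prod 𝓘(ℂ, ℂ)) ω (fun y => TotalSpace.mk' ℂ y (ξ y)) x ↔
      ContMDiffAt 𝓘(ℂ, ℂ) 𝓘(ℂ, ℂ) ω (fun y => chartDeriv p y (ξ y)) x :=
  (tangentLine X).contMDiffAt_section_iff (i := achart ℂ p) hx

theorem isHolSection_coordVec (p : X) :
    IsHolSection ℂ (coordVec p) (chartAt ℂ p).source := by
  refine isHolSection_of_contMDiffAt fun x hx => (contMDiffAt_vectorField_iff hx).2 ?_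
  refine (contMDiffAt_const (c := (1 : ℂ))).congr_of_eventuallyEq ?_
  filter_upwards [(chartAt ℂ p).open_source.mem_nhds hx] with y hy
  exact chartDeriv_coordVec hy

/-- Tangent vectors at x are written in the chart preferred at x, whereas `coordVec p` belongs to
the chart at p. The chain rule for the change of charts turns the derivative along it into d/dz in
the chart at p. -/
theorem mvfderiv_coordVec {p x : X} (hx : x ∈ (chartAt ℂ p).source) {g : X → ℂ}
    (hg : MDifferentiableAt 𝓘(ℂ, ℂ) 𝓘(ℂ, ℂ) g x) :
    mvfderiv 𝓘(ℂ, ℂ) g x (coordVec p x) =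
      deriv (fun w => g ((chartAt ℂ p).symm w)) (chartAt ℂ p x) := by
  have h1 : HasFDerivAt (fun w => g ((chartAt ℂ x).symm w)) (mfderiv 𝓘(ℂ, ℂ) 𝓘(ℂ, ℂ) g x)
      (chartAt ℂ x x) := by
    have := hg.hasMFDerivAt.2
    simp only [writtenInExtChartAt, Function.comp_def, mfld_simps] at this
    exact hasFDerivWithinAt_univ.1 this
  have h2 : HasFDerivAt (fun w => chartAt ℂ x ((chartAt ℂ p).symm w))
      ((tangentBundleCore 𝓘(ℂ, ℂ) X).coordChange (achart ℂ p) (achart ℂ x) x)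
      (chartAt ℂ p x) := by
    have := hasFDerivWithinAt_tangentCoordChange (I := 𝓘(ℂ, ℂ)) (x := p) (y := x) (z := x)
      (by simpa using hx)
    simpa [hasFDerivWithinAt_univ, Function.comp_def] using this
  have h3 : HasFDerivAt (fun w => g ((chartAt ℂ x).symm (chartAt ℂ x ((chartAt ℂ p).symm w))))
      _ (chartAt ℂ p x) :=
    HasFDerivAt.comp (g := fun w => g ((chartAt ℂ x).symm w)) (chartAt ℂ p x)
      (by rw [(chartAt ℂ p).left_inv hx]; exact h1) h2
  have h4 : ∀ᶠ w in 𝓝 (chartAt ℂ p x), (chartAt ℂ p).symm w ∈ (chartAt ℂ x).source := by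
    apply ((chartAt ℂ p).continuousAt_symm ((chartAt ℂ p).map_source hx)).eventually
    rw [(chartAt ℂ p).left_inv hx]
    exact (chartAt ℂ x).open_source.mem_nhds (mem_chart_source ℂ x)
  have h5 := h3.congr_of_eventuallyEq (f₁ := fun w => g ((chartAt ℂ p).symm w)) (by
    filter_upwards [h4] with w hw
    rw [(chartAt ℂ x).left_inv hw])
  rw [h5.hasDerivAt.deriv]
  rfl

theorem mvfderiv_eq_deriv {p x : X} (hx : x ∈ (chartAt ℂ p).source) {g : X → ℂ}
    (hg : MDifferentiableAt 𝓘(ℂ, ℂ) 𝓘(ℂ, ℂ) g x) (v : TangentSpace 𝓘(ℂ, ℂ) x) :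
    mvfderiv 𝓘(ℂ, ℂ) g x v =
      chartDeriv p x v * deriv (fun w => g ((chartAt ℂ p).symm w)) (chartAt ℂ p x) := by
  conv_lhs => rw [← chartDeriv_smul_coordVec hx v]
  rw [map_smul, mvfderiv_coordVec hx hg, smul_eq_mul]

theorem analyticAt_comp_chart_symm {p x : X} (hx : x ∈ (chartAt ℂ p).source) {g : X → ℂ}
    (hg : ContMDiffAt 𝓘(ℂ, ℂ) 𝓘(ℂ, ℂ) ω g x) :
    AnalyticAt ℂ (fun w => g ((chartAt ℂ p).symm w)) (chartAt ℂ p x) := by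
  have h1 : ContMDiffAt 𝓘(ℂ, ℂ) 𝓘(ℂ, ℂ) ω (chartAt ℂ p).symm (chartAt ℂ p x) :=
    contMDiffAt_symm_of_mem_maximalAtlas (IsManifold.chart_mem_maximalAtlas p)
      ((chartAt ℂ p).map_source hx)
  rw [← (chartAt ℂ p).left_inv hx] at hg
  exact (hg.comp _ h1).contDiffAt.analyticAt

theorem contMDiffAt_comp_chart {p x : X} (hx : x ∈ (chartAt ℂ p).source) {g : ℂ → ℂ}
    (hg : AnalyticAt ℂ g (chartAt ℂ p x)) :
    ContMDiffAt 𝓘(ℂ, ℂ) 𝓘(ℂ, ℂ) ω (fun y => g (chartAt ℂ p y)) x :=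
  hg.contDiffAt.contMDiffAt.comp x
    (contMDiffOn_chart.contMDiffAt ((chartAt ℂ p).open_source.mem_nhds hx))

end Tangent

/-! ### Linear differential equations to finite order -/

section LinearODE

/-- Row vectors with `a (k + 1) = a k' - a k A` compute the derivatives of `a 0 ⬝ᵥ s`, to order `N`,
for a solution `s` of `s' + A s = 0` to order `N`. -/
theorem iteratedDeriv_dotProduct {r N : ℕ} {a : ℕ → ℂ → Fin r → ℂ}
    {A : ℂ → Matrix (Fin r) (Fin r) ℂ} {s u : ℂ → Fin r → ℂ} {w₀ : ℂ}
    (ha : ∀ k j, AnalyticAt ℂ (fun w => a k w j) w₀)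
    (hs : ∀ j, AnalyticAt ℂ (fun w => s w j) w₀) (hu : ∀ j, AnalyticAt ℂ (fun w => u w j) w₀)
    (hrec : ∀ k, ∀ᶠ w in 𝓝 w₀, ∀ j,
      a (k + 1) w j = deriv (fun z => a k z j) w - ∑ i, a k w i * A w i j)
    (hode : ∀ᶠ w in 𝓝 w₀, ∀ i, deriv (fun z => s z i) w + ∑ j, A w i j * s w j =
      (w - w₀) ^ N * u w i) {k : ℕ} (hk : k ≤ N) :
    iteratedDeriv k (fun w => ∑ j, a 0 w j * s w j) w₀ = ∑ j, a k w₀ j * s w₀ j := by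
  -- Equality holds up to an error of order N + 1 - k at w₀. Each differentiation costs one order,
  -- and the defect of the equation for s, of order N, is absorbed. For k ≤ N the exponent stays
  -- positive, so the error vanishes at w₀.
  have key : ∀ k ≤ N, ∃ g : ℂ → ℂ, AnalyticAt ℂ g w₀ ∧
      iteratedDeriv k (fun w => ∑ j, a 0 w j * s w j) =ᶠ[𝓝 w₀]
        fun w => ∑ j, a k w j * s w j + (w - w₀) ^ (N + 1 - k) * g w := by
    intro k
    induction k with
    | zero => intro _; exact ⟨0, analyticAt_const, by simp⟩
    | succ k ih =>
      intro hk
      obtain ⟨g, hg, he⟩ := ih (by omega)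
      obtain ⟨m, hm⟩ : ∃ m, N = k + 1 + m := ⟨N - (k + 1), by omega⟩
      have e1 : N + 1 - k = m + 2 := by omega
      have e2 : N + 1 - (k + 1) = m + 1 := by omega
      rw [e1] at he
      rw [e2]
      -- The first two terms come from differentiating the old error, the third from the defect of
      -- s, where (w - w₀)^N is split as (w - w₀)^k (w - w₀)^(m+1).
      refine ⟨fun w => (m + 2) * g w + (w - w₀) * deriv g w +
        (w - w₀) ^ k * ∑ j, a k w j * u w j, ?_, ?_⟩
      · have := hg.deriv
        have h2 := ha k
        fun_prop
      · have hana := (Filter.eventually_all.2 fun j => (ha k j).eventually_analyticAt).and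
          ((Filter.eventually_all.2 fun j => (hs j).eventually_analyticAt).and
            hg.eventually_analyticAt)
        filter_upwards [he.eventuallyEq_nhds, hana, hrec k, hode] with w h1 ⟨h2, h3, h4⟩ h5 h6
        rw [iteratedDeriv_succ, h1.deriv_eq]
        have d1 : HasDerivAt (fun z => ∑ j, a k z j * s z j)
            (∑ j, (deriv (fun z => a k z j) w * s w j + a k w j * deriv (fun z => s z j) w)) w :=
          HasDerivAt.fun_sum fun j _ =>
            (h2 j).differentiableAt.hasDerivAt.mul (h3 j).differentiableAt.hasDerivAt
        have d2 : HasDerivAt (fun z => (z - w₀) ^ (m + 2) * g z)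
            (((m + 2 : ℕ) * (w - w₀) ^ (m + 1) * 1) * g w + (w - w₀) ^ (m + 2) * deriv g w) w :=
          (((hasDerivAt_id w).sub_const w₀).fun_pow (m + 2)).mul h4.differentiableAt.hasDerivAt
        rw [(d1.fun_add d2).deriv]
        have e3 : ∑ j, (deriv (fun z => a k z j) w * s w j + a k w j * deriv (fun z => s z j) w) =
            ∑ j, a (k + 1) w j * s w j + (w - w₀) ^ N * ∑ j, a k w j * u w j := by
          have f1 : ∀ j, deriv (fun z => a k z j) w = a (k + 1) w j + ∑ i, a k w i * A w i j :=
            fun j => by rw [h5 j]; ring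
          have f2 : ∀ j, deriv (fun z => s z j) w =
              (w - w₀) ^ N * u w j - ∑ i, A w j i * s w i := fun j => by rw [← h6 j]; ring
          simp only [f1, f2, add_mul, mul_sub, Finset.sum_add_distrib, Finset.sum_sub_distrib,
            Finset.sum_mul, Finset.mul_sum]
          rw [Finset.sum_comm]
          have f3 : ∀ i, ∑ j, a k w i * A w i j * s w j = ∑ j, a k w i * (A w i j * s w j) :=
            fun i => Finset.sum_congr rfl fun j _ => by ring
          simp only [f3]
          have f4 : ∑ i, a k w i * ((w - w₀) ^ N * u w i) =
              ∑ i, (w - w₀) ^ N * (a k w i * u w i) :=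
            Finset.sum_congr rfl fun j _ => by ring
          rw [f4]
          ring
        rw [e3, hm]
        push_cast
        ring
  obtain ⟨g, -, he⟩ := key k hk
  rw [he.self_of_nhds]
  obtain ⟨m, hm⟩ : ∃ m, N + 1 - k = m + 1 := ⟨N - k, by omega⟩
  simp [hm]

/-- A linear differential equation has solutions to any finite order, with any initial value. -/
theorem exists_solution_to_order {r : ℕ} {A : ℂ → Matrix (Fin r) (Fin r) ℂ} {w₀ : ℂ}
    (hA : ∀ i j, AnalyticAt ℂ (fun w => A w i j) w₀) (v : Fin r → ℂ) (N : ℕ) :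
    ∃ s u : ℂ → Fin r → ℂ, (∀ j, AnalyticAt ℂ (fun w => s w j) w₀) ∧
      (∀ j, AnalyticAt ℂ (fun w => u w j) w₀) ∧ s w₀ = v ∧
      ∀ᶠ w in 𝓝 w₀, ∀ i, deriv (fun z => s z i) w + ∑ j, A w i j * s w j =
        (w - w₀) ^ N * u w i := by
  induction N with
  | zero =>
    refine ⟨fun _ => v, fun w i => ∑ j, A w i j * v j, fun j => analyticAt_const, fun j => ?_, rfl,
      Filter.Eventually.of_forall fun w i => by simp⟩
    fun_prop
  | succ N ih =>
    obtain ⟨s, u, hs, hu, hv, he⟩ := ih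
    have h1 : ∀ i, ∃ t : ℂ → ℂ, AnalyticAt ℂ t w₀ ∧
        ∀ᶠ w in 𝓝 w₀, u w i - u w₀ i = (w - w₀) * t w := fun i => by
      have h2 : AnalyticAt ℂ (fun w => u w i - u w₀ i) w₀ := (hu i).sub analyticAt_const
      have h3 : ((1 : ℕ) : ℕ∞) ≤ analyticOrderAt (fun w => u w i - u w₀ i) w₀ := by
        rw [Nat.cast_one, Order.one_le_iff_ne_zero]
        exact h2.analyticOrderAt_ne_zero.2 (by simp)
      obtain ⟨t, ht, ht'⟩ := (natCast_le_analyticOrderAt h2).1 h3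
      exact ⟨t, ht, by simpa using ht'⟩
    choose t ht ht' using h1
    have hN : ((N : ℂ) + 1) ≠ 0 := by exact_mod_cast Nat.succ_ne_zero N
    -- The subtracted term has derivative (w - w₀)^N u(w₀), which cancels the leading part of the
    -- defect. What remains is divisible by one more power of w - w₀.
    refine ⟨fun w i => s w i - (w - w₀) ^ (N + 1) * (u w₀ i / (N + 1)),
      fun w i => t i w - ∑ j, A w i j * (u w₀ j / (N + 1)), fun j => ?_, fun j => ?_, ?_, ?_⟩
    · have := hs j; fun_prop
    · have := ht j; fun_prop
    · ext i; simp [← hv]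
    · filter_upwards [he, Filter.eventually_all.2 ht',
        Filter.eventually_all.2 fun j => (hs j).eventually_analyticAt] with w h1 h2 h3 i
      have d := (h3 i).differentiableAt.hasDerivAt.sub
        ((((hasDerivAt_id w).sub_const w₀).fun_pow (N + 1)).mul_const (u w₀ i / (N + 1)))
      have d' : deriv (fun z => s z i - (z - w₀) ^ (N + 1) * (u w₀ i / (N + 1))) w = _ := d.deriv
      rw [d']
      have h4 : u w i = u w₀ i + (w - w₀) * t i w := by rw [← h2 i]; ring
      have h5 : ∑ j, A w i j * (s w j - (w - w₀) ^ (N + 1) * (u w₀ j / (N + 1))) =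
          ∑ j, A w i j * s w j -
            (w - w₀) ^ (N + 1) * ∑ j, A w i j * (u w₀ j / (N + 1)) := by
        rw [Finset.mul_sum, ← Finset.sum_sub_distrib]
        exact Finset.sum_congr rfl fun j _ => by ring
      have h6 := h1 i
      rw [h4] at h6
      rw [h5]
      have h7 : deriv (fun z => s z i) w = (w - w₀) ^ N * (u w₀ i + (w - w₀) * t i w) -
        ∑ j, A w i j * s w j := by rw [← h6]; ring
      rw [h7]
      push_cast
      simp only [id]
      field_simp
      ring

end LinearODE

/-! ### The Leibniz rule for finite sums, and the rank of the fibres -/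

section CovariantSum

variable {X : Type u} [TopologicalSpace X] [ChartedSpace ℂ X] {F : Type} [NormedAddCommGroup F]
  [NormedSpace ℂ F] {V : X → Type v}
  [TopologicalSpace (TotalSpace F V)] [∀ x, AddCommGroup (V x)] [∀ x, Module ℂ (V x)]
  [∀ x, TopologicalSpace (V x)] [∀ x, IsTopologicalAddGroup (V x)]
  [∀ x, ContinuousSMul ℂ (V x)] [FiberBundle F V] [VectorBundle ℂ F V]

theorem covariantDerivative_sum_smul
    {cov : (Π x, V x) → Π x, TangentSpace 𝓘(ℂ, ℂ) x →L[ℂ] V x} {Ω : Set X}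
    (hcov : IsCovariantDerivativeOn (I := 𝓘(ℂ, ℂ)) F cov Ω) {ι : Type*} (T : Finset ι)
    {f : ι → Π x, V x} {g : ι → X → ℂ} {x : X} (hx : x ∈ Ω)
    (hf : ∀ i, MDifferentiableAt 𝓘(ℂ, ℂ) (𝓘(ℂ, ℂ).prod 𝓘(ℂ, F))
      (fun y => TotalSpace.mk' F y (f i y)) x)
    (hg : ∀ i, MDifferentiableAt 𝓘(ℂ, ℂ) 𝓘(ℂ, ℂ) (g i) x) :
    cov (fun y => ∑ i ∈ T, g i y • f i y) x =
      ∑ i ∈ T, (g i x • cov (f i) x + (mvfderiv 𝓘(ℂ, ℂ) (g i) x).smulRight (f i x)) := by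
  classical
  induction T using Finset.induction_on with
  | empty =>
    simp only [Finset.sum_empty]
    exact hcov.zero hx
  | insert i T hi ih =>
    have e : (fun y => ∑ i ∈ insert i T, g i y • f i y) =
        (g i • f i) + fun y => ∑ i ∈ T, g i y • f i y := by
      ext y; simp [Finset.sum_insert hi]
    have hT : MDifferentiableAt 𝓘(ℂ, ℂ) (𝓘(ℂ, ℂ).prod 𝓘(ℂ, F))
        (fun y => TotalSpace.mk' F y (∑ i ∈ T, g i y • f i y)) x :=
      MDifferentiableAt.sum_section fun j _ => (hg j).smul_section (hf j)
    rw [e, hcov.add ((hg i).smul_section (hf i)) hT hx,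
      hcov.leibniz (hf i) (hg i) hx, ih, Finset.sum_insert hi]

end CovariantSum

section Fiber

variable {X : Type u} [TopologicalSpace X]

theorem finiteDimensional_fiber (r : ℕ) (V : X → Type v)
    [TopologicalSpace (TotalSpace (Fin r → ℂ) V)] [∀ x, AddCommGroup (V x)] [∀ x, Module ℂ (V x)]
    [∀ x, TopologicalSpace (V x)] [FiberBundle (Fin r → ℂ) V] [VectorBundle ℂ (Fin r → ℂ) V]
    (x : X) : FiniteDimensional ℂ (V x) :=
  Module.Finite.equiv ((trivializationAt (Fin r → ℂ) V x).linearEquivAt ℂ x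
    (FiberBundle.mem_baseSet_trivializationAt' x)).symm

theorem finrank_fiber (r : ℕ) (V : X → Type v)
    [TopologicalSpace (TotalSpace (Fin r → ℂ) V)] [∀ x, AddCommGroup (V x)] [∀ x, Module ℂ (V x)]
    [∀ x, TopologicalSpace (V x)] [FiberBundle (Fin r → ℂ) V] [VectorBundle ℂ (Fin r → ℂ) V]
    (x : X) : Module.finrank ℂ (V x) = r := by
  rw [((trivializationAt (Fin r → ℂ) V x).linearEquivAt ℂ x
    (FiberBundle.mem_baseSet_trivializationAt' x)).finrank_eq, Module.finrank_fin_fun]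

end Fiber

/-! ### Frames adapted to the filtration and the connection matrix -/

section Oper

variable {X : Type u} [TopologicalSpace X] [ChartedSpace ℂ X] [T1Space X]
  [IsManifold 𝓘(ℂ, ℂ) ω X]

/-- Twisting intersects the domains of frames, so these shrink along the graded pieces, and the
domain for the top one serves for all. -/
theorem gradedLine_baseSet_subset (r : ℕ) (S : Finset X) (L : HolLine X) (p : X) {i j : ℕ}
    (hij : i ≤ j) :
    (gradedLine r S L j).core.baseSet ((gradedLine r S L j).core.indexAt p) ⊆
      (gradedLine r S L i).core.baseSet ((gradedLine r S L i).core.indexAt p) := by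
  induction hij with
  | refl => exact subset_rfl
  | step _ ih => exact fun x hx => ih hx.1

variable {r : ℕ} {S : Finset X} {L : HolLine X} {V : X → Type v}
    [TopologicalSpace (TotalSpace (Fin r → ℂ) V)] [∀ x, AddCommGroup (V x)] [∀ x, Module ℂ (V x)]
    [∀ x, TopologicalSpace (V x)] [∀ x, IsTopologicalAddGroup (V x)]
    [∀ x, ContinuousSMul ℂ (V x)] [FiberBundle (Fin r → ℂ) V] [VectorBundle ℂ (Fin r → ℂ) V]
    [ContMDiffVectorBundle ω (Fin r → ℂ) V 𝓘(ℂ, ℂ)]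

/-- The coordinate, in the frame of the graded piece preferred at `p`, of the class of a vector. -/
def BranchedOper.grCoord (O : BranchedOper r S L V) (j : ℕ) (p x : X) : O.fil (j + 1) x →ₗ[ℂ] ℂ :=
  ((gradedLine r S L j).coord ((gradedLine r S L j).core.indexAt p) x).toLinearMap ∘ₗ O.gr j x

theorem BranchedOper.grCoord_self (O : BranchedOper r S L V) (j : ℕ) (p : X)
    (a : O.fil (j + 1) p) : O.grCoord j p p a = O.gr j p a :=
  (gradedLine r S L j).coord_indexAt p (O.gr j p a)

theorem BranchedOper.grCoord_eq_zero_iff (O : BranchedOper r S L V) {j : ℕ} (hj : j < r) {p x : X}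
    (hx : x ∈ (gradedLine r S L j).core.baseSet ((gradedLine r S L j).core.indexAt p))
    (a : O.fil (j + 1) x) : O.grCoord j p x a = 0 ↔ (a : V x) ∈ O.fil j x := by
  rw [← O.gr_ker j hj x a]
  change (gradedLine r S L j).coord _ x (O.gr j x a) = 0 ↔ _
  rw [← ((gradedLine r S L j).coord ((gradedLine r S L j).core.indexAt p) x).map_zero,
    ((gradedLine r S L j).coord_injective hx).eq_iff]

theorem BranchedOper.contMDiffAt_grCoord (O : BranchedOper r S L V) {j : ℕ} (hj : j < r) {p x : X}
    (hx : x ∈ (gradedLine r S L j).core.baseSet ((gradedLine r S L j).core.indexAt p))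
    {W : Set X} (hW : IsOpen W) (hxW : x ∈ W) {s : Π x, O.fil (j + 1) x}
    (hs : IsHolSection (Fin r → ℂ) (fun x => (s x : V x)) W) :
    ContMDiffAt 𝓘(ℂ, ℂ) 𝓘(ℂ, ℂ) ω (fun y => O.grCoord j p y (s y)) x :=
  ((gradedLine r S L j).contMDiffAt_section_iff hx).1
    ((O.gr_hol j hj W hW s hs).contMDiffAt hW hxW)

/-- A holomorphic frame of `V` near `p` which is adapted to the filtration. -/
structure AdaptedFrame (O : BranchedOper r S L V) (p : X) where
  W : Set X
  isOpen : IsOpen W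
  mem : p ∈ W
  sub_chart : W ⊆ (chartAt ℂ p).source
  sub_divisor : W ⊆ divisorBaseSet S p
  sub_graded : ∀ j, j < r →
    W ⊆ (gradedLine r S L j).core.baseSet ((gradedLine r S L j).core.indexAt p)
  -- The order is reversed: `f j` lies in F_{r-j}. This is what makes the matrix of the jet map
  -- lower triangular.
  f : (j : Fin r) → Π x, O.fil (r - 1 - j + 1) x
  hol : ∀ j, IsHolSection (Fin r → ℂ) (fun x => (f j x : V x)) W
  ne_zero : ∀ j : Fin r, ∀ x ∈ W, O.grCoord (r - 1 - j) p x (f j x) ≠ 0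

/-- A vector of F_{j+1} at p of class 1 extends with constant coefficients in a local frame of
F_{j+1}. The coordinate of its class is continuous and non-zero at p, hence non-zero nearby. -/
theorem BranchedOper.exists_local_section (O : BranchedOper r S L V) (p : X) {j : ℕ} (hj : j < r) :
    ∃ W : Set X, IsOpen W ∧ p ∈ W ∧ ∃ s : Π x, O.fil (j + 1) x,
      IsHolSection (Fin r → ℂ) (fun x => (s x : V x)) W ∧
      ∀ x ∈ W, O.grCoord j p x (s x) ≠ 0 := by
  classical
  obtain ⟨W, hW, hp, e, he, hspan⟩ := O.fil_sub (j + 1) hj p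
  obtain ⟨a, ha⟩ := O.gr_surj j hj p (1 : ℂ)
  have hmem : (a : V p) ∈ Submodule.span ℂ (Set.range fun i => e i p) := by
    rw [(hspan p hp).2]; exact a.2
  obtain ⟨c, hc⟩ := (Submodule.mem_span_range_iff_exists_fun ℂ).1 hmem
  -- Membership in the filtration is known only on W, so 0 is used elsewhere.
  let s : Π x, O.fil (j + 1) x := fun x =>
    if hx : x ∈ W then ⟨∑ i, c i • e i x, by
      rw [← (hspan x hx).2]
      exact Submodule.sum_mem _ fun i _ => Submodule.smul_mem _ _
        (Submodule.subset_span ⟨i, rfl⟩)⟩ else 0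
  have hs : IsHolSection (Fin r → ℂ) (fun x => (s x : V x)) W := by
    refine IsHolSection.congr (s := fun x => ∑ i, c i • e i x) ?_ fun x hx => by simp [s, hx]
    exact isHolSection_of_contMDiffAt fun x hx =>
      contMDiffAt_sum_smul (c := fun _ => c) (fun i => (he i).contMDiffAt hW hx)
        fun i => contMDiffAt_const
  have hsp : s p = a := by
    apply Subtype.ext
    simp [s, hp, hc]
  have hb := (gradedLine r S L j).core.mem_baseSet_at p
  have hcont := (O.contMDiffAt_grCoord hj hb hW hp hs).continuousAt
  have hne : O.grCoord j p p (s p) ≠ 0 := by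
    rw [hsp, O.grCoord_self]
    exact fun h => one_ne_zero (α := ℂ) (ha.symm.trans h)
  obtain ⟨W', hW', hW'o, hpW'⟩ := eventually_nhds_iff.1 (hcont.eventually_ne hne)
  exact ⟨W ∩ W', hW.inter hW'o, ⟨hp, hpW'⟩, s, hs.mono Set.inter_subset_left,
    fun x hx => hW' x hx.2⟩

theorem exists_adaptedFrame (hr : 2 ≤ r) (O : BranchedOper r S L V) (p : X) :
    Nonempty (AdaptedFrame O p) := by
  have hj : ∀ j : Fin r, r - 1 - j < r := fun j => by omega
  choose W hW hp s hs hne using fun j : Fin r => O.exists_local_section p (hj j)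
  let B := (gradedLine r S L (r - 1)).core.baseSet ((gradedLine r S L (r - 1)).core.indexAt p)
  -- Since r ≥ 2, the top graded line contains at least one factor TX ⊗ 𝒪(S). The frame domain of
  -- that factor at p lies in the chart and in the neighbourhood where `localEq S p` is an equation
  -- of S.
  have hB1 : B ⊆ (gradedLine r S L 1).core.baseSet ((gradedLine r S L 1).core.indexAt p) :=
    gradedLine_baseSet_subset r S L p (by omega)
  exact ⟨{
    W := B ∩ ⋂ j, W j
    isOpen := ((gradedLine r S L (r - 1)).core.isOpen_baseSet _).inter (isOpen_iInter_of_finite hW)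
    mem := ⟨(gradedLine r S L (r - 1)).core.mem_baseSet_at p, Set.mem_iInter.2 hp⟩
    sub_chart := fun x hx => (hB1 hx.1).2.1
    sub_divisor := fun x hx => (hB1 hx.1).2.2
    sub_graded := fun j hj x hx => gradedLine_baseSet_subset r S L p (by omega) hx.1
    f := s
    hol := fun j => (hs j).mono fun x hx => Set.mem_iInter.1 hx.2 j
    ne_zero := fun j x hx => hne j x (Set.mem_iInter.1 hx.2 j) }⟩

namespace AdaptedFrame

variable {O : BranchedOper r S L V} {p : X} (A : AdaptedFrame O p)

/-- Strong induction on the index: once the coefficients of smaller index vanish, the relation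
expresses c_j f_j through vectors f_i with i > j. These lie in F_{r-1-j}, so the class of c_j f_j in
the graded piece is zero, while that of f_j is not. -/
theorem linearIndependent {x : X} (hx : x ∈ A.W) :
    LinearIndependent ℂ fun j => (A.f j x : V x) := by
  rw [Fintype.linearIndependent_iff]
  intro c hc
  have key : ∀ n : ℕ, ∀ j : Fin r, (j : ℕ) = n → c j = 0 := by
    intro n
    induction n using Nat.strong_induction_on with
    | _ n ih =>
      intro j hj
      have h1 : c j • (A.f j x : V x) ∈ O.fil (r - 1 - j) x := by
        have h2 : c j • (A.f j x : V x) = -∑ i ∈ Finset.univ.erase j, c i • (A.f i x : V x) := by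
          rw [eq_neg_iff_add_eq_zero,
            Finset.add_sum_erase _ (fun i => c i • (A.f i x : V x)) (Finset.mem_univ j)]
          exact hc
        rw [h2]
        refine Submodule.neg_mem _ (Submodule.sum_mem _ fun i hi => ?_)
        rcases lt_or_gt_of_ne (Finset.ne_of_mem_erase hi) with h | h
        · rw [ih i (by rw [← hj]; exact h) i rfl, zero_smul]; exact Submodule.zero_mem _
        · have hmono := monotone_nat_of_le_succ (f := fun i => O.fil i x) fun i => O.fil_mono i x
          have h' : (j : ℕ) < i := h
          exact Submodule.smul_mem _ _ (hmono (show r - 1 - i + 1 ≤ r - 1 - j by omega) (A.f i x).2)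
      have h3 := (O.grCoord_eq_zero_iff (p := p) (show r - 1 - j < r by omega)
        (A.sub_graded _ (by omega) hx) (c j • A.f j x)).2 h1
      rw [map_smul, smul_eq_mul] at h3
      exact (mul_eq_zero.1 h3).resolve_right (A.ne_zero j x hx)
  exact fun j => key j j rfl

theorem isLocalFrameOn :
    IsLocalFrameOn 𝓘(ℂ, ℂ) (Fin r → ℂ) ω (fun j x => (A.f j x : V x)) A.W where
  linearIndependent := A.linearIndependent
  generating {x} hx := by
    have := finiteDimensional_fiber r V x
    refine ((A.linearIndependent hx).span_eq_top_of_card_eq_finrank' ?_).ge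
    rw [finrank_fiber r V x, Fintype.card_fin]
  contMDiffOn := A.hol

/-- The coefficients of a vector in the frame. -/
def coeff (x : X) : V x →ₗ[ℂ] Fin r → ℂ := LinearMap.pi fun j => A.isLocalFrameOn.coeff j x

theorem sum_coeff {x : X} (hx : x ∈ A.W) (v : V x) :
    v = ∑ j, A.coeff x v j • (A.f j x : V x) := by
  classical
  have := A.isLocalFrameOn.coeff_sum_eq (Function.update 0 x v) hx
  rw [Function.update_self] at this
  exact this

theorem coeff_frame {x : X} (hx : x ∈ A.W) (j : Fin r) :
    A.coeff x (A.f j x) = Pi.single j 1 := by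
  have h := A.sum_coeff hx (A.f j x)
  have h2 := Fintype.linearIndependent_iff.1 (A.linearIndependent hx)
    (fun i => A.coeff x (A.f j x) i - (Pi.single j 1 : Fin r → ℂ) i) (by
      simp only [sub_smul, Finset.sum_sub_distrib]
      rw [← h]
      simp [Pi.single_apply, ite_smul])
  ext i
  exact sub_eq_zero.1 (h2 i)

theorem coeff_sum {x : X} (hx : x ∈ A.W) (c : Fin r → ℂ) :
    A.coeff x (∑ j, c j • (A.f j x : V x)) = c := by
  simp only [map_sum, map_smul, A.coeff_frame hx]
  ext i
  simp [Pi.single_apply]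

theorem contMDiffAt_coeff {x : X} (hx : x ∈ A.W) {s : Π x, V x}
    (hs : ContMDiffAt 𝓘(ℂ, ℂ) (𝓘(ℂ, ℂ).prod 𝓘(ℂ, Fin r → ℂ)) ω
      (fun y => TotalSpace.mk' (Fin r → ℂ) y (s y)) x) (j : Fin r) :
    ContMDiffAt 𝓘(ℂ, ℂ) 𝓘(ℂ, ℂ) ω (fun y => A.coeff y (s y) j) x := by
  refine contMDiffAt_frame_coeff (f := fun j x => (A.f j x : V x))
    (c := fun y => A.coeff y (s y)) (fun j => (A.hol j).contMDiffAt A.isOpen hx) hs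
    (A.linearIndependent hx) ?_ j
  filter_upwards [A.isOpen.mem_nhds hx] with y hy
  exact A.sum_coeff hy (s y)

/-- The derivative of a section along the coordinate vector field. -/
abbrev nabla (_ : AdaptedFrame O p) (s : Π x, V x) (x : X) : V x := O.D.toFun s x (coordVec p x)

theorem isHolSection_nabla {s : Π x, V x} {U : Set X} (hU : IsOpen U) (hUW : U ⊆ A.W)
    (hs : IsHolSection (Fin r → ℂ) s U) : IsHolSection (Fin r → ℂ) (A.nabla s) U :=
  O.D.hol U hU (Set.subset_univ _) s _ hs
    ((isHolSection_coordVec p).mono (hUW.trans A.sub_chart))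

/-- The connection matrix, as a function of the coordinate. -/
def conn (w : ℂ) : Matrix (Fin r) (Fin r) ℂ := fun i j =>
  A.coeff ((chartAt ℂ p).symm w) (A.nabla (fun x => A.f j x) ((chartAt ℂ p).symm w)) i

theorem analyticAt_conn {x : X} (hx : x ∈ A.W) (i j : Fin r) :
    AnalyticAt ℂ (fun w => A.conn w i j) (chartAt ℂ p x) :=
  analyticAt_comp_chart_symm (A.sub_chart hx)
    (A.contMDiffAt_coeff hx ((A.isHolSection_nabla A.isOpen subset_rfl (A.hol j)).contMDiffAt
      A.isOpen hx) i)

/-- The Leibniz rule, applied to the expansion of s in the frame, gives ∇ = d/dz + `A.conn`. -/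
theorem coeff_nabla {s : Π x, V x} {x : X} (hx : x ∈ A.W)
    (hs : ContMDiffAt 𝓘(ℂ, ℂ) (𝓘(ℂ, ℂ).prod 𝓘(ℂ, Fin r → ℂ)) ω
      (fun y => TotalSpace.mk' (Fin r → ℂ) y (s y)) x) (i : Fin r) :
    A.coeff x (A.nabla s x) i =
      deriv (fun w => A.coeff _ (s ((chartAt ℂ p).symm w)) i) (chartAt ℂ p x) +
        ∑ j, A.conn (chartAt ℂ p x) i j * A.coeff x (s x) j := by
  have hc : ∀ j, MDifferentiableAt 𝓘(ℂ, ℂ) 𝓘(ℂ, ℂ) (fun y => A.coeff y (s y) j) x := fun j =>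
    (A.contMDiffAt_coeff hx hs j).mdifferentiableAt (by simp)
  have hf : ∀ j, MDifferentiableAt 𝓘(ℂ, ℂ) (𝓘(ℂ, ℂ).prod 𝓘(ℂ, Fin r → ℂ))
      (fun y => TotalSpace.mk' (Fin r → ℂ) y (A.f j y : V y)) x := fun j =>
    ((A.hol j).contMDiffAt A.isOpen hx).mdifferentiableAt (by simp)
  have h1 : O.D.toFun s x =
      O.D.toFun (fun y => ∑ j, A.coeff y (s y) j • (A.f j y : V y)) x := by
    have h0 : MDifferentiableAt 𝓘(ℂ, ℂ) (𝓘(ℂ, ℂ).prod 𝓘(ℂ, Fin r → ℂ)) (fun y =>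
        TotalSpace.mk' (Fin r → ℂ) y (∑ j, A.coeff y (s y) j • (A.f j y : V y))) x :=
      MDifferentiableAt.sum_section fun j _ => (hc j).smul_section (hf j)
    exact (O.D.isCov.mono (Set.subset_univ A.W)).congr_of_eqOn
      (hs.mdifferentiableAt (by simp)) h0 (A.isOpen.mem_nhds hx) fun y hy => A.sum_coeff hy (s y)
  have hwx : (chartAt ℂ p).symm (chartAt ℂ p x) = x := (chartAt ℂ p).left_inv (A.sub_chart hx)
  have h2 : A.nabla s x = ∑ j, (A.coeff x (s x) j • A.nabla (fun y => A.f j y) x +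
      deriv (fun w => A.coeff _ (s ((chartAt ℂ p).symm w)) j) (chartAt ℂ p x) •
        (A.f j x : V x)) := by
    change O.D.toFun s x (coordVec p x) = _
    rw [h1, covariantDerivative_sum_smul O.D.isCov Finset.univ (Set.mem_univ x) hf hc]
    simp only [sum_apply]
    refine Finset.sum_congr rfl fun j _ => ?_
    rw [← mvfderiv_coordVec (A.sub_chart hx) (hc j)]
    rfl
  have h3 : ∀ j, A.coeff x (A.nabla (fun y => (A.f j y : V y)) x) i =
      A.conn (chartAt ℂ p x) i j := fun j => by
    unfold conn; rw [hwx]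
  rw [h2]
  simp only [map_sum, map_add, map_smul, A.coeff_frame hx, Finset.sum_apply, Pi.add_apply,
    Pi.smul_apply, smul_eq_mul, h3, Finset.sum_add_distrib]
  simp only [Pi.single_apply, mul_ite, mul_one, mul_zero, Finset.sum_ite_eq, Finset.mem_univ,
    if_true]
  rw [add_comm]
  exact congrArg _ (Finset.sum_congr rfl fun j _ => mul_comm _ _)

end AdaptedFrame

end Oper

/-! ### Coordinates in twists and in 𝒪(kS) -/

section Twist

variable {X : Type u} [TopologicalSpace X] [ChartedSpace ℂ X]

theorem clm_apply_eq_mul (f : ℂ →L[ℂ] ℂ) (b : ℂ) : f b = b * f 1 := by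
  have := f.map_smul b 1
  simpa using this

theorem localEq_self_of_notMem {S : Finset X} {x : X} (hx : x ∉ S) : localEq S x x = 1 := by
  simp [localEq, hx]

/-- The neighbourhood of p meets S at most in p. Statements about frames of 𝒪(kS) can therefore be
split into the cases x = p and x ∉ S, and off S the preferred frame at x is the function 1. -/
theorem notMem_of_ne {S : Finset X} {p x : X} (hx : x ∈ divisorBaseSet S p) (h : x ≠ p) : x ∉ S :=
  notMem_of_mem_divisorBaseSet S h (mem_divisorBaseSet S x) hx

theorem divisorCoord_of_notMem {S : Finset X} (k : ℤ) {p x : X} (hx : x ∉ S) :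
    divisorCoord S k x p x = localEq S p x ^ k := by
  unfold divisorCoord
  split_ifs with h
  · subst h; rw [localEq_self_of_notMem hx, one_zpow]
  · rw [localEq_self_of_notMem hx, div_one]

theorem HolBundle.coord_tmul {F : Type} [NormedAddCommGroup F] [NormedSpace ℂ F]
    {E : HolBundle X F} {L : HolLine X} (i : (E.twist L).ι) {x : X} (a : E.Fiber x)
    (b : L.Fiber x) (b' : ℂ) (hb : L.coord i.2 x b = b') :
    (E.twist L).coord i x (tmul a b) = b' • E.coord i.1 x a := by
  have h1 : L.coord i.2 x b = (show ℂ from b) * L.core.coordChange (L.core.indexAt x) i.2 x 1 := by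
    exact clm_apply_eq_mul (L.core.coordChange (L.core.indexAt x) i.2 x) b
  have h2 : (E.twist L).coord i x (tmul a b) =
      L.core.coordChange (L.core.indexAt x) i.2 x 1 •
        E.core.coordChange (E.core.indexAt x) i.1 x ((show ℂ from b) • (show F from a)) := rfl
  rw [h2, map_smul, smul_smul, ← hb, h1, mul_comm]
  rfl

variable [T1Space X] [IsManifold 𝓘(ℂ, ℂ) ω X]

theorem coord_divisorBundle (S : Finset X) (k : ℤ) (p x : X) (a : (divisorBundle S k).Fiber x) :
    (divisorBundle S k).coord p x a = divisorCoord S k x p x * (show ℂ from a) := rfl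

theorem coord_oneSection {S : Finset X} {p x : X} (hx : x ∈ divisorBaseSet S p) :
    (divisorBundle S 1).coord p x (oneSection S x) = localEq S p x := by
  rw [coord_divisorBundle]
  change divisorCoord S 1 x p x * localEq S x x = _
  by_cases h : x = p
  · subst h; simp [divisorCoord]
  · have hS := notMem_of_ne hx h
    rw [divisorCoord_of_notMem 1 hS, localEq_self_of_notMem hS, zpow_one, mul_one]

theorem coord_tangentIncl {S : Finset X} {p x : X} (hx : x ∈ divisorBaseSet S p)
    (v : TangentSpace 𝓘(ℂ, ℂ) x) :
    (tangentTwist S).coord ((tangentTwist S).core.indexAt p) x (tangentIncl S v) =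
      localEq S p x * chartDeriv p x v :=
  HolBundle.coord_tmul (E := tangentLine X) (L := divisorBundle S 1) (achart ℂ p, p) v
    (oneSection S x) _ (coord_oneSection hx)

end Twist

/-! ### The jet map in an adapted frame -/

section Oper

variable {X : Type u} [TopologicalSpace X] [ChartedSpace ℂ X] [T1Space X]
  [IsManifold 𝓘(ℂ, ℂ) ω X]
variable {r : ℕ} {S : Finset X} {L : HolLine X} {V : X → Type v}
    [TopologicalSpace (TotalSpace (Fin r → ℂ) V)] [∀ x, AddCommGroup (V x)] [∀ x, Module ℂ (V x)]
    [∀ x, TopologicalSpace (V x)] [∀ x, IsTopologicalAddGroup (V x)]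
    [∀ x, ContinuousSMul ℂ (V x)] [FiberBundle (Fin r → ℂ) V] [VectorBundle ℂ (Fin r → ℂ) V]
    [ContMDiffVectorBundle ω (Fin r → ℂ) V 𝓘(ℂ, ℂ)]

theorem BranchedOper.mem_fil_top (O : BranchedOper r S L V) (x : X) (a : V x) :
    a ∈ O.fil (r - 1 + 1) x := by
  rw [O.fil_top (r - 1 + 1) (by omega)]; exact Submodule.mem_top

/-- The coordinate of the class in `Q` of a vector, in the frame of `Q` preferred at `p`. -/
def BranchedOper.topCoord (O : BranchedOper r S L V) (p x : X) : V x →ₗ[ℂ] ℂ :=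
  O.grCoord (r - 1) p x ∘ₗ LinearMap.id.codRestrict _ (O.mem_fil_top x)

theorem BranchedOper.topCoord_eq_coord (O : BranchedOper r S L V) (p x : X) (a : V x) :
    O.topCoord p x a =
      (topLine r S L).coord ((topLine r S L).core.indexAt p) x (O.quot x a) := rfl

/-- A section which is flat to order `N` at `y`. -/
def BranchedOper.FlatToOrder (O : BranchedOper r S L V) (N : ℕ) (y : X) (s : Π x, V x) : Prop :=
  -- A holomorphic function h vanishing at y takes the place of a coordinate centred at y, so the
  -- notion depends on no chart and can be used in the charts of p and of y alike.
  ∃ U : Set X, IsOpen U ∧ y ∈ U ∧ IsHolSection (Fin r → ℂ) s U ∧ ∃ h : X → ℂ,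
    ContMDiffAt 𝓘(ℂ, ℂ) 𝓘(ℂ, ℂ) ω h y ∧ h y = 0 ∧
    ∀ U' : Set X, IsOpen U' → U' ⊆ U → ∀ ξ : Π x : X, TangentSpace 𝓘(ℂ, ℂ) x,
      IsHolSection ℂ ξ U' → ∃ t : Π x, V x, IsHolSection (Fin r → ℂ) t U' ∧
        ∀ x ∈ U', O.D.toFun s x (ξ x) = h x ^ N • t x

theorem BranchedOper.flatToOrder_of_flat (O : BranchedOper r S L V) (N : ℕ) {y : X} {s : Π x, V x}
    {U : Set X} (hU : IsOpen U) (hy : y ∈ U) (hs : IsHolSection (Fin r → ℂ) s U)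
    (hflat : ∀ x ∈ U, O.D.toFun s x = 0) : O.FlatToOrder N y s := by
  refine ⟨U, hU, hy, hs, 0, contMDiffAt_const, rfl, fun U' _ hU' ξ _ => ⟨fun x => 0, ?_, ?_⟩⟩
  · exact (contMDiff_zeroSection ℂ V).contMDiffOn
  · intro x hx
    rw [hflat x (hU' hx)]
    simp

namespace AdaptedFrame

variable {O : BranchedOper r S L V} {p : X} (A : AdaptedFrame O p)

theorem eventually_symm_mem {x : X} (hx : x ∈ A.W) :
    ∀ᶠ w in 𝓝 (chartAt ℂ p x), (chartAt ℂ p).symm w ∈ A.W ∧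
      chartAt ℂ p ((chartAt ℂ p).symm w) = w := by
  have hc := A.sub_chart hx
  refine Filter.Eventually.and ?_ ?_
  · apply ((chartAt ℂ p).continuousAt_symm ((chartAt ℂ p).map_source hc)).eventually
    rw [(chartAt ℂ p).left_inv hc]
    exact A.isOpen.mem_nhds hx
  · filter_upwards [(chartAt ℂ p).open_target.mem_nhds ((chartAt ℂ p).map_source hc)] with w hw
    exact (chartAt ℂ p).right_inv hw

/-- The rows of the jet map in the frame, as functions of the coordinate. -/
def row : ℕ → ℂ → Fin r → ℂ
  | 0 => fun w j => O.topCoord p ((chartAt ℂ p).symm w) (A.f j ((chartAt ℂ p).symm w))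
  | k + 1 => fun w j => deriv (fun z => row k z j) w - ∑ i, row k w i * A.conn w i j

theorem contMDiffAt_topCoord (hr : 2 ≤ r) {x : X} (hx : x ∈ A.W) {U : Set X} (hU : IsOpen U)
    (hxU : x ∈ U) {s : Π x, V x} (hs : IsHolSection (Fin r → ℂ) s U) :
    ContMDiffAt 𝓘(ℂ, ℂ) 𝓘(ℂ, ℂ) ω (fun y => O.topCoord p y (s y)) x :=
  O.contMDiffAt_grCoord (by omega) (A.sub_graded _ (by omega) hx) hU hxU
    (s := fun x => ⟨s x, O.mem_fil_top x (s x)⟩) hs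

theorem analyticAt_row (hr : 2 ≤ r) {x : X} (hx : x ∈ A.W) (k : ℕ) (j : Fin r) :
    AnalyticAt ℂ (fun w => A.row k w j) (chartAt ℂ p x) := by
  induction k generalizing j with
  | zero =>
    exact analyticAt_comp_chart_symm (A.sub_chart hx)
      (A.contMDiffAt_topCoord hr hx A.isOpen hx (A.hol j))
  | succ k ih =>
    have h1 := (ih j).deriv
    have h2 := fun i => A.analyticAt_conn hx i j
    change AnalyticAt ℂ
      (fun w => deriv (fun z => A.row k z j) w - ∑ i, A.row k w i * A.conn w i j) _
    fun_prop

/-- The component of order `k` of the jet map in the frames preferred at `p`. -/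
def lam (k : ℕ) (x : X) : V x →ₗ[ℂ] ℂ :=
  ∑ j, A.row k (chartAt ℂ p x) j • (LinearMap.proj j ∘ₗ A.coeff x)

theorem lam_apply (k : ℕ) (x : X) (v : V x) :
    A.lam k x v = ∑ j, A.row k (chartAt ℂ p x) j * A.coeff x v j := by
  simp [lam]

theorem lam_zero {x : X} (hx : x ∈ A.W) (v : V x) : A.lam 0 x v = O.topCoord p x v := by
  rw [lam_apply]
  conv_rhs => rw [A.sum_coeff hx v]
  rw [map_sum]
  refine Finset.sum_congr rfl fun j _ => ?_
  rw [map_smul, smul_eq_mul, mul_comm]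
  unfold row
  rw [(chartAt ℂ p).left_inv (A.sub_chart hx)]

theorem contMDiffAt_lam (hr : 2 ≤ r) {x : X} (hx : x ∈ A.W) {s : Π x, V x}
    (hs : ContMDiffAt 𝓘(ℂ, ℂ) (𝓘(ℂ, ℂ).prod 𝓘(ℂ, Fin r → ℂ)) ω
      (fun y => TotalSpace.mk' (Fin r → ℂ) y (s y)) x) (k : ℕ) :
    ContMDiffAt 𝓘(ℂ, ℂ) 𝓘(ℂ, ℂ) ω (fun y => A.lam k y (s y)) x := by
  simp only [lam_apply]
  exact contMDiffAt_finsetSum fun j _ =>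
    (contMDiffAt_comp_chart (A.sub_chart hx) (A.analyticAt_row hr hx k j)).mul
      (A.contMDiffAt_coeff hx hs j)

/-- The recursion for `row` is designed for this: differentiating the pairing of `row k` with the
coefficients of s and subtracting the pairing with those of ∇s leaves `row (k+1)`, by `coeff_nabla`.
Thus `lam (k+1)` is the covariant derivative of `lam k` in the dual bundle. -/
theorem lam_succ (hr : 2 ≤ r) (k : ℕ) {x : X} (hx : x ∈ A.W) {s : Π x, V x}
    (hs : ContMDiffAt 𝓘(ℂ, ℂ) (𝓘(ℂ, ℂ).prod 𝓘(ℂ, Fin r → ℂ)) ω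
      (fun y => TotalSpace.mk' (Fin r → ℂ) y (s y)) x) :
    A.lam (k + 1) x (s x) =
      deriv (fun w => A.lam k _ (s ((chartAt ℂ p).symm w))) (chartAt ℂ p x) -
        A.lam k x (A.nabla s x) := by
  have hc := fun j => analyticAt_comp_chart_symm (A.sub_chart hx) (A.contMDiffAt_coeff hx hs j)
  have hr' := fun j => A.analyticAt_row hr hx k j
  have hwx : (chartAt ℂ p).symm (chartAt ℂ p x) = x := (chartAt ℂ p).left_inv (A.sub_chart hx)
  have h1 : (fun w => A.lam k _ (s ((chartAt ℂ p).symm w))) =ᶠ[𝓝 (chartAt ℂ p x)]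
      fun w => ∑ j, A.row k w j * A.coeff _ (s ((chartAt ℂ p).symm w)) j := by
    filter_upwards [A.eventually_symm_mem hx] with w hw
    rw [lam_apply, hw.2]
  have h2 : HasDerivAt (fun w => ∑ j, A.row k w j * A.coeff _ (s ((chartAt ℂ p).symm w)) j)
      (∑ j, (deriv (fun z => A.row k z j) (chartAt ℂ p x) * A.coeff x (s x) j +
        A.row k (chartAt ℂ p x) j *
          deriv (fun w => A.coeff _ (s ((chartAt ℂ p).symm w)) j) (chartAt ℂ p x)))
      (chartAt ℂ p x) :=
    HasDerivAt.fun_sum fun j _ => by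
      have := (hr' j).differentiableAt.hasDerivAt.mul (hc j).differentiableAt.hasDerivAt
      rwa [hwx] at this
  rw [h1.deriv_eq, h2.deriv, lam_apply, lam_apply]
  simp only [A.coeff_nabla hx hs]
  change ∑ j, (deriv (fun z => A.row k z j) (chartAt ℂ p x) -
    ∑ i, A.row k (chartAt ℂ p x) i * A.conn (chartAt ℂ p x) i j) * A.coeff x (s x) j = _
  simp only [sub_mul, mul_add, Finset.sum_add_distrib, Finset.sum_sub_distrib, Finset.sum_mul,
    Finset.mul_sum]
  rw [Finset.sum_comm]
  simp only [mul_assoc]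
  ring

/-- The second fundamental forms give the leading terms of the jet map. -/
theorem lam_fil (hr : 2 ≤ r) (k : ℕ) : ∀ j, k + j + 1 = r → ∀ s : Π x, O.fil (j + 1) x,
    IsHolSection (Fin r → ℂ) (fun x => (s x : V x)) A.W → ∀ x ∈ A.W,
      A.lam k x (s x) = (-1) ^ k * localEq S p x ^ k * O.grCoord j p x (s x) := by
  classical
  induction k with
  | zero =>
    intro j hj s hs x hx
    obtain rfl : j = r - 1 := by omega
    rw [A.lam_zero hx]
    simp only [pow_zero, one_mul]
    rfl
  | succ k ih =>
    intro j hj s hs x hx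
    -- As a section of F_{j+2}, s has class zero modulo F_{j+1}, so the induction hypothesis gives
    -- zero and the derivative in `lam_succ` drops out.
    have hvan : ∀ y ∈ A.W, A.lam k y (s y) = 0 := fun y hy => by
      have hmem : ∀ z, (s z : V z) ∈ O.fil (j + 1 + 1) z := fun z => O.fil_mono _ z (s z).2
      have := ih (j + 1) (by omega) (fun z => ⟨s z, hmem z⟩) hs y hy
      rw [this, (O.grCoord_eq_zero_iff (by omega) (A.sub_graded _ (by omega) hy) _).2 (s y).2,
        mul_zero]
    have hD : ∀ y ∈ A.W, A.nabla (fun x => (s x : V x)) y ∈ O.fil (j + 1 + 1) y := fun y hy =>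
      O.transversal (j + 1) (by omega) (by omega) A.W A.isOpen s hs y hy _
    -- The induction hypothesis is to be applied to ∇s as a section of F_{j+2}; off the domain of
    -- the frame it is replaced by 0.
    let t : Π y, O.fil (j + 1 + 1) y := fun y =>
      if hy : y ∈ A.W then ⟨_, hD y hy⟩ else 0
    have ht : ∀ y ∈ A.W, (t y : V y) = A.nabla (fun x => (s x : V x)) y := fun y hy => by
      simp [t, hy]
    have h1 := ih (j + 1) (by omega) t
      ((A.isHolSection_nabla A.isOpen subset_rfl hs).congr ht) x hx
    rw [ht x hx] at h1
    have h2 : (fun w => A.lam k _ (s ((chartAt ℂ p).symm w) : V ((chartAt ℂ p).symm w)))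
        =ᶠ[𝓝 (chartAt ℂ p x)]
        fun _ => 0 := by
      filter_upwards [A.eventually_symm_mem hx] with w hw
      exact hvan _ hw.1
    rw [A.lam_succ hr k hx (s := fun x => (s x : V x)) (hs.contMDiffAt A.isOpen hx), h1,
      h2.deriv_eq, deriv_const]
    -- The class of ∇s is [s] ⊗ ∂ ⊗ 1. Here ∂ has coordinate 1, and the section 1 of 𝒪(S) has the
    -- local equation as its coordinate: this is the source of every zero of the determinant.
    have h3 : O.grCoord (j + 1) p x (t x) = localEq S p x * O.grCoord j p x (s x) := by
      have h4 := O.second_fund j (by omega) A.W A.isOpen s hs x hx (coordVec p x) (hD x hx)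
      have h5 : t x = ⟨_, hD x hx⟩ := Subtype.ext (ht x hx)
      rw [h5]
      change (gradedLine r S L (j + 1)).coord _ x (O.gr (j + 1) x _) = _
      rw [h4]
      refine HolBundle.coord_tmul (E := gradedLine r S L j) (L := tangentTwist S) _ _ _ _ ?_
      exact (coord_tangentIncl (A.sub_divisor hx) _).trans (by
        rw [chartDeriv_coordVec (A.sub_chart hx), mul_one])
    rw [h3]
    ring

end AdaptedFrame

end Oper

/-! ### The determinant of the jet map and sections flat to finite order -/

section Oper

variable {X : Type u} [TopologicalSpace X] [ChartedSpace ℂ X] [T1Space X]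
  [IsManifold 𝓘(ℂ, ℂ) ω X]
variable {r : ℕ} {S : Finset X} {L : HolLine X} {V : X → Type v}
    [TopologicalSpace (TotalSpace (Fin r → ℂ) V)] [∀ x, AddCommGroup (V x)] [∀ x, Module ℂ (V x)]
    [∀ x, TopologicalSpace (V x)] [∀ x, IsTopologicalAddGroup (V x)]
    [∀ x, ContinuousSMul ℂ (V x)] [FiberBundle (Fin r → ℂ) V] [VectorBundle ℂ (Fin r → ℂ) V]
    [ContMDiffVectorBundle ω (Fin r → ℂ) V 𝓘(ℂ, ℂ)]

namespace AdaptedFrame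

variable {O : BranchedOper r S L V} {p : X} (A : AdaptedFrame O p)

/-- The jet map in the frames preferred at `p`. -/
def jet (x : X) : V x →ₗ[ℂ] Fin r → ℂ := LinearMap.pi fun k => A.lam k x

/-- The matrix of the jet map. -/
def jetMat (x : X) : Matrix (Fin r) (Fin r) ℂ := fun k j => A.lam k x (A.f j x)

theorem jetMat_mulVec {x : X} (hx : x ∈ A.W) (v : V x) :
    (A.jetMat x).mulVec (A.coeff x v) = A.jet x v := by
  ext k
  change ∑ j, A.lam k x (A.f j x) * A.coeff x v j = A.lam k x v
  conv_rhs => rw [A.sum_coeff hx v, map_sum]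
  exact Finset.sum_congr rfl fun j _ => by rw [map_smul, smul_eq_mul, mul_comm]

/-- The unit part of the determinant of the jet map. -/
def unit (x : X) : ℂ := ∏ k : Fin r, (-1) ^ (k : ℕ) * O.grCoord (r - 1 - k) p x (A.f k x)

theorem unit_ne_zero {x : X} (hx : x ∈ A.W) : A.unit x ≠ 0 :=
  Finset.prod_ne_zero_iff.2 fun k _ =>
    mul_ne_zero (pow_ne_zero _ (by norm_num)) (A.ne_zero k x hx)

theorem contMDiffAt_unit {x : X} (hx : x ∈ A.W) :
    ContMDiffAt 𝓘(ℂ, ℂ) 𝓘(ℂ, ℂ) ω A.unit x :=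
  contMDiffAt_finsetProd fun k _ => contMDiffAt_const.mul
    (O.contMDiffAt_grCoord (by omega) (A.sub_graded _ (by omega) hx) A.isOpen hx (A.hol k))

/-- For k < j the vector f_j lies in F_{r-j} ⊂ F_{r-1-k}, so `lam_fil` makes the entry (k, j) zero.
The diagonal entry of index k is a unit times the k-th power of the local equation, and the
exponents 0, …, r - 1 add up to r(r-1)/2. -/
theorem det_jetMat (hr : 2 ≤ r) {x : X} (hx : x ∈ A.W) :
    (A.jetMat x).det = localEq S p x ^ (r * (r - 1) / 2) * A.unit x := by
  have htri : ∀ k j : Fin r, k < j → A.jetMat x k j = 0 := fun k j hkj => by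
    have hlt : (k : ℕ) < j := hkj
    have hmono := fun z => monotone_nat_of_le_succ (f := fun i => O.fil i z)
      fun i => O.fil_mono i z
    have hmem : ∀ z, (A.f j z : V z) ∈ O.fil (r - 1 - k + 1) z := fun z =>
      hmono z (show r - 1 - (j : ℕ) + 1 ≤ r - 1 - k + 1 by omega) (A.f j z).2
    have h1 := A.lam_fil hr k (r - 1 - k) (by omega) (fun z => ⟨A.f j z, hmem z⟩) (A.hol j) x hx
    refine h1.trans ?_
    rw [(O.grCoord_eq_zero_iff (by omega) (A.sub_graded _ (by omega) hx) _).2, mul_zero]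
    exact hmono x (show r - 1 - (j : ℕ) + 1 ≤ r - 1 - k by omega) (A.f j x).2
  have hdiag : ∀ k : Fin r, A.jetMat x k k =
      localEq S p x ^ (k : ℕ) * ((-1) ^ (k : ℕ) * O.grCoord (r - 1 - k) p x (A.f k x)) :=
    fun k => by
      have := A.lam_fil hr k (r - 1 - k) (by omega) (A.f k) (A.hol k) x hx
      refine this.trans ?_
      ring
  rw [Matrix.det_of_isLowerTriangular _ fun k j hkj => htri k j hkj]
  simp only [hdiag, Finset.prod_mul_distrib, unit]
  rw [Finset.prod_pow_eq_pow_sum, Fin.sum_univ_eq_sum_range fun i => i, Finset.sum_range_id]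

theorem contMDiffAt_jetMat (hr : 2 ≤ r) {x : X} (hx : x ∈ A.W) (k j : Fin r) :
    ContMDiffAt 𝓘(ℂ, ℂ) 𝓘(ℂ, ℂ) ω (fun y => A.jetMat y k j) x :=
  A.contMDiffAt_lam hr hx ((A.hol j).contMDiffAt A.isOpen hx) k

theorem det_jetMat_ne_zero (hr : 2 ≤ r) {x : X} (hx : x ∈ A.W) (hS : x ∉ S) :
    (A.jetMat x).det ≠ 0 := by
  rw [A.det_jetMat hr hx]
  exact mul_ne_zero (pow_ne_zero _ (localEq_ne_zero S (A.sub_divisor hx) hS)) (A.unit_ne_zero hx)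

theorem jet_bijective (hr : 2 ≤ r) {x : X} (hx : x ∈ A.W) (hS : x ∉ S) :
    Function.Bijective (A.jet x) := by
  have := finiteDimensional_fiber r V x
  have hinj : Function.Injective (A.jet x) := by
    rw [injective_iff_map_eq_zero]
    intro v hv
    rw [← A.jetMat_mulVec hx] at hv
    have h1 := Matrix.eq_zero_of_mulVec_eq_zero (A.det_jetMat_ne_zero hr hx hS) hv
    rw [A.sum_coeff hx v, h1]
    simp
  exact ⟨hinj, (LinearMap.injective_iff_surjective_of_finrank_eq_finrank
    (by rw [finrank_fiber r V x, Module.finrank_fin_fun])).1 hinj⟩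

/-- Every vector is the value of a section which is flat to a given order. -/
theorem exists_flatToOrder (N : ℕ) {y : X} (hy : y ∈ A.W) (v : V y) :
    ∃ s, O.FlatToOrder N y s ∧ s y = v := by
  -- The frame coefficients of the section are taken to solve the equation of the connection to
  -- order N, so that ∇σ is (z - z(y))^N times a holomorphic section.
  obtain ⟨s, u, hs, hu, hv, hode⟩ := exists_solution_to_order (w₀ := chartAt ℂ p y)
    (fun i j => A.analyticAt_conn hy i j) (A.coeff y v) N
  have hyc := A.sub_chart hy
  have hcont : Filter.Tendsto (chartAt ℂ p) (𝓝 y) (𝓝 (chartAt ℂ p y)) :=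
    (chartAt ℂ p).continuousAt hyc
  have hev := hcont.eventually (hode.and
    ((Filter.eventually_all.2 fun j => (hs j).eventually_analyticAt).and
      (Filter.eventually_all.2 fun j => (hu j).eventually_analyticAt)))
  obtain ⟨U, hU, hUo, hyU⟩ := eventually_nhds_iff.1 (hev.and (A.isOpen.mem_nhds hy))
  let σ : Π x, V x := fun x => ∑ j, s (chartAt ℂ p x) j • (A.f j x : V x)
  have hσ : IsHolSection (Fin r → ℂ) σ U := isHolSection_of_contMDiffAt fun x hx =>
    contMDiffAt_sum_smul (c := fun x => s (chartAt ℂ p x))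
      (fun j => (A.hol j).contMDiffAt A.isOpen (hU x hx).2) fun j =>
      contMDiffAt_comp_chart (A.sub_chart (hU x hx).2) ((hU x hx).1.2.1 j)
  have hnabla : ∀ x ∈ U, A.nabla σ x =
      (chartAt ℂ p x - chartAt ℂ p y) ^ N • ∑ j, u (chartAt ℂ p x) j • (A.f j x : V x) := by
    intro x hx
    obtain ⟨⟨h1, -, -⟩, hxW⟩ := hU x hx
    conv_lhs => rw [A.sum_coeff hxW (A.nabla σ x)]
    rw [Finset.smul_sum]
    refine Finset.sum_congr rfl fun i _ => ?_
    rw [smul_smul, ← h1 i, A.coeff_nabla hxW (hσ.contMDiffAt hUo hx)]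
    have h2 : (fun w => A.coeff _ (σ ((chartAt ℂ p).symm w)) i) =ᶠ[𝓝 (chartAt ℂ p x)]
        fun w => s w i := by
      filter_upwards [A.eventually_symm_mem hxW] with w hw
      rw [A.coeff_sum hw.1, hw.2]
    rw [h2.deriv_eq, A.coeff_sum hxW]
  refine ⟨σ, ⟨U, hUo, hyU, hσ, fun x => chartAt ℂ p x - chartAt ℂ p y, ?_, sub_self _, ?_⟩, ?_⟩
  · exact (contMDiffOn_chart.contMDiffAt ((chartAt ℂ p).open_source.mem_nhds hyc)).sub
      contMDiffAt_const
  · intro U' hU' hsub ξ hξ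
    refine ⟨fun x => ∑ j, (chartDeriv p x (ξ x) * u (chartAt ℂ p x) j) • (A.f j x : V x),
      isHolSection_of_contMDiffAt fun x hx => contMDiffAt_sum_smul
        (c := fun x j => chartDeriv p x (ξ x) * u (chartAt ℂ p x) j)
        (fun j => (A.hol j).contMDiffAt A.isOpen (hU x (hsub hx)).2) fun j =>
        ((contMDiffAt_vectorField_iff (A.sub_chart (hU x (hsub hx)).2)).1
          (hξ.contMDiffAt hU' hx)).mul
        (contMDiffAt_comp_chart (A.sub_chart (hU x (hsub hx)).2) ((hU x (hsub hx)).1.2.2 j)),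
      fun x hx => ?_⟩
    have hxc := A.sub_chart (hU x (hsub hx)).2
    conv_lhs => rw [← chartDeriv_smul_coordVec hxc (ξ x), map_smul]
    have h3 := hnabla x (hsub hx)
    change O.D.toFun σ x (coordVec p x) = _ at h3
    rw [h3]
    simp only [Finset.smul_sum, smul_smul]
    exact Finset.sum_congr rfl fun j _ => by congr 1; ring
  · change ∑ j, s (chartAt ℂ p y) j • (A.f j y : V y) = v
    rw [hv, ← A.sum_coeff hy]

/-- The jet map computes the derivatives of the image in `Q` of a section which is flat to
sufficiently high order. -/
theorem lam_of_flatToOrder (hr : 2 ≤ r) {N k : ℕ} (hk : k ≤ N) {y : X} (hy : y ∈ A.W)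
    {s : Π x, V x} (hs : O.FlatToOrder N y s) :
    A.lam k y (s y) = iteratedDeriv k
      (fun w => O.topCoord p _ (s ((chartAt ℂ p).symm w))) (chartAt ℂ p y) := by
  obtain ⟨U, hU, hyU, hsU, h, hh, hhy, hflat⟩ := hs
  have hyc := A.sub_chart hy
  have hwy : (chartAt ℂ p).symm (chartAt ℂ p y) = y := (chartAt ℂ p).left_inv hyc
  obtain ⟨t, ht, hst⟩ := hflat (U ∩ A.W) (hU.inter A.isOpen) Set.inter_subset_left
    (coordVec p) ((isHolSection_coordVec p).mono fun x hx => A.sub_chart hx.2)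
  have hUW := hU.inter A.isOpen
  have hyUW : y ∈ U ∩ A.W := ⟨hyU, hy⟩
  have hev : ∀ᶠ w in 𝓝 (chartAt ℂ p y), (chartAt ℂ p).symm w ∈ U ∩ A.W := by
    apply ((chartAt ℂ p).continuousAt_symm ((chartAt ℂ p).map_source hyc)).eventually
    rw [hwy]
    exact hUW.mem_nhds hyUW
  have hana : AnalyticAt ℂ (fun w => h ((chartAt ℂ p).symm w)) (chartAt ℂ p y) :=
    analyticAt_comp_chart_symm hyc hh
  -- Since h vanishes at y, it is (z - z(y)) h₁, and its N-th power gives the defect the form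
  -- required by `iteratedDeriv_dotProduct`.
  obtain ⟨h₁, hh₁, hh₁'⟩ := (natCast_le_analyticOrderAt (n := 1) hana).1 (by
    rw [Nat.cast_one, Order.one_le_iff_ne_zero]
    exact hana.analyticOrderAt_ne_zero.2 (by rw [hwy, hhy]))
  have hcs := fun j => analyticAt_comp_chart_symm hyc
    (A.contMDiffAt_coeff hy (hsU.contMDiffAt hU hyU) j)
  have hct := fun j => analyticAt_comp_chart_symm hyc
    (A.contMDiffAt_coeff hy (ht.contMDiffAt hUW hyUW) j)
  have key := iteratedDeriv_dotProduct (N := N) (k := k) (a := A.row) (A := A.conn)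
    (s := fun w => A.coeff _ (s ((chartAt ℂ p).symm w)))
    (u := fun w j => h₁ w ^ N * A.coeff _ (t ((chartAt ℂ p).symm w)) j) (w₀ := chartAt ℂ p y)
    (fun k j => A.analyticAt_row hr hy k j) hcs
    (fun j => (hh₁.pow N).mul (hct j)) (fun k => Filter.Eventually.of_forall fun w j => rfl) ?_ hk
  · rw [hwy] at key
    rw [lam_apply, ← key]
    refine Filter.EventuallyEq.iteratedDeriv_eq _ ?_
    filter_upwards [A.eventually_symm_mem hy] with w hw
    rw [← A.lam_zero hw.1, lam_apply, hw.2]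
  · filter_upwards [hev, hh₁', A.eventually_symm_mem hy] with w h1 h2 h3 i
    have h4 := A.coeff_nabla h1.2 (hsU.contMDiffAt hU h1.1) i
    rw [h3.2] at h4
    rw [← h4]
    change A.coeff _ (O.D.toFun s _ (coordVec p _)) i = _
    rw [hst _ h1, map_smul, h2]
    simp only [Pi.smul_apply, smul_eq_mul, pow_one, mul_pow]
    ring

/-- The jet maps attached to different points are related by the change of coordinates for jets. -/
theorem coord_jet (hr : 2 ≤ r) {y : X} (hy : y ∈ A.W) (B : AdaptedFrame O y) (v : V y) :
    (jetBundle (topLine r S L) r).coord ((jetBundle (topLine r S L) r).core.indexAt p) y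
      (B.jet y v) = A.jet y v := by
  -- The vector v is realised as the value of a section flat to order r. Both jets then consist of
  -- derivatives of order less than r of its image in Q, written in two coordinate systems.
  obtain ⟨s, hs, rfl⟩ := A.exists_flatToOrder r hy v
  have hs' := hs
  obtain ⟨U, hU, hyU, hsU, -⟩ := hs'
  set Q := topLine r S L with hQ
  have hyb : y ∈ jetBaseSet Q (Q.core.indexAt p, achart ℂ p) :=
    ⟨A.sub_graded _ (by omega) hy, A.sub_chart hy⟩
  have hyb' : y ∈ jetBaseSet Q (Q.core.indexAt y, achart ℂ y) :=
    ⟨Q.core.mem_baseSet_at y, mem_chart_source ℂ y⟩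
  have hana : AnalyticAt ℂ (fun w => O.topCoord y _ (s ((chartAt ℂ y).symm w)))
      (chartAt ℂ y y) :=
    analyticAt_comp_chart_symm (mem_chart_source ℂ y)
      (B.contMDiffAt_topCoord hr B.mem hU hyU hsU)
  have hB : B.jet y (s y) = fun k : Fin r => iteratedDeriv k
      (fun w => O.topCoord y _ (s ((chartAt ℂ y).symm w))) (chartAt ℂ y y) := by
    ext k
    exact B.lam_of_flatToOrder hr k.2.le B.mem hs
  ext k
  have h1 := jetCoordChange_mulVec Q r (Q.core.indexAt y, achart ℂ y)
    (Q.core.indexAt p, achart ℂ p) hyb' hyb hana k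
  change (jetCoordChange Q r (Q.core.indexAt y, achart ℂ y) (Q.core.indexAt p, achart ℂ p)
    y).mulVec (B.jet y (s y)) k = _
  rw [hB]
  refine h1.trans ?_
  refine Eq.trans ?_ (A.lam_of_flatToOrder hr k.2.le hy hs).symm
  refine Filter.EventuallyEq.iteratedDeriv_eq _ ?_
  have hev : ∀ᶠ w in 𝓝 (chartAt ℂ p y), (chartAt ℂ p).symm w ∈ A.W ∩ B.W := by
    apply ((chartAt ℂ p).continuousAt_symm ((chartAt ℂ p).map_source hyb.2)).eventually
    rw [(chartAt ℂ p).left_inv hyb.2]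
    exact (A.isOpen.inter B.isOpen).mem_nhds ⟨hy, B.mem⟩
  filter_upwards [hev] with w hw
  have e1 : (chartAt ℂ y).symm (chartAt ℂ y ((chartAt ℂ p).symm w)) = (chartAt ℂ p).symm w :=
    (chartAt ℂ y).left_inv (B.sub_chart hw.2)
  set z := (chartAt ℂ p).symm w with hz
  change Q.core.coordChange (Q.core.indexAt y) (Q.core.indexAt p) z 1 *
    O.topCoord y ((chartAt ℂ y).symm (chartAt ℂ y z)) (s ((chartAt ℂ y).symm (chartAt ℂ y z))) =
      O.topCoord p z (s z)
  rw [e1, mul_comm, ← clm_apply_eq_mul, O.topCoord_eq_coord, O.topCoord_eq_coord]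
  exact Q.coordChange_coord (B.sub_graded _ (by omega) hw.2) (A.sub_graded _ (by omega) hw.1) _

end AdaptedFrame

end Oper

/-! ### Transport of a connection along an isomorphism -/

section Transport

variable {X : Type u} [TopologicalSpace X] [ChartedSpace ℂ X] [IsManifold 𝓘(ℂ, ℂ) ω X]
variable {F F' : Type} [NormedAddCommGroup F] [NormedSpace ℂ F]
    [NormedAddCommGroup F'] [NormedSpace ℂ F'] [FiniteDimensional ℂ F']
    {V : X → Type*} {V' : X → Type*}
    [TopologicalSpace (TotalSpace F V)] [∀ x, AddCommGroup (V x)] [∀ x, Module ℂ (V x)]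
    [∀ x, TopologicalSpace (V x)] [∀ x, IsTopologicalAddGroup (V x)]
    [∀ x, ContinuousSMul ℂ (V x)] [FiberBundle F V] [VectorBundle ℂ F V]
    [TopologicalSpace (TotalSpace F' V')] [∀ x, AddCommGroup (V' x)] [∀ x, Module ℂ (V' x)]
    [∀ x, TopologicalSpace (V' x)] [∀ x, IsTopologicalAddGroup (V' x)]
    [∀ x, ContinuousSMul ℂ (V' x)] [FiberBundle F' V'] [VectorBundle ℂ F' V']
    [ContMDiffVectorBundle ω F' V' 𝓘(ℂ, ℂ)]

/-- The connection on `V'` which corresponds to `D` under an isomorphism over `Ω`. -/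
def transportConnection (D : HolConnection F V Set.univ) {Ω : Set X} (hΩ : IsOpen Ω)
    (Θ : Π x, V' x →ₗ[ℂ] V x) (Θ' : Π x, V x →ₗ[ℂ] V' x)
    (hΘ : ∀ W : Set X, IsOpen W → W ⊆ Ω → ∀ s : Π x, V' x, IsHolSection F' s W →
      IsHolSection F (fun x => Θ x (s x)) W)
    (hΘ' : ∀ W : Set X, IsOpen W → W ⊆ Ω → ∀ s : Π x, V x, IsHolSection F s W →
      IsHolSection F' (fun x => Θ' x (s x)) W)
    (hinv : ∀ x ∈ Ω, ∀ a, Θ' x (Θ x a) = a) : HolConnection F' V' Ω where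
  -- Since Θ' is only assumed linear, the derivative is taken along one spanning tangent vector and
  -- extended by the coordinate form, which yields a continuous linear map.
  toFun t x := (chartDeriv x x).smulRight
    (Θ' x (D.toFun (fun y => Θ y (t y)) x (coordVec x x)))
  isCov :=
    { add := fun {σ σ' x} hσ hσ' hx => by
        have h1 := mdifferentiableAt_map_section hΩ Θ hΘ hx hσ
        have h2 := mdifferentiableAt_map_section hΩ Θ hΘ hx hσ'
        have e : (fun y => Θ y ((σ + σ') y)) = (fun y => Θ y (σ y)) + fun y => Θ y (σ' y) := by
          ext y; simp
        rw [e, D.isCov.add h1 h2]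
        refine ContinuousLinearMap.ext fun v => ?_
        simp
      leibniz := fun {σ g x} hσ hg hx => by
        have h1 := mdifferentiableAt_map_section hΩ Θ hΘ hx hσ
        have e : (fun y => Θ y ((g • σ) y)) = g • fun y => Θ y (σ y) := by
          ext y; simp
        rw [e, D.isCov.leibniz h1 hg]
        refine ContinuousLinearMap.ext fun v => ?_
        have h2 : mvfderiv 𝓘(ℂ, ℂ) g x v =
            chartDeriv x x v * mvfderiv 𝓘(ℂ, ℂ) g x (coordVec x x) := by
          conv_lhs => rw [← chartDeriv_smul_coordVec (mem_chart_source ℂ x) v]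
          rw [map_smul, smul_eq_mul]
        simp only [add_apply, smul_apply, ContinuousLinearMap.smulRight_apply, map_add, map_smul,
          hinv x hx, smul_add, smul_smul, h2, mul_comm] }
  hol W hW hWΩ s ξ hs hξ := by
    refine (hΘ' W hW hWΩ _ (D.hol W hW (Set.subset_univ _) _ ξ (hΘ W hW hWΩ s hs) hξ)).congr
      fun x _ => ?_
    rw [ContinuousLinearMap.smulRight_apply, ← map_smul, ← map_smul,
      chartDeriv_smul_coordVec (mem_chart_source ℂ x)]

theorem transportConnection_apply (D : HolConnection F V Set.univ) {Ω : Set X} (hΩ : IsOpen Ω)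
    (Θ : Π x, V' x →ₗ[ℂ] V x) (Θ' : Π x, V x →ₗ[ℂ] V' x)
    (hΘ : ∀ W : Set X, IsOpen W → W ⊆ Ω → ∀ s : Π x, V' x, IsHolSection F' s W →
      IsHolSection F (fun x => Θ x (s x)) W)
    (hΘ' : ∀ W : Set X, IsOpen W → W ⊆ Ω → ∀ s : Π x, V x, IsHolSection F s W →
      IsHolSection F' (fun x => Θ' x (s x)) W)
    (hinv : ∀ x ∈ Ω, ∀ a, Θ' x (Θ x a) = a) (t : Π x, V' x) (x : X)
    (v : TangentSpace 𝓘(ℂ, ℂ) x) :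
    (transportConnection D hΩ Θ Θ' hΘ hΘ' hinv).toFun t x v =
      Θ' x (D.toFun (fun y => Θ y (t y)) x v) := by
  change (chartDeriv x x).smulRight
    (Θ' x (D.toFun (fun y => Θ y (t y)) x (coordVec x x))) v = _
  rw [ContinuousLinearMap.smulRight_apply, ← map_smul, ← map_smul,
      chartDeriv_smul_coordVec (mem_chart_source ℂ x)]

end Transport

/-! ### The inclusion E ⊗ 𝒪(-mS) ⟶ E off S -/

section TwistIncl

theorem eventually_notMem {X : Type u} [TopologicalSpace X] [T1Space X] {S : Finset X}
    {x : X} (hx : x ∉ S) : ∀ᶠ y in 𝓝 x, y ∉ S :=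
  S.finite_toSet.isClosed.isOpen_compl.mem_nhds (by simpa using hx)

theorem localEq_of_notMem {X : Type u} [TopologicalSpace X] [ChartedSpace ℂ X] {S : Finset X}
    {p : X} (hp : p ∉ S) (x : X) : localEq S p x = 1 := by
  simp [localEq, hp]

variable {X : Type u} [TopologicalSpace X] [ChartedSpace ℂ X] [T1Space X]
  [IsManifold 𝓘(ℂ, ℂ) ω X] {F : Type} [NormedAddCommGroup F] [NormedSpace ℂ F]
  (E : HolBundle X F) (S : Finset X) (m : ℕ)

/-- The inverse of `twistIncl` off `S`. -/
def twistInclInv (x : X) : E.Fiber x →ₗ[ℂ] (E.twist (divisorBundle S (-(m : ℤ)))).Fiber x :=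
  (LinearMap.id : F →ₗ[ℂ] F)

variable {S}

theorem twistIncl_twistInclInv {x : X} (hx : x ∉ S) (a : E.Fiber x) :
    twistIncl E S m x (twistInclInv E S m x a) = a := by
  change localEq S x x ^ m • (show F from a) = a
  rw [localEq_self_of_notMem hx, one_pow, one_smul]

theorem twistInclInv_twistIncl {x : X} (hx : x ∉ S)
    (a : (E.twist (divisorBundle S (-(m : ℤ)))).Fiber x) :
    twistInclInv E S m x (twistIncl E S m x a) = a := by
  change localEq S x x ^ m • (show F from a) = a
  rw [localEq_self_of_notMem hx, one_pow, one_smul]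

theorem coord_twist_divisorBundle (i : E.ι) (p : X) {x : X} (hx : x ∉ S)
    (a : (E.twist (divisorBundle S (-(m : ℤ)))).Fiber x) :
    (E.twist (divisorBundle S (-(m : ℤ)))).coord (i, p) x a =
      localEq S p x ^ (-(m : ℤ)) • E.coord i x (twistIncl E S m x a) := by
  have h1 : (E.twist (divisorBundle S (-(m : ℤ)))).coord (i, p) x a =
      (divisorCoord S (-(m : ℤ)) x p x * 1) •
        E.core.coordChange (E.core.indexAt x) i x (show F from a) := rfl
  have h2 : twistIncl E S m x a = localEq S x x ^ m • (show F from a) := rfl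
  rw [h1, mul_one, divisorCoord_of_notMem _ hx, h2, localEq_self_of_notMem hx, one_pow, one_smul]
  rfl

/-- For x ∉ S the local equation with index x is the constant 1, so both sections have the same
coordinates near x. -/
theorem contMDiffAt_twistIncl_iff {x : X} (hx : x ∉ S)
    {t : Π x, (E.twist (divisorBundle S (-(m : ℤ)))).Fiber x} :
    ContMDiffAt 𝓘(ℂ, ℂ) (𝓘(ℂ, ℂ).prod 𝓘(ℂ, F)) ω
      (fun y => TotalSpace.mk' F y (twistIncl E S m y (t y))) x ↔
    ContMDiffAt 𝓘(ℂ, ℂ) (𝓘(ℂ, ℂ).prod 𝓘(ℂ, F)) ω (fun y => TotalSpace.mk' F y (t y)) x := by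
  rw [E.contMDiffAt_section_iff (E.core.mem_baseSet_at x),
    (E.twist (divisorBundle S (-(m : ℤ)))).contMDiffAt_section_iff
      (i := (E.core.indexAt x, x)) ⟨E.core.mem_baseSet_at x, mem_divisorBaseSet S x⟩]
  refine Filter.EventuallyEq.contMDiffAt_iff ?_
  filter_upwards [eventually_notMem hx] with y hy
  rw [coord_twist_divisorBundle E m _ _ hy, localEq_of_notMem hx, one_zpow, one_smul]

theorem isHolSection_twistIncl {W : Set X} (hW : IsOpen W) (hWS : W ⊆ (S : Set X)ᶜ)
    {t : Π x, (E.twist (divisorBundle S (-(m : ℤ)))).Fiber x} (ht : IsHolSection F t W) :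
    IsHolSection F (fun y => twistIncl E S m y (t y)) W :=
  isHolSection_of_contMDiffAt fun x hx =>
    (contMDiffAt_twistIncl_iff E m (by simpa using hWS hx)).2 (ht.contMDiffAt hW hx)

theorem isHolSection_twistInclInv {W : Set X} (hW : IsOpen W) (hWS : W ⊆ (S : Set X)ᶜ)
    {s : Π x, E.Fiber x} (hs : IsHolSection F s W) :
    IsHolSection F (fun y => twistInclInv E S m y (s y)) W :=
  isHolSection_of_contMDiffAt fun x hx => by
    have hxS : x ∉ S := by simpa using hWS hx
    refine (contMDiffAt_twistIncl_iff E m hxS).1 ?_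
    refine (hs.contMDiffAt hW hx).congr_of_eventuallyEq ?_
    filter_upwards [eventually_notMem hxS] with y hy
    rw [twistIncl_twistInclInv E m hy]

end TwistIncl

/-! ### The global jet homomorphism and the connection on E -/

section Oper

variable {X : Type u} [TopologicalSpace X] [ChartedSpace ℂ X] [T1Space X]
  [IsManifold 𝓘(ℂ, ℂ) ω X]
variable {r : ℕ} {S : Finset X} {L : HolLine X} {V : X → Type v}
    [TopologicalSpace (TotalSpace (Fin r → ℂ) V)] [∀ x, AddCommGroup (V x)] [∀ x, Module ℂ (V x)]
    [∀ x, TopologicalSpace (V x)] [∀ x, IsTopologicalAddGroup (V x)]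
    [∀ x, ContinuousSMul ℂ (V x)] [FiberBundle (Fin r → ℂ) V] [VectorBundle ℂ (Fin r → ℂ) V]
    [ContMDiffVectorBundle ω (Fin r → ℂ) V 𝓘(ℂ, ℂ)]

namespace BranchedOper

variable (O : BranchedOper r S L V) (hr : 2 ≤ r)

/-- An adapted frame near `p`. -/
def frame (p : X) : AdaptedFrame O p := (exists_adaptedFrame hr O p).some

/-- The jet homomorphism of an oper. -/
def jetHom : HolHom (Fin r → ℂ) (Fin r → ℂ) V (jetBundle (topLine r S L) r).Fiber where
  toFun x := (O.frame hr x).jet x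
  -- At each point the map is defined by a frame chosen for that point. Holomorphy near p follows
  -- because `coord_jet` rewrites all of these maps in the single frame at p.
  hol W hW s hs := isHolSection_of_contMDiffAt fun p hp => by
    refine ((jetBundle (topLine r S L) r).contMDiffAt_section_iff
      ((jetBundle (topLine r S L) r).core.mem_baseSet_at p)).2 ?_
    have h1 : ContMDiffAt 𝓘(ℂ, ℂ) 𝓘(ℂ, Fin r → ℂ) ω
        (fun y => (O.frame hr p).jet y (s y)) p :=
      contMDiffAt_pi_space.2 fun k =>
        (O.frame hr p).contMDiffAt_lam hr (O.frame hr p).mem (hs.contMDiffAt hW hp) k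
    refine h1.congr_of_eventuallyEq ?_
    filter_upwards [(O.frame hr p).isOpen.mem_nhds (O.frame hr p).mem] with y hy
    exact (O.frame hr p).coord_jet hr hy (O.frame hr y) (s y)

theorem coord_jetHom {p x : X} (hx : x ∈ (O.frame hr p).W) (v : V x) :
    (jetBundle (topLine r S L) r).coord ((jetBundle (topLine r S L) r).core.indexAt p) x
      ((O.jetHom hr).toFun x v) = (O.frame hr p).jet x v :=
  (O.frame hr p).coord_jet hr hx (O.frame hr x) v

theorem isFlatJetMap_jetHom : O.IsFlatJetMap (O.jetHom hr) := by
  intro W hW s hs hflat x hx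
  funext k
  exact (O.frame hr x).lam_of_flatToOrder hr k.2.le (O.frame hr x).mem
    (O.flatToOrder_of_flat r hW hx hs hflat)

theorem jetHom_bijective {x : X} (hx : x ∉ S) : Function.Bijective ((O.jetHom hr).toFun x) :=
  (O.frame hr x).jet_bijective hr (O.frame hr x).mem hx

open Classical in
/-- The inverse of the jet homomorphism off `S`. -/
def jetInv (x : X) : (jetBundle (topLine r S L) r).Fiber x →ₗ[ℂ] V x :=
  -- The value 0 over S is a mere default; the inverse is used only off S.
  if hx : x ∉ S then (LinearEquiv.ofBijective _ (O.jetHom_bijective hr hx)).symm.toLinearMap else 0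

theorem jetHom_jetInv {x : X} (hx : x ∉ S) (a : (jetBundle (topLine r S L) r).Fiber x) :
    (O.jetHom hr).toFun x (O.jetInv hr x a) = a := by
  unfold jetInv
  rw [dif_pos hx]
  exact (LinearEquiv.ofBijective _ (O.jetHom_bijective hr hx)).apply_symm_apply a

/-- The frame coefficients of the preimage solve a linear system with matrix `jetMat`, whose
determinant does not vanish off S. -/
theorem isHolSection_jetInv {W : Set X} (hW : IsOpen W) (hWS : W ⊆ (S : Set X)ᶜ)
    {t : Π x, (jetBundle (topLine r S L) r).Fiber x} (ht : IsHolSection (Fin r → ℂ) t W) :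
    IsHolSection (Fin r → ℂ) (fun x => O.jetInv hr x (t x)) W :=
  isHolSection_of_contMDiffAt fun p hp => by
    have hpS : p ∉ S := by simpa using hWS hp
    set A := O.frame hr p
    have ht' := contMDiffAt_pi_space.1 (((jetBundle (topLine r S L) r).contMDiffAt_section_iff
      ((jetBundle (topLine r S L) r).core.mem_baseSet_at p)).1 (ht.contMDiffAt hW hp))
    have hnhds := A.isOpen.mem_nhds A.mem
    have hc := contMDiffAt_of_mulVec_eq (M := A.jetMat)
      (c := fun y => A.coeff y (O.jetInv hr y (t y)))
      (fun i j => A.contMDiffAt_jetMat hr A.mem i j) ht' (A.det_jetMat_ne_zero hr A.mem hpS) (by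
        filter_upwards [hnhds, eventually_notMem hpS] with y hy hyS
        rw [A.jetMat_mulVec hy, ← O.coord_jetHom hr hy, O.jetHom_jetInv hr hyS])
    refine (contMDiffAt_sum_smul (f := fun j x => (A.f j x : V x))
      (c := fun y => A.coeff y (O.jetInv hr y (t y)))
      (fun j => (A.hol j).contMDiffAt A.isOpen A.mem) hc).congr_of_eventuallyEq ?_
    filter_upwards [hnhds] with y hy
    rw [← A.sum_coeff hy]

/-- The identification of `E` with `V` off `S`. -/
def fromTwist (x : X) : (jetTwist r S L).Fiber x →ₗ[ℂ] V x :=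
  O.jetInv hr x ∘ₗ twistIncl (jetBundle (topLine r S L) r) S (r - 1) x

/-- The identification of `V` with `E` off `S`. -/
def toTwist (x : X) : V x →ₗ[ℂ] (jetTwist r S L).Fiber x :=
  twistInclInv (jetBundle (topLine r S L) r) S (r - 1) x ∘ₗ (O.jetHom hr).toFun x

theorem toTwist_fromTwist {x : X} (hx : x ∉ S) (a : (jetTwist r S L).Fiber x) :
    O.toTwist hr x (O.fromTwist hr x a) = a := by
  change twistInclInv _ S (r - 1) x ((O.jetHom hr).toFun x (O.jetInv hr x _)) = a
  rw [O.jetHom_jetInv hr hx]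
  exact twistInclInv_twistIncl _ _ hx a

theorem jetHom_fromTwist {x : X} (hx : x ∉ S) (a : (jetTwist r S L).Fiber x) :
    (O.jetHom hr).toFun x (O.fromTwist hr x a) =
      twistIncl (jetBundle (topLine r S L) r) S (r - 1) x a :=
  O.jetHom_jetInv hr hx _

theorem isHolSection_fromTwist {W : Set X} (hW : IsOpen W) (hWS : W ⊆ (S : Set X)ᶜ)
    {t : Π x, (jetTwist r S L).Fiber x} (ht : IsHolSection (Fin r → ℂ) t W) :
    IsHolSection (Fin r → ℂ) (fun x => O.fromTwist hr x (t x)) W :=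
  O.isHolSection_jetInv hr hW hWS (isHolSection_twistIncl _ _ hW hWS ht)

/-- The connection on `E` over the complement of `S` which corresponds to that of the oper. -/
def twistConnection : HolConnection (Fin r → ℂ) (jetTwist r S L).Fiber ((S : Set X)ᶜ) :=
  transportConnection O.D S.finite_toSet.isClosed.isOpen_compl (O.fromTwist hr) (O.toTwist hr)
    (fun _ hW hWS _ hs => O.isHolSection_fromTwist hr hW hWS hs)
    (fun _ hW hWS _ hs => isHolSection_twistInclInv _ _ hW hWS ((O.jetHom hr).hol _ hW _ hs))
    fun x hx a => O.toTwist_fromTwist hr (by simpa using hx) a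

theorem twistConnection_apply (t : Π x, (jetTwist r S L).Fiber x) (x : X)
    (v : TangentSpace 𝓘(ℂ, ℂ) x) : (O.twistConnection hr).toFun t x v =
      O.toTwist hr x (O.D.toFun (fun y => O.fromTwist hr y (t y)) x v) :=
  transportConnection_apply ..

/-- Off S the map Φ is injective, so the section s that corresponds to t is the transported one on
W. A connection depends only on the germ of the section. -/
theorem isTransport_twistConnection : O.IsTransport (O.jetHom hr) (O.twistConnection hr) := by
  intro W hW hWS s t hs ht hst x hx v
  have hxS : x ∉ S := by simpa using hWS hx
  have h1 : O.D.toFun (fun y => O.fromTwist hr y (t y)) x = O.D.toFun s x := by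
    refine (O.D.isCov.mono (Set.subset_univ W)).congr_of_eqOn
      (((O.isHolSection_fromTwist hr hW hWS ht).contMDiffAt hW hx).mdifferentiableAt (by simp))
      ((hs.contMDiffAt hW hx).mdifferentiableAt (by simp)) (hW.mem_nhds hx) fun y hy => ?_
    have hyS : y ∉ S := by simpa using hWS hy
    apply (O.jetHom_bijective hr hyS).1
    rw [hst y hy, O.jetHom_fromTwist hr hyS]
  rw [twistConnection_apply, h1]
  exact (twistIncl_twistInclInv _ _ hxS _).symm

end BranchedOper

end Oper

/-! ### The de Rham connection on 𝒪(-mS) is logarithmic -/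

section DeRham

variable {X : Type u} [TopologicalSpace X] [ChartedSpace ℂ X]

theorem functionValue_of_notMem [T1Space X] [IsManifold 𝓘(ℂ, ℂ) ω X] {S : Finset X} (k : ℤ)
    {x : X} (hx : x ∉ S) (a : (divisorBundle S k).Fiber x) : functionValue S k x a = a := by
  change localEq S x x ^ (-k) * _ = _
  rw [localEq_self_of_notMem hx, one_zpow]
  exact one_mul (show ℂ from a)

variable [IsManifold 𝓘(ℂ, ℂ) ω X]

theorem contMDiffAt_mvfderiv {W : Set X} (hW : IsOpen W) {g : X → ℂ}
    (hg : ∀ x ∈ W, ContMDiffAt 𝓘(ℂ, ℂ) 𝓘(ℂ, ℂ) ω g x) {ξ : Π x : X, TangentSpace 𝓘(ℂ, ℂ) x}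
    (hξ : IsHolSection ℂ ξ W) {x : X} (hx : x ∈ W) :
    ContMDiffAt 𝓘(ℂ, ℂ) 𝓘(ℂ, ℂ) ω (fun y => mvfderiv 𝓘(ℂ, ℂ) g y (ξ y)) x := by
  have hxc := mem_chart_source ℂ x
  have h1 : ContMDiffAt 𝓘(ℂ, ℂ) 𝓘(ℂ, ℂ) ω (fun y => chartDeriv x y (ξ y) *
      deriv (fun w => g ((chartAt ℂ x).symm w)) (chartAt ℂ x y)) x :=
    ((contMDiffAt_vectorField_iff hxc).1 (hξ.contMDiffAt hW hx)).mul
      (contMDiffAt_comp_chart hxc (analyticAt_comp_chart_symm hxc (hg x hx)).deriv)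
  refine h1.congr_of_eventuallyEq ?_
  filter_upwards [hW.mem_nhds hx, (chartAt ℂ x).open_source.mem_nhds hxc] with y hy hyc
  exact mvfderiv_eq_deriv hyc ((hg y hy).mdifferentiableAt (by simp)) _

variable [T1Space X] {S : Finset X} (k : ℤ)

theorem coord_divisorBundle_of_notMem {p x : X} (hx : x ∉ S) (a : (divisorBundle S k).Fiber x) :
    (divisorBundle S k).coord p x a = localEq S p x ^ k * functionValue S k x a := by
  rw [functionValue_of_notMem k hx, coord_divisorBundle, divisorCoord_of_notMem k hx]

theorem eventually_coord_divisorBundle {x : X} (hx : x ∉ S) (t : Π y, (divisorBundle S k).Fiber y) :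
    (fun y => (divisorBundle S k).coord x y (t y)) =ᶠ[𝓝 x]
      fun y => functionValue S k y (t y) := by
  filter_upwards [eventually_notMem hx] with y hy
  rw [coord_divisorBundle_of_notMem k hy, localEq_of_notMem hx, one_zpow, one_mul]

theorem contMDiffAt_divisorBundle_iff {x : X} (hx : x ∉ S) {t : Π y, (divisorBundle S k).Fiber y} :
    ContMDiffAt 𝓘(ℂ, ℂ) (𝓘(ℂ, ℂ).prod 𝓘(ℂ, ℂ)) ω (fun y => TotalSpace.mk' ℂ y (t y)) x ↔
      ContMDiffAt 𝓘(ℂ, ℂ) 𝓘(ℂ, ℂ) ω (fun y => functionValue S k y (t y)) x := by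
  rw [(divisorBundle S k).contMDiffAt_section_iff (i := x) (mem_divisorBaseSet S x)]
  exact (eventually_coord_divisorBundle k hx t).contMDiffAt_iff

theorem mdifferentiableAt_functionValue {x : X} (hx : x ∉ S)
    {t : Π y, (divisorBundle S k).Fiber y}
    (ht : MDifferentiableAt 𝓘(ℂ, ℂ) (𝓘(ℂ, ℂ).prod 𝓘(ℂ, ℂ)) (fun y => TotalSpace.mk' ℂ y (t y)) x) :
    MDifferentiableAt 𝓘(ℂ, ℂ) 𝓘(ℂ, ℂ) (fun y => functionValue S k y (t y)) x :=
  (((divisorBundle S k).mdifferentiableAt_section_iff (i := x)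
    (mem_divisorBaseSet S x)).1 ht).congr_of_eventuallyEq
      (eventually_coord_divisorBundle k hx t).symm

variable (S) in
/-- The de Rham differential on `𝒪(kS)` off `S`. -/
def deRhamOn : HolConnection ℂ (divisorBundle S k).Fiber ((S : Set X)ᶜ) where
  toFun t x := mvfderiv 𝓘(ℂ, ℂ) (fun y => functionValue S k y (t y)) x
  isCov :=
    { add := fun {σ σ' x} hσ hσ' hx => by
        have hxS : x ∉ S := by simpa using hx
        have h1 := mdifferentiableAt_functionValue k hxS hσ
        have h2 := mdifferentiableAt_functionValue k hxS hσ'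
        have e : (fun y => functionValue S k y ((σ + σ') y)) =
            (fun y => functionValue S k y (σ y)) + fun y => functionValue S k y (σ' y) := by
          ext y; exact mul_add _ _ _
        rw [e]
        exact mvfderiv_add h1 h2
      leibniz := fun {σ g x} hσ hg hx => by
        have hxS : x ∉ S := by simpa using hx
        have h1 := mdifferentiableAt_functionValue k hxS hσ
        have e : (fun y => functionValue S k y ((g • σ) y)) =
            g * fun y => functionValue S k y (σ y) := by
          ext y; exact mul_left_comm _ _ _
        rw [e, mvfderiv_mul hg h1]
        refine ContinuousLinearMap.ext fun v => ?_
        refine congrArg (g x * mvfderiv 𝓘(ℂ, ℂ) (fun y => functionValue S k y (σ y)) x v + ·) ?_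
        change functionValue S k x (σ x) * mvfderiv 𝓘(ℂ, ℂ) g x v =
          mvfderiv 𝓘(ℂ, ℂ) g x v * (show ℂ from σ x)
        rw [functionValue_of_notMem k hxS]
        exact mul_comm _ _ }
  hol W hW hWS s ξ hs hξ := isHolSection_of_contMDiffAt fun x hx => by
    have hxS : ∀ y ∈ W, y ∉ S := fun y hy => by simpa using hWS hy
    refine (contMDiffAt_divisorBundle_iff k (hxS x hx)).2 ?_
    refine (contMDiffAt_mvfderiv hW (g := fun y => functionValue S k y (s y))
      (fun y hy => (contMDiffAt_divisorBundle_iff k (hxS y hy)).1 (hs.contMDiffAt hW hy)) hξ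
      hx).congr_of_eventuallyEq ?_
    filter_upwards [eventually_notMem (hxS x hx)] with y hy
    rw [functionValue_of_notMem k hy]
    rfl

/-- Sections of 𝒪(-mS) are functions divisible by the m-th power of the local equation. The exponent
is non-negative, so the formula holds at p as well as off S. -/
theorem functionValue_eq_mul_coord (m : ℕ) {p x : X} (hp : p ∈ S) (hx : x ∈ divisorBaseSet S p)
    (a : (divisorBundle S (-(m : ℤ))).Fiber x) :
    functionValue S (-(m : ℤ)) x a =
      localEq S p x ^ m * (divisorBundle S (-(m : ℤ))).coord p x a := by
  by_cases h : x = p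
  · subst h
    change localEq S x x ^ (-(-(m : ℤ))) * _ = _
    rw [neg_neg, zpow_natCast, coord_divisorBundle, divisorCoord, if_pos rfl, one_mul]
  · have hS := notMem_of_ne hx h
    rw [coord_divisorBundle_of_notMem _ hS, ← mul_assoc, zpow_neg, zpow_natCast,
      mul_inv_cancel₀ (pow_ne_zero _ (localEq_ne_zero S hx hS)), one_mul]

/-- Near a point of `S`, the contraction of the de Rham differential of a section of `𝒪(-mS)` with
a vector field vanishing on `S` extends holomorphically. -/
theorem exists_extension_deRhamOn (m : ℕ) {W : Set X} (hW : IsOpen W)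
    {s : Π x, (divisorBundle S (-(m : ℤ))).Fiber x} {ξ : Π x : X, TangentSpace 𝓘(ℂ, ℂ) x}
    (hs : IsHolSection ℂ s W) (hξ : IsHolSection ℂ ξ W) {p : X} (hp : p ∈ W) (hpS : p ∈ S)
    (hξp : ξ p = 0) : ∃ g : X → ℂ, ContMDiffAt 𝓘(ℂ, ℂ) 𝓘(ℂ, ℂ) ω g p ∧ ∀ᶠ y in 𝓝 p, y ∉ S →
      (divisorBundle S (-(m : ℤ))).coord p y
        ((deRhamOn S (-(m : ℤ))).toFun s y (ξ y)) = g y := by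
  have hpc := mem_chart_source ℂ p
  set c := chartAt ℂ p
  set σ : X → ℂ := fun y => (divisorBundle S (-(m : ℤ))).coord p y (s y)
  have hWb := hW.inter ((isOpen_divisorBaseSet S p).inter c.open_source)
  have hpW : p ∈ W ∩ (divisorBaseSet S p ∩ c.source) := ⟨hp, mem_divisorBaseSet S p, hpc⟩
  have hσ : ∀ y ∈ W ∩ (divisorBaseSet S p ∩ c.source), ContMDiffAt 𝓘(ℂ, ℂ) 𝓘(ℂ, ℂ) ω σ y :=
    fun y hy => ((divisorBundle S (-(m : ℤ))).contMDiffAt_section_iff (i := p) hy.2.1).1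
      (hs.contMDiffAt hW hy.1)
  have hχ : AnalyticAt ℂ (fun w => chartDeriv p (c.symm w) (ξ (c.symm w))) (c p) :=
    analyticAt_comp_chart_symm (g := fun y => chartDeriv p y (ξ y)) hpc
      ((contMDiffAt_vectorField_iff hpc).1 (hξ.contMDiffAt hW hp))
  -- The vector field vanishes at p, so its coordinate is (z - z(p)) η with η holomorphic.
  obtain ⟨η, hη, hη'⟩ := (natCast_le_analyticOrderAt (n := 1) hχ).1 (by
    rw [Nat.cast_one, Order.one_le_iff_ne_zero]
    refine hχ.analyticOrderAt_ne_zero.2 ?_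
    rw [c.left_inv hpc, hξp, map_zero])
  have hσa := analyticAt_comp_chart_symm hpc (hσ p hpW)
  -- With z centred at p and f = z^m σ, the derivative of f along zη d/dz is z^m η (zσ' + mσ).
  -- Dividing by z^m gives the coordinate in 𝒪(-mS), with no pole left.
  refine ⟨fun y => η (c y) * ((c y - c p) * deriv (fun w => σ (c.symm w)) (c y) + m * σ y), ?_, ?_⟩
  · exact (contMDiffAt_comp_chart hpc hη).mul (((contMDiffAt_comp_chart
      (g := fun w => (w - c p) * deriv (fun w => σ (c.symm w)) w) hpc
      ((analyticAt_id.sub analyticAt_const).mul hσa.deriv))).add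
        (contMDiffAt_const.mul (hσ p hpW)))
  · have hη'' := (c.continuousAt hpc).eventually hη'
    filter_upwards [hη'', hWb.mem_nhds hpW] with y h1 hy hyS
    rw [c.left_inv hy.2.2, pow_one, smul_eq_mul] at h1
    have hloc : ∀ z, localEq S p z = c z - c p := fun z => by simp [localEq, hpS, c]
    have hne : c y - c p ≠ 0 := by rw [← hloc]; exact localEq_ne_zero S hy.2.1 hyS
    have hfv : MDifferentiableAt 𝓘(ℂ, ℂ) 𝓘(ℂ, ℂ)
        (fun y => functionValue S (-(m : ℤ)) y (s y)) y :=
      ((contMDiffAt_divisorBundle_iff _ hyS).1 (hs.contMDiffAt hW hy.1)).mdifferentiableAt (by simp)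
    rw [coord_divisorBundle_of_notMem _ hyS, functionValue_of_notMem _ hyS]
    change _ * mvfderiv 𝓘(ℂ, ℂ) (fun y => functionValue S (-(m : ℤ)) y (s y)) y (ξ y) = _
    rw [mvfderiv_eq_deriv hy.2.2 hfv, h1, hloc]
    have hσy := analyticAt_comp_chart_symm hy.2.2 (hσ y hy)
    have h2 : (fun w => functionValue S (-(m : ℤ)) (c.symm w) (s (c.symm w))) =ᶠ[𝓝 (c y)]
        fun w => (w - c p) ^ m * σ (c.symm w) := by
      have h3 : ∀ᶠ w in 𝓝 (c y), c.symm w ∈ divisorBaseSet S p := by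
        apply (c.continuousAt_symm (c.map_source hy.2.2)).eventually
        rw [c.left_inv hy.2.2]
        exact (isOpen_divisorBaseSet S p).mem_nhds hy.2.1
      filter_upwards [h3, c.open_target.mem_nhds (c.map_source hy.2.2)] with w hw hwt
      rw [functionValue_eq_mul_coord m hpS hw, hloc, c.right_inv hwt]
    have h4 : HasDerivAt (fun w => (w - c p) ^ m * σ (c.symm w)) _ (c y) :=
      (((hasDerivAt_id (c y)).sub_const (c p)).fun_pow m).mul hσy.differentiableAt.hasDerivAt
    rw [h2.deriv_eq, h4.deriv, c.left_inv hy.2.2, zpow_neg, zpow_natCast]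
    simp only [id]
    -- The exponent m - 1 from the power rule is truncated at m = 0, so this case is separate.
    rcases m with _ | m
    · simp; ring
    · simp only [Nat.add_sub_cancel]
      field_simp
      ring

variable (S) in
/-- The logarithmic connection on `𝒪(-mS)` given by the de Rham differential. -/
def deRhamLog (m : ℕ) : LogConnection ℂ (divisorBundle S (-(m : ℤ))).Fiber S where
  toHolConnection := deRhamOn S (-(m : ℤ))
  log W hW s ξ hs hξ hξS := by
    classical
    have hex := fun (p : X) (hp : p ∈ W ∧ p ∈ S) =>
      exists_extension_deRhamOn m hW hs hξ hp.1 hp.2 (hξS p hp.1 hp.2)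
    choose g hg hg' using hex
    -- At a point of S the value is that of the local extension at this point, read in the point's
    -- own frame; elsewhere it is the derivative itself.
    let t : Π x, (divisorBundle S (-(m : ℤ))).Fiber x := fun x =>
      if hx : x ∈ W ∧ x ∈ S then g x hx x else (deRhamOn S (-(m : ℤ))).toFun s x (ξ x)
    have ht : ∀ x, x ∉ S → t x = (deRhamOn S (-(m : ℤ))).toFun s x (ξ x) := fun x hx => by
      simp [t, hx]
    refine ⟨t, isHolSection_of_contMDiffAt fun x hx => ?_, fun x _ hx => ht x hx⟩
    by_cases hxS : x ∈ S
    · refine ((divisorBundle S (-(m : ℤ))).contMDiffAt_section_iff (i := x)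
        (mem_divisorBaseSet S x)).2 ((hg x ⟨hx, hxS⟩).congr_of_eventuallyEq ?_)
      filter_upwards [hg' x ⟨hx, hxS⟩,
        (isOpen_divisorBaseSet S x).mem_nhds (mem_divisorBaseSet S x)] with y h1 h2
      by_cases hy : y = x
      · subst hy
        refine ((divisorBundle S (-(m : ℤ))).coord_indexAt y (t y)).trans ?_
        simp [t, hx, hxS]
      · have hyS := notMem_of_ne h2 hy
        rw [ht y hyS, h1 hyS]
    · have hWS := hW.inter S.finite_toSet.isClosed.isOpen_compl
      have hx' : x ∈ W ∩ (S : Set X)ᶜ := ⟨hx, by simpa using hxS⟩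
      refine (((deRhamOn S (-(m : ℤ))).hol _ hWS Set.inter_subset_right s ξ
        (hs.mono Set.inter_subset_left) (hξ.mono Set.inter_subset_left)).congr
          fun y hy => ?_).contMDiffAt hWS hx'
      exact ht y (by simpa using hy.2)

theorem isDeRham_deRhamLog (m : ℕ) : IsDeRham (deRhamLog S m) := by
  intro W _ hWS t _ x hx v
  rw [functionValue_of_notMem _ (show x ∉ S by simpa using hWS hx)]
  rfl

end DeRham

/-! ### Top exterior powers and the uniqueness of isomorphisms up to constants -/

section Determinant

/-- A linear form on the top exterior power is determined by its value on a basis. -/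
theorem linearForm_ιMulti {r : ℕ} {M : Type*} [AddCommGroup M] [Module ℂ M]
    (b : Module.Basis (Fin r) ℂ M) (φ : ⋀[ℂ]^r M →ₗ[ℂ] ℂ) (v : Fin r → M) :
    φ (exteriorPower.ιMulti ℂ r v) =
      φ (exteriorPower.ιMulti ℂ r b) * (Matrix.of fun i j => b.repr (v j) i).det := by
  have h := DFunLike.congr_fun
    ((φ.compAlternatingMap (exteriorPower.ιMulti ℂ r)).eq_smul_basis_det b) v
  exact h

/-- The determinant, as an isomorphism. -/
def detEquiv (r : ℕ) : ⋀[ℂ]^r (Fin r → ℂ) ≃ₗ[ℂ] ℂ :=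
  LinearEquiv.ofBijective
    (exteriorPower.alternatingMapLinearEquiv (Pi.basisFun ℂ (Fin r)).det) <| by
    have hs : Function.Surjective
        (exteriorPower.alternatingMapLinearEquiv (Pi.basisFun ℂ (Fin r)).det) := fun c =>
      ⟨c • exteriorPower.ιMulti ℂ r (Pi.basisFun ℂ (Fin r)), by
        rw [map_smul, exteriorPower.alternatingMapLinearEquiv_apply_ιMulti,
          Module.Basis.det_self, smul_eq_mul, mul_one]⟩
    refine ⟨(LinearMap.injective_iff_surjective_of_finrank_eq_finrank ?_).2 hs, hs⟩
    rw [exteriorPower.finrank_eq, Module.finrank_fin_fun, Nat.choose_self, Module.finrank_self]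

theorem detEquiv_ιMulti {r : ℕ} (v : Fin r → Fin r → ℂ) :
    detEquiv r (exteriorPower.ιMulti ℂ r v) = (Matrix.of fun i j => v j i).det :=
  exteriorPower.alternatingMapLinearEquiv_apply_ιMulti _ v

end Determinant

section DetIsoUnique

variable {X : Type u} [TopologicalSpace X] [ChartedSpace ℂ X]
variable {r : ℕ} (E : HolBundle X (Fin r → ℂ)) (M : HolLine X)

/-- The local section with constant coordinates in the frame preferred at `p`. -/
def constSection (p : X) (a : Fin r → ℂ) (y : X) : E.Fiber y :=
  E.core.coordChange (E.core.indexAt p) (E.core.indexAt y) y a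

theorem isHolSection_constSection (p : X) (a : Fin r → ℂ) :
    IsHolSection (Fin r → ℂ) (constSection E p a) (E.core.baseSet (E.core.indexAt p)) :=
  isHolSection_of_contMDiffAt fun x hx => by
    refine (E.contMDiffAt_section_iff hx).2 ?_
    refine (contMDiffAt_const (c := a)).congr_of_eventuallyEq ?_
    filter_upwards [(E.core.isOpen_baseSet _).mem_nhds hx] with y hy
    exact (E.core.coordChange_comp (E.core.indexAt p) (E.core.indexAt y) (E.core.indexAt p) y
      ⟨⟨hy, E.core.mem_baseSet_at y⟩, hy⟩ a).trans (E.core.coordChange_self _ y hy a)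

theorem wedge_constSection_ne_zero (p : X) :
    wedge (fun j : Fin r => constSection E p (Pi.single j 1)) p ≠ 0 := by
  intro h
  have h1 : exteriorPower.ιMulti ℂ r (Pi.basisFun ℂ (Fin r)) = (0 : ⋀[ℂ]^r (Fin r → ℂ)) := by
    refine Eq.trans (congrArg (exteriorPower.ιMulti ℂ r) (funext fun j => ?_)) h
    rw [Pi.basisFun_apply]
    exact (E.core.coordChange_self _ p (E.core.mem_baseSet_at p) _).symm
  have h2 := detEquiv_ιMulti (Pi.basisFun ℂ (Fin r))
  rw [h1, map_zero] at h2
  exact one_ne_zero ((Module.Basis.det_self (Pi.basisFun ℂ (Fin r))).symm.trans h2.symm)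

variable {E M}

/-- The ratio of two isomorphisms of the determinant with a line bundle is holomorphic. -/
theorem DetIso.contMDiffAt_ratio [IsManifold 𝓘(ℂ, ℂ) ω X]
    (θ θ₀ : DetIso (Fin r → ℂ) E.Fiber r M.Fiber) {g : X → ℂ}
    (hg : ∀ x a, θ.toEquiv x a = g x • θ₀.toEquiv x a) (p : X) :
    ContMDiffAt 𝓘(ℂ, ℂ) 𝓘(ℂ, ℂ) ω g p := by
  -- A local frame has non-zero wedge at p, so near p the ratio is a quotient of two holomorphic
  -- functions with non-vanishing denominator.
  set e : Fin r → Π y, E.Fiber y := fun j => constSection E p (Pi.single j 1) with he'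
  have hW := E.core.isOpen_baseSet (E.core.indexAt p)
  have hp := E.core.mem_baseSet_at p
  have he : ∀ j, IsHolSection (Fin r → ℂ) (e j) (E.core.baseSet (E.core.indexAt p)) :=
    fun j => isHolSection_constSection E p _
  have hpM := M.core.mem_baseSet_at p
  have h1 := (M.contMDiffAt_section_iff hpM).1 ((θ.hol _ hW e he).contMDiffAt hW hp)
  have h2 := (M.contMDiffAt_section_iff hpM).1 ((θ₀.hol _ hW e he).contMDiffAt hW hp)
  have h3 : M.coord (M.core.indexAt p) p (θ₀.toEquiv p (wedge e p)) ≠ 0 := fun h0 =>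
    wedge_constSection_ne_zero E p ((θ₀.toEquiv p).map_eq_zero_iff.1
      (M.coord_injective hpM (h0.trans (map_zero _).symm)))
  refine (h1.mul (contMDiffAt_inv_of_ne_zero h2 h3)).congr_of_eventuallyEq ?_
  filter_upwards [h2.continuousAt.eventually_ne h3] with y hy
  have h4 : M.coord (M.core.indexAt p) y (θ.toEquiv y (wedge e y)) =
      g y * M.coord (M.core.indexAt p) y (θ₀.toEquiv y (wedge e y)) := by
    rw [hg y, map_smul, smul_eq_mul]
  rw [Pi.mul_apply, h4, mul_assoc, mul_inv_cancel₀ hy, mul_one]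

/-- Two isomorphisms of the determinant with a line bundle are proportional at each point. -/
theorem DetIso.exists_ratio (θ θ₀ : DetIso (Fin r → ℂ) E.Fiber r M.Fiber) :
    ∃ g : X → ℂ, ∀ x a, θ.toEquiv x a = g x • θ₀.toEquiv x a := by
  -- The fibres are one-dimensional, and the ratio is the value of θ ∘ θ₀⁻¹ at the frame vector 1.
  refine ⟨fun x => θ.toEquiv x ((θ₀.toEquiv x).symm (show M.Fiber x from (1 : ℂ))), fun x a => ?_⟩
  have h1 : a = (show ℂ from θ₀.toEquiv x a) •
      (θ₀.toEquiv x).symm (show M.Fiber x from (1 : ℂ)) := by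
    apply (θ₀.toEquiv x).injective
    rw [map_smul, LinearEquiv.apply_symm_apply]
    exact (mul_one (show ℂ from θ₀.toEquiv x a)).symm
  conv_lhs => rw [h1, map_smul]
  exact mul_comm (show ℂ from θ₀.toEquiv x a) _

/-- Two isomorphisms of the determinant with a line bundle differ by a constant. -/
theorem DetIso.exists_eq_smul [CompactSpace X] [PreconnectedSpace X] [Nonempty X]
    [IsManifold 𝓘(ℂ, ℂ) ω X] (θ θ₀ : DetIso (Fin r → ℂ) E.Fiber r M.Fiber) :
    ∃ c : ℂ, ∀ x a, θ.toEquiv x a = c • θ₀.toEquiv x a := by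
  obtain ⟨g, hg⟩ := θ.exists_ratio θ₀
  have hhol : MDifferentiable 𝓘(ℂ, ℂ) 𝓘(ℂ, ℂ) g := fun p =>
    (θ.contMDiffAt_ratio θ₀ hg p).mdifferentiableAt (by simp)
  have : IsManifold 𝓘(ℂ, ℂ) 1 X := .of_le (n := ω) le_top
  -- Compactness and connectedness enter here, through the maximum principle.
  obtain ⟨c, hc⟩ := hhol.exists_eq_const_of_compactSpace
  exact ⟨c, fun x a => by rw [hg x a, hc, Function.const_apply]⟩

end DetIsoUnique

theorem mvfderiv_congr {X : Type u} [TopologicalSpace X] [ChartedSpace ℂ X] {f g : X → ℂ} {x : X}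
    (h : f =ᶠ[𝓝 x] g) : mvfderiv 𝓘(ℂ, ℂ) f x = mvfderiv 𝓘(ℂ, ℂ) g x :=
  ContinuousLinearMap.ext fun v =>
    congrArg (fun l : TangentSpace 𝓘(ℂ, ℂ) x →L[ℂ] ℂ => l v) h.mfderiv_eq

/-! ### The isomorphism of det E with 𝒪(-mS) -/

section Oper

variable {X : Type u} [TopologicalSpace X] [ChartedSpace ℂ X] [T1Space X]
  [IsManifold 𝓘(ℂ, ℂ) ω X]
variable {r : ℕ} {S : Finset X} {L : HolLine X} {V : X → Type v}
    [TopologicalSpace (TotalSpace (Fin r → ℂ) V)] [∀ x, AddCommGroup (V x)] [∀ x, Module ℂ (V x)]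
    [∀ x, TopologicalSpace (V x)] [∀ x, IsTopologicalAddGroup (V x)]
    [∀ x, ContinuousSMul ℂ (V x)] [FiberBundle (Fin r → ℂ) V] [VectorBundle ℂ (Fin r → ℂ) V]
    [ContMDiffVectorBundle ω (Fin r → ℂ) V 𝓘(ℂ, ℂ)]

namespace AdaptedFrame

variable {O : BranchedOper r S L V} {p : X} (A : AdaptedFrame O p)

/-- The value of the trivialization of the determinant on the frame. -/
def volume (x : X) : ℂ := O.triv.toEquiv x (wedge (fun j y => (A.f j y : V y)) x)

theorem contMDiffAt_volume {x : X} (hx : x ∈ A.W) :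
    ContMDiffAt 𝓘(ℂ, ℂ) 𝓘(ℂ, ℂ) ω A.volume x :=
  contMDiffAt_trivial_section_iff.1
    ((O.triv.hol A.W A.isOpen (fun j y => A.f j y) A.hol).contMDiffAt A.isOpen hx)

theorem triv_ιMulti {x : X} (hx : x ∈ A.W) (v : Fin r → V x) :
    O.triv.toEquiv x (exteriorPower.ιMulti ℂ r v) =
      A.volume x * (Matrix.of fun i j => A.coeff x (v j) i).det := by
  have h := linearForm_ιMulti (A.isLocalFrameOn.toBasisAt hx)
    (show ⋀[ℂ]^r (V x) →ₗ[ℂ] ℂ from (O.triv.toEquiv x).toLinearMap) v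
  have h1 : ∀ i j, (A.isLocalFrameOn.toBasisAt hx).repr (v j) i = A.coeff x (v j) i := fun i j => by
    change _ = A.isLocalFrameOn.coeff i x (v j)
    simp [IsLocalFrameOn.coeff, hx]
  have h2 : ⇑(A.isLocalFrameOn.toBasisAt hx) = fun j => (A.f j x : V x) :=
    funext fun j => A.isLocalFrameOn.toBasisAt_coe hx j
  simp only [h1] at h
  rw [h2] at h
  exact h

/-- Were it zero, the trivialization would vanish on all of the top exterior power, although it is
surjective. -/
theorem volume_ne_zero {x : X} (hx : x ∈ A.W) : A.volume x ≠ 0 := by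
  intro h
  have h1 : ∀ a, O.triv.toEquiv x a = 0 := by
    intro a
    have h2 : (O.triv.toEquiv x).toLinearMap = 0 := by
      refine exteriorPower.linearMap_ext (AlternatingMap.ext fun v => ?_)
      refine (A.triv_ιMulti hx v).trans ?_
      rw [h, zero_mul]
      rfl
    exact DFunLike.congr_fun h2 a
  have h3 := h1 ((O.triv.toEquiv x).symm (1 : ℂ))
  rw [LinearEquiv.apply_symm_apply] at h3
  exact one_ne_zero h3

theorem det_jet (hr : 2 ≤ r) {x : X} (hx : x ∈ A.W) (v : Fin r → V x) :
    (Matrix.of fun i j => A.jet x (v j) i).det = localEq S p x ^ (r * (r - 1) / 2) * A.unit x *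
      (Matrix.of fun i j => A.coeff x (v j) i).det := by
  rw [← A.det_jetMat hr hx, ← Matrix.det_mul]
  congr 1
  ext i j
  exact (congrFun (A.jetMat_mulVec hx (v j)) i).symm

/-- The factor which compares the trivialization of `⋀^r V` with the determinant of the coordinates
in `E`. -/
def factor (x : X) : ℂ := A.volume x * (A.unit x)⁻¹

theorem factor_ne_zero {x : X} (hx : x ∈ A.W) : A.factor x ≠ 0 :=
  mul_ne_zero (A.volume_ne_zero hx) (inv_ne_zero (A.unit_ne_zero hx))

theorem contMDiffAt_factor {x : X} (hx : x ∈ A.W) :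
    ContMDiffAt 𝓘(ℂ, ℂ) 𝓘(ℂ, ℂ) ω A.factor x :=
  (A.contMDiffAt_volume hx).mul (contMDiffAt_inv_of_ne_zero (A.contMDiffAt_unit hx)
    (A.unit_ne_zero hx))

theorem triv_ιMulti_eq_det_jet (hr : 2 ≤ r) {x : X} (hx : x ∈ A.W) (v : Fin r → V x) :
    localEq S p x ^ (r * (r - 1) / 2) *
        (show ℂ from O.triv.toEquiv x (exteriorPower.ιMulti ℂ r v)) =
      A.factor x * (Matrix.of fun i j => A.jet x (v j) i).det := by
  have h := A.triv_ιMulti hx v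
  rw [A.det_jet hr hx]
  refine (congrArg (localEq S p x ^ (r * (r - 1) / 2) * ·) h).trans ?_
  have := A.unit_ne_zero hx
  unfold factor
  field_simp

end AdaptedFrame

/-- The matrix of the coordinates of `r` vectors of `E`, in the frame preferred at `p`. -/
def twistMatrix (r : ℕ) (S : Finset X) (L : HolLine X) (p x : X)
    (t : Fin r → (jetTwist r S L).Fiber x) : Matrix (Fin r) (Fin r) ℂ :=
  Matrix.of fun i j => (jetTwist r S L).coord ((jetTwist r S L).core.indexAt p) x (t j) i

namespace BranchedOper

variable (O : BranchedOper r S L V) (hr : 2 ≤ r)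

/-- Passing to E multiplies each of the r coordinates of a jet by the power -(r-1) of the local
equation, hence the determinant by the power -r(r-1). -/
theorem det_twistMatrix {p x : X} (hx : x ∈ (O.frame hr p).W) (hS : x ∉ S)
    (t : Fin r → (jetTwist r S L).Fiber x) :
    localEq S p x ^ (r * (r - 1)) * (twistMatrix r S L p x t).det =
      (Matrix.of fun i j => (O.frame hr p).jet x (O.fromTwist hr x (t j)) i).det := by
  have hne := localEq_ne_zero S ((O.frame hr p).sub_divisor hx) hS
  have h1 : twistMatrix r S L p x t = localEq S p x ^ (-((r - 1 : ℕ) : ℤ)) •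
      Matrix.of fun i j => (O.frame hr p).jet x (O.fromTwist hr x (t j)) i := by
    ext i j
    have h2 := coord_twist_divisorBundle (jetBundle (topLine r S L) r) (r - 1)
      ((jetBundle (topLine r S L) r).core.indexAt p) p hS (t j)
    rw [← O.jetHom_fromTwist hr hS, O.coord_jetHom hr hx] at h2
    exact congrFun h2 i
  rw [h1, Matrix.det_smul, Fintype.card_fin, zpow_neg, zpow_natCast, ← mul_assoc, inv_pow,
    ← pow_mul, mul_comm (r - 1), mul_inv_cancel₀ (pow_ne_zero _ hne), one_mul]

/-- With m = r(r-1)/2, the determinant of Φ contributes the power -m of the local equation and the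
twist the power 2m. The surviving power m is the reason why det E is 𝒪(-mS). -/
theorem triv_fromTwist {p x : X} (hx : x ∈ (O.frame hr p).W) (hS : x ∉ S)
    (t : Fin r → (jetTwist r S L).Fiber x) :
    O.triv.toEquiv x (exteriorPower.ιMulti ℂ r fun j => O.fromTwist hr x (t j)) =
      localEq S p x ^ (r * (r - 1) / 2) *
        ((O.frame hr p).factor x * (twistMatrix r S L p x t).det) := by
  have hne := localEq_ne_zero S ((O.frame hr p).sub_divisor hx) hS
  have h := (O.frame hr p).triv_ιMulti_eq_det_jet hr hx fun j => O.fromTwist hr x (t j)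
  have h2 : r * (r - 1) = r * (r - 1) / 2 + r * (r - 1) / 2 := by
    have : 2 ∣ r * (r - 1) := (Nat.even_mul_pred_self r).two_dvd
    omega
  rw [← O.det_twistMatrix hr hx hS] at h
  refine mul_left_cancel₀ (pow_ne_zero (r * (r - 1) / 2) hne) (h.trans ?_)
  conv_lhs => rw [h2, pow_add]
  ring

/-- The isomorphism of `det E` with `𝒪(-mS)`, `m = r(r-1)/2`, given by `det V ≅ 𝒪`. -/
def detTwistEquiv (x : X) : ⋀[ℂ]^r ((jetTwist r S L).Fiber x) ≃ₗ[ℂ]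
    (divisorBundle S (-((r * (r - 1) / 2 : ℕ) : ℤ))).Fiber x :=
  -- In the frames preferred at x the map is the determinant times the unit `factor`, which makes
  -- sense over S too.
  ((detEquiv r).trans (LinearEquiv.smulOfNeZero ℂ ℂ ((O.frame hr x).factor x)
    ((O.frame hr x).factor_ne_zero (O.frame hr x).mem)) : ⋀[ℂ]^r (Fin r → ℂ) ≃ₗ[ℂ] ℂ)

theorem detTwistEquiv_ιMulti (x : X) (t : Fin r → (jetTwist r S L).Fiber x) :
    O.detTwistEquiv hr x (exteriorPower.ιMulti ℂ r t) =
      (O.frame hr x).factor x * (twistMatrix r S L x x t).det := by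
  have h : twistMatrix r S L x x t = Matrix.of fun i j => (show Fin r → ℂ from t j) i := by
    ext i j
    exact congrFun ((jetTwist r S L).coord_indexAt x (t j)) i
  rw [h]
  exact congrArg ((O.frame hr x).factor x * ·)
    (detEquiv_ιMulti fun j => (show Fin r → ℂ from t j))

theorem detTwistEquiv_eq_triv {x : X} (hS : x ∉ S) (t : Fin r → (jetTwist r S L).Fiber x) :
    O.detTwistEquiv hr x (exteriorPower.ιMulti ℂ r t) =
      (show ℂ from O.triv.toEquiv x
        (exteriorPower.ιMulti ℂ r fun j => O.fromTwist hr x (t j))) := by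
  refine (O.detTwistEquiv_ιMulti hr x t).trans ?_
  refine Eq.trans ?_ (O.triv_fromTwist hr (O.frame hr x).mem hS t).symm
  rw [localEq_self_of_notMem hS, one_pow, one_mul]

/-- Since `detTwistEquiv` uses a different adapted frame at each point, its holomorphy is not
apparent. At x = p the formula is the definition. Every other x in the domain lies off S, where both
sides are the trivialization of det V, independent of frames, read in the frame of 𝒪(-mS) at p. -/
theorem coord_detTwistEquiv {p x : X} (hx : x ∈ (O.frame hr p).W)
    (t : Fin r → (jetTwist r S L).Fiber x) :
    (divisorBundle S (-((r * (r - 1) / 2 : ℕ) : ℤ))).coord p x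
      (O.detTwistEquiv hr x (exteriorPower.ιMulti ℂ r t)) =
      (O.frame hr p).factor x * (twistMatrix r S L p x t).det := by
  by_cases h : x = p
  · subst h
    exact ((divisorBundle S _).coord_indexAt x _).trans (O.detTwistEquiv_ιMulti hr x t)
  · have hS := notMem_of_ne ((O.frame hr p).sub_divisor hx) h
    have hne := localEq_ne_zero S ((O.frame hr p).sub_divisor hx) hS
    rw [coord_divisorBundle_of_notMem _ hS, functionValue_of_notMem _ hS]
    refine (congrArg (localEq S p x ^ (-((r * (r - 1) / 2 : ℕ) : ℤ)) * ·)
      ((O.detTwistEquiv_eq_triv hr hS t).trans (O.triv_fromTwist hr hx hS t))).trans ?_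
    rw [zpow_neg, zpow_natCast, ← mul_assoc, inv_mul_cancel₀ (pow_ne_zero _ hne), one_mul]

/-- The isomorphism `det E ≅ 𝒪(-mS)`, `m = r(r-1)/2`, given by `det V ≅ 𝒪`. -/
def detTwist : DetIso (Fin r → ℂ) (jetTwist r S L).Fiber r
    (divisorBundle S (-((r * (r - 1) / 2 : ℕ) : ℤ))).Fiber where
  toEquiv := O.detTwistEquiv hr
  hol W hW s hs := isHolSection_of_contMDiffAt fun p hp => by
    refine ((divisorBundle S _).contMDiffAt_section_iff (i := p) (mem_divisorBaseSet S p)).2 ?_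
    have h1 : ∀ i j, ContMDiffAt 𝓘(ℂ, ℂ) 𝓘(ℂ, ℂ) ω
        (fun y => twistMatrix r S L p y (fun j => s j y) i j) p := fun i j =>
      contMDiffAt_pi_space.1 (((jetTwist r S L).contMDiffAt_section_iff
        ((jetTwist r S L).core.mem_baseSet_at p)).1 ((hs j).contMDiffAt hW hp)) i
    refine (((O.frame hr p).contMDiffAt_factor (O.frame hr p).mem).mul
      (contMDiffAt_det h1)).congr_of_eventuallyEq ?_
    filter_upwards [(O.frame hr p).isOpen.mem_nhds (O.frame hr p).mem] with y hy
    exact O.coord_detTwistEquiv hr hy fun j => s j y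

/-- The isomorphism `det E ≅ 𝒪(-mS)` carries the induced connection to the de Rham differential. -/
theorem carries_detTwist
    (D' : HolConnection (Fin r → ℂ) (jetTwist r S L).Fiber ((S : Set X)ᶜ))
    (hD' : O.IsTransport (O.jetHom hr) D') :
    (O.detTwist hr).Carries D' (deRhamLog S (r * (r - 1) / 2)).toFun := by
  intro W hW hWS s hs x hx v
  have hxS : ∀ y ∈ W, y ∉ S := fun y hy => by simpa using hWS hy
  have hs' : ∀ j, IsHolSection (Fin r → ℂ) (fun y => O.fromTwist hr y (s j y)) W := fun j =>
    O.isHolSection_fromTwist hr hW hWS (hs j)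
  -- The transport condition compares the two derivatives after Φ, and Φ is injective off S.
  have h1 : ∀ j, O.fromTwist hr x (D'.toFun (s j) x v) =
      O.D.toFun (fun y => O.fromTwist hr y (s j y)) x v := fun j => by
    apply (O.jetHom_bijective hr (hxS x hx)).1
    rw [O.jetHom_fromTwist hr (hxS x hx)]
    exact (hD' W hW hWS _ (s j) (hs' j) (hs j)
      (fun y hy => O.jetHom_fromTwist hr (hxS y hy) (s j y)) x hx v).symm
  have h2 := O.det_eq W hW (Set.subset_univ W) (fun j y => O.fromTwist hr y (s j y)) hs' x hx v
  have h3 : (O.detTwist hr).toEquiv x (D'.wedgeDeriv s x v) =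
      (show ℂ from O.triv.toEquiv x
        (O.D.wedgeDeriv (fun j y => O.fromTwist hr y (s j y)) x v)) := by
    unfold HolConnection.wedgeDeriv
    rw [map_sum, map_sum]
    refine Finset.sum_congr rfl fun j _ => ?_
    refine (O.detTwistEquiv_eq_triv hr (hxS x hx) _).trans ?_
    refine congrArg (fun w => (show ℂ from O.triv.toEquiv x (exteriorPower.ιMulti ℂ r w))) ?_
    funext i
    by_cases hij : i = j
    · subst hij
      rw [Function.update_self, Function.update_self, h1]
    · rw [Function.update_of_ne hij, Function.update_of_ne hij]
  refine h3.trans (h2.trans ?_)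
  -- Both sides are now differentials of functions which agree on W, so the claim reduces to the
  -- corresponding property of det V.
  change mvfderiv 𝓘(ℂ, ℂ) (fun y => (show ℂ from O.triv.toEquiv y _)) x v =
    mvfderiv 𝓘(ℂ, ℂ) (fun y => functionValue S _ y ((O.detTwist hr).toEquiv y (wedge s y))) x v
  refine congrArg (fun l : TangentSpace 𝓘(ℂ, ℂ) x →L[ℂ] ℂ => l v)
    (mvfderiv_congr ?_)
  filter_upwards [hW.mem_nhds hx] with y hy
  rw [functionValue_of_notMem _ (hxS y hy)]
  exact (O.detTwistEquiv_eq_triv hr (hxS y hy) fun j => s j y).symm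

end BranchedOper

end Oper

/-! ### Independence of the choice of isomorphism, and conclusion -/

section Scaling

variable {X : Type u} [TopologicalSpace X] [ChartedSpace ℂ X] [T1Space X]
  [IsManifold 𝓘(ℂ, ℂ) ω X] {r : ℕ} {S : Finset X} {E : HolBundle X (Fin r → ℂ)} {m : ℕ}

/-- Whether an isomorphism carries a connection to the de Rham differential does not change on
scaling. -/
theorem carries_deRhamLog_of_eq_smul {D : HolConnection (Fin r → ℂ) E.Fiber ((S : Set X)ᶜ)}
    {θ θ₀ : DetIso (Fin r → ℂ) E.Fiber r (divisorBundle S (-(m : ℤ))).Fiber} {c : ℂ}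
    (hc : ∀ x a, θ.toEquiv x a = c • θ₀.toEquiv x a) (h : θ₀.Carries D (deRhamLog S m).toFun) :
    θ.Carries D (deRhamLog S m).toFun := by
  intro W hW hWS s hs x hx v
  rw [hc, h W hW hWS s hs x hx v]
  have e : (fun y => θ.toEquiv y (wedge s y)) = c • fun y => θ₀.toEquiv y (wedge s y) :=
    funext fun y => hc y _
  rw [e, (deRhamLog S m).isCov.smul_const c
    (((θ₀.hol W hW s hs).contMDiffAt hW hx).mdifferentiableAt (by simp))
    (show x ∈ (S : Set X)ᶜ from hWS hx)]
  rfl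

end Scaling

end

end HolGeom

theorem lemma4 {X : Type*} [TopologicalSpace X] [T2Space X] [CompactSpace X]
    [ConnectedSpace X] [ChartedSpace ℂ X] [IsManifold 𝓘(ℂ, ℂ) ω X]
    (S : Finset X) (r : ℕ) (hr : 2 ≤ r) (L : HolGeom.HolLine X)
    (hL : Even r → Nonempty (HolGeom.HolIso ℂ ℂ
      (HolGeom.HolBundle.pow L 2).Fiber (HolGeom.tangentTwist S).Fiber))
    {V : X → Type*} [TopologicalSpace (TotalSpace (Fin r → ℂ) V)]
    [∀ x, AddCommGroup (V x)] [∀ x, Module ℂ (V x)] [∀ x, TopologicalSpace (V x)]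
    [∀ x, IsTopologicalAddGroup (V x)] [∀ x, ContinuousSMul ℂ (V x)]
    [FiberBundle (Fin r → ℂ) V] [VectorBundle ℂ (Fin r → ℂ) V]
    [ContMDiffVectorBundle ω (Fin r → ℂ) V 𝓘(ℂ, ℂ)]
    (O : HolGeom.BranchedOper r S L V) :
    ∃ Φ : HolGeom.HolHom (Fin r → ℂ) (Fin r → ℂ) V
        (HolGeom.jetBundle (HolGeom.topLine r S L) r).Fiber,
      O.IsFlatJetMap Φ ∧
      (∀ x, x ∉ S → Function.Bijective (Φ.toFun x)) ∧
      (∃ D' : HolGeom.HolConnection (Fin r → ℂ) (HolGeom.jetTwist r S L).Fiber ((S : Set X)ᶜ),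
        O.IsTransport Φ D') ∧
      Nonempty (HolGeom.DetIso (Fin r → ℂ) (HolGeom.jetTwist r S L).Fiber r
        (HolGeom.divisorBundle S (-((r * (r - 1) / 2 : ℕ) : ℤ))).Fiber) ∧
      ∃ δ : HolGeom.LogConnection ℂ
          (HolGeom.divisorBundle S (-((r * (r - 1) / 2 : ℕ) : ℤ))).Fiber S,
        HolGeom.IsDeRham δ ∧
        ∀ D' : HolGeom.HolConnection (Fin r → ℂ) (HolGeom.jetTwist r S L).Fiber ((S : Set X)ᶜ),
          O.IsTransport Φ D' →
          ∀ θ : HolGeom.DetIso (Fin r → ℂ) (HolGeom.jetTwist r S L).Fiber r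
            (HolGeom.divisorBundle S (-((r * (r - 1) / 2 : ℕ) : ℤ))).Fiber,
            θ.Carries D' δ.toFun := by
  refine ⟨O.jetHom hr, O.isFlatJetMap_jetHom hr, fun x hx => O.jetHom_bijective hr hx,
    ⟨O.twistConnection hr, O.isTransport_twistConnection hr⟩, ⟨O.detTwist hr⟩,
    HolGeom.deRhamLog S (r * (r - 1) / 2), HolGeom.isDeRham_deRhamLog _, fun D' hD' θ => ?_⟩
  -- An arbitrary isomorphism is a constant multiple of `detTwist`, for which the claim is known.
  obtain ⟨c, hc⟩ := θ.exists_eq_smul (O.detTwist hr)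
  exact HolGeom.carries_deRhamLog_of_eq_smul hc (O.carries_detTwist hr D' hD')
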